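/- **Setting.** Let $D\subset\mathbb R^d$ be compact and let $k:D\times D\to\mathbb R$ be a continuous kernel with $k(x,x)\le 1$ and reproducing kernel Hilbert space $H$. Let $\lambda>0$, $R,B\ge 0$, and let $f_1,\dots,f_T\in H$ be fixed functions with $\|f_t\|_H\le B$ and $\sum_{t=1}^{T-1}\|f_{t+1}-f_t\|_H\le B_T$. In round $t$ an action $x_t\in D$ is chosen and $y_t=f_t(x_t)+\epsilon_t$ is observed, where $\mathbb E[e^{r\epsilon_t}\mid x_1,y_1,\dots,x_{t-1},y_{t-1},x_t]\le e^{r^2R^2/2}$ for all $r\in\mathbb R$. The dynamic regret is $R_T=\sum_{t=1}^T\big(\max_D f_t-f_t(x_t)\big)$. **Algorithm (WGP-UCB).** Let $0<\eta<1$, $w_s=\eta^{-s}$, $\lambda_t=\lambda w_t$ and $\alpha_t=\lambda w_t^2$. After $t$ rounds put $W=\mathrm{diag}(\sqrt{w_1},\dots,\sqrt{w_t})$, $K_t=(k(x_i,x_j))_{i,j\le t}$, $\tilde K_t=WK_tW$, $\tilde k_t(x)=W(k(x_i,x))_{i\le t}$, and $$\tilde\mu_t(x)=\tilde k_t(x)^\top(\tilde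 K_t+\lambda_tI)^{-1}Wy_{1:t},\qquad \tilde\sigma_t^2(x)=k(x,x)-\tilde k_t(x)^\top(\tilde K_t+\lambda_tI)^{-1}\tilde k_t(x).$$ For $\delta\in(0,1)$ the algorithm is run with confidence parameter $\delta/T$: it plays $x_{t+1}\in\arg\max_{x\in D}\tilde\mu_t(x)+\beta_t\tilde\sigma_t(x)$, where $$\beta_t=B+\frac{R}{\sqrt\lambda}\sqrt{2\log(T/\delta)+2\bar\gamma_t},\qquad \bar\gamma_t=\max_{a\in D^t}\tfrac12\log\det\big(I+\alpha_t^{-1}(w_iw_jk(a_i,a_j))_{i,j\le t}\big).$$ **Features and tuning.** For $m\in\mathbb N$ let $\breve\varphi_m$ be a map from $D$ to a Euclidean space of dimension at most $2m^d$, and suppose that for some $C_0$ and all $m\ge 1$ $$\sup_{x,y\in D}|k(x,y)-\breve\varphi_m(x)^\top\breve\varphi_m(y)|\le C_0(e/4)^m .\tag{1}$$ Put $\breve\gamma_T=\max_{a\in D^T}\tfrac12\log\det\big(I+\lambda_T^{-1}(\sqrt{w_iw_j}\,\breve\varphi_{\bar m}(a_i)^\top\breve\varphi_{\bar m}(a_j))_{i,j\le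 T}\big)$ and $\dot\gamma_T=\max\{\bar\gamma_T,\breve\gamma_T\}$. The discount factor $\eta\in(0,1)$ and the integer $\bar m\ge 1$ are chosen jointly, with $\dot\gamma_T$ taken for the same $\eta$ and $\bar m$, so that $\bar m=\log_{4/e}(T^3\dot\gamma_T^{3/2})$ up to rounding (an error of at most $1$) and $\eta$ is given by (a) or (b) below. **Claim.** For every $b>0$ there are a constant $C$ and an integer $p$, depending only on $b,\lambda,R,B,d,D,k,C_0$ and the feature maps (not on $T$, $\delta$, $B_T$, $\eta$, $\bar m$, the functions $f_t$ or the noise), such that for all $T\ge1$ and $\delta\in(0,1)$, with probability at least $1-\delta$: (a) ($B_T$ known) if $B_T\ge b/T$ and $\eta=1-\dot\gamma_T^{-1/4}B_T^{1/2}T^{-1/2}$, then $R_T\le C\,(1+\log(T/\delta))^p\,\dot\gamma_T^{7/8}B_T^{1/4}T^{3/4}$; (b) ($B_T$ unknown) if $B_T\ge b$ and $\eta=1-\dot\gamma_T^{-1/4}T^{-1/2}$, then $R_T\le C\,(1+\log(T/\delta))^p\,\dot\gamma_T^{7/8}B_T\,T^{3/4}$. Moreover the same holds, without assuming (1), for $D=[0,1]^d$,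 the squared exponential kernel $k(x,y)=e^{-\|x-y\|_2^2/(2l^2)}$ with $l>0$, and its quadrature Fourier features: with $H_n$ the physicists' Hermite polynomials, $\rho$ ranging over the $d$-tuples of roots of $H_{\bar m}$, and $v(\rho)=\prod_{j=1}^d\frac{2^{\bar m-1}\bar m!}{\bar m^2H_{\bar m-1}(\rho_j)^2}$, the coordinates of $\breve\varphi_{\bar m}(x)$ are $\sqrt{v(\rho)}\cos(\tfrac{\sqrt2}{l}\rho^\top x)$ and $\sqrt{v(\rho)}\sin(\tfrac{\sqrt2}{l}\rho^\top x)$. -/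

import Mathlib

open MeasureTheory

universe u v

namespace WGP

noncomputable section

/-! ### Weighted Gaussian process regression

`X` is the decision set and `k` the kernel. Rounds are numbered `1, 2, …`; a history of `t` rounds
is a tuple indexed by `Fin t`, whose entry `i` belongs to round `i + 1`. -/

/-- The exponential weight `w_s = η^{-s}`. -/
def weight (η : ℝ) (s : ℕ) : ℝ := (η ^ s)⁻¹

/-- The matrix `W K W` with entries `√w_i √w_j k(a_i, a_j)`. -/
def weightedKernelMatrix {X : Type*} (k : X → X → ℝ) (η : ℝ) {t : ℕ} (a : Fin t → X) :
    Matrix (Fin t) (Fin t) ℝ :=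
  Matrix.of fun i j => √(weight η ((i : ℕ) + 1)) * √(weight η ((j : ℕ) + 1)) * k (a i) (a j)

/-- The vector `W k_t(z)` with entries `√w_i k(a_i, z)`. -/
def weightedKernelVector {X : Type*} (k : X → X → ℝ) (η : ℝ) {t : ℕ} (a : Fin t → X) (z : X) :
    Fin t → ℝ :=
  fun i => √(weight η ((i : ℕ) + 1)) * k (a i) z

/-- The regularized matrix `W K W + λ_t I` with `λ_t = λ w_t`. -/
def regularizedMatrix {X : Type*} (k : X → X → ℝ) (lam η : ℝ) {t : ℕ} (a : Fin t → X) :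
    Matrix (Fin t) (Fin t) ℝ :=
  weightedKernelMatrix k η a + (lam * weight η t) • (1 : Matrix (Fin t) (Fin t) ℝ)

/-- The weighted posterior mean after the actions `a` and the observations `y`. -/
def posteriorMean {X : Type*} (k : X → X → ℝ) (lam η : ℝ) {t : ℕ} (a : Fin t → X)
    (y : Fin t → ℝ) (z : X) : ℝ :=
  weightedKernelVector k η a z ⬝ᵥ
    ((regularizedMatrix k lam η a)⁻¹.mulVec fun i => √(weight η ((i : ℕ) + 1)) * y i)

/-- The weighted posterior variance after the actions `a`. -/
def posteriorVar {X : Type*} (k : X → X → ℝ) (lam η : ℝ) {t : ℕ} (a : Fin t → X) (z : X) : ℝ :=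
  k z z - weightedKernelVector k η a z ⬝ᵥ
    ((regularizedMatrix k lam η a)⁻¹.mulVec (weightedKernelVector k η a z))

/-! ### Information gains -/

/-- The double-weighted maximum information gain
`max_a ½ log det (I + α_t⁻¹ W² K_a W²)`, `α_t = λ w_t²`, over the `t`-tuples `a` of points. -/
def doubleGain {X : Type*} (k : X → X → ℝ) (lam η : ℝ) (t : ℕ) : ℝ :=
  ⨆ a : Fin t → X, 1 / 2 * Real.log (Matrix.det ((1 : Matrix (Fin t) (Fin t) ℝ) +
    (lam * weight η t ^ 2)⁻¹ •
      Matrix.of fun i j : Fin t => weight η ((i : ℕ) + 1) * weight η ((j : ℕ) + 1) * k (a i) (a j)))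

/-- The weighted maximum information gain
`max_a ½ log det (I + λ_t⁻¹ W Φ_a Φ_aᵀ W)`, `λ_t = λ w_t`, of a finite-dimensional feature map
`φ`, over the `t`-tuples `a` of points. -/
def featureGain {X ι : Type*} [Fintype ι] (φ : X → ι → ℝ) (lam η : ℝ) (t : ℕ) : ℝ :=
  ⨆ a : Fin t → X, 1 / 2 * Real.log (Matrix.det ((1 : Matrix (Fin t) (Fin t) ℝ) +
    (lam * weight η t)⁻¹ • weightedKernelMatrix (fun z z' => φ z ⬝ᵥ φ z') η a))

/-- The combined weighted maximum information gain: the larger of the two gains above. -/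
def combinedGain {X ι : Type*} [Fintype ι] (k : X → X → ℝ) (φ : X → ι → ℝ) (lam η : ℝ)
    (t : ℕ) : ℝ :=
  max (doubleGain k lam η t) (featureGain φ lam η t)

/-! ### The algorithm and its environment -/

/-- The confidence width `β_t = B + λ^{-1/2} R √(2 log (1/δ) + 2 γ̄_t)`. -/
def width {X : Type*} (k : X → X → ℝ) (lam R B δ η : ℝ) (t : ℕ) : ℝ :=
  B + 1 / √lam * R * √(2 * Real.log (1 / δ) + 2 * doubleGain k lam η t)

/-- The upper confidence bound at `z` after the actions `a` and the observations `y`. -/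
def ucb {X : Type*} (k : X → X → ℝ) (lam R B δ η : ℝ) {t : ℕ} (a : Fin t → X)
    (y : Fin t → ℝ) (z : X) : ℝ :=
  posteriorMean k lam η a y z + width k lam R B δ η t * √(posteriorVar k lam η a z)

/-- The observation `y_t = f_t(x_t) + ε_t`. -/
def observation {X Ω : Type*} (f : ℕ → X → ℝ) (x : ℕ → Ω → X) (ε : ℕ → Ω → ℝ) (t : ℕ) (ω : Ω) :
    ℝ :=
  f t (x t ω) + ε t ω

/-- The σ-algebra generated by `x_1, y_1, …, x_t, y_t` and the next action `x_{t+1}`. -/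
@[reducible] def history {X Ω : Type*} [MeasurableSpace X] (f : ℕ → X → ℝ) (x : ℕ → Ω → X) (ε : ℕ → Ω → ℝ)
    (t : ℕ) : MeasurableSpace Ω :=
  (⨆ s ∈ Set.Icc 1 t, (MeasurableSpace.comap (x s) inferInstance ⊔
    MeasurableSpace.comap (observation f x ε s) inferInstance)) ⊔
    MeasurableSpace.comap (x (t + 1)) inferInstance

/-- `x` are the actions of WGP-UCB, with weights `w_s = η^{-s}` and confidence parameter `δ`, in the
rounds `1, …, T` against the reward functions `f_1, …, f_T`, when the noise `ε` is conditionally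
`R`-sub-Gaussian. -/
structure IsRun {X Ω : Type*} [MeasurableSpace X] [MeasurableSpace Ω] (P : Measure Ω)
    (k : X → X → ℝ) (lam R B δ η : ℝ) (T : ℕ) (f : ℕ → X → ℝ) (x : ℕ → Ω → X)
    (ε : ℕ → Ω → ℝ) : Prop where
  measurable_action : ∀ t ∈ Set.Icc 1 T, Measurable (x t)
  measurable_noise : ∀ t ∈ Set.Icc 1 T, Measurable (ε t)
  integrable_exp_noise : ∀ t < T, ∀ r : ℝ, Integrable (fun ω => Real.exp (r * ε (t + 1) ω)) P
  subGaussian_noise : ∀ t < T, ∀ r : ℝ,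
    P[fun ω => Real.exp (r * ε (t + 1) ω) | history f x ε t] ≤ᵐ[P]
      fun _ => Real.exp (r ^ 2 * R ^ 2 / 2)
  action_maximizes : ∀ t < T, ∀ᵐ ω ∂P, ∀ z : X,
    ucb k lam R B δ η (fun i : Fin t => x ((i : ℕ) + 1) ω)
        (fun i : Fin t => observation f x ε ((i : ℕ) + 1) ω) z ≤
      ucb k lam R B δ η (fun i : Fin t => x ((i : ℕ) + 1) ω)
        (fun i : Fin t => observation f x ε ((i : ℕ) + 1) ω) (x (t + 1) ω)

/-- The dynamic regret `∑_{t ≤ T} (max f_t - f_t(x_t))`. -/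
def dynamicRegret {X Ω : Type*} (f : ℕ → X → ℝ) (x : ℕ → Ω → X) (T : ℕ) (ω : Ω) : ℝ :=
  ∑ t ∈ Finset.Icc 1 T, ((⨆ z, f t z) - f t (x t ω))

/-! ### Tuning and the order of the regret -/

/-- The joint choice of the discount factor `η = 1 - γ̇_T^{-1/4} V^{1/2} T^{-1/2}` and of the number
`m = log_{4/e} (T³ γ̇_T^{3/2})`, up to rounding, of quadrature nodes, where `γ̇_T` is the combined
gain for the same `η` and `m`. -/
structure IsTuned {X : Type*} {ι : ℕ → Type*} [∀ m, Fintype (ι m)] (k : X → X → ℝ)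
    (φ : ∀ m, X → ι m → ℝ) (lam : ℝ) (T : ℕ) (V η : ℝ) (m : ℕ) : Prop where
  eta_pos : 0 < η
  eta_lt_one : η < 1
  eta_eq : η = 1 - combinedGain k (φ m) lam η T ^ (-(1 / 4) : ℝ) * V ^ (1 / 2 : ℝ) *
    (T : ℝ) ^ (-(1 / 2) : ℝ)
  one_le_nodes : 1 ≤ m
  nodes : |(m : ℝ) - Real.logb (4 / Real.exp 1)
    ((T : ℝ) ^ 3 * combinedGain k (φ m) lam η T ^ (3 / 2 : ℝ))| ≤ 1

/-- The order of the dynamic regret of WGP-UCB for the kernel `k` and the feature maps `φ m`.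
The constants `C` and `p` are chosen before the horizon `T`, the failure probability `δ`, the
budget `BT`, the tuning, the reward functions and the noise. -/
def RegretOrder {X : Type*} [MeasurableSpace X] {ι : ℕ → Type*} [∀ m, Fintype (ι m)]
    (k : X → X → ℝ) (φ : ∀ m, X → ι m → ℝ) (lam R B : ℝ) : Prop :=
  ∀ b : ℝ, 0 < b → ∃ (C : ℝ) (p : ℕ),
    ∀ (H : Type u) [NormedAddCommGroup H] [InnerProductSpace ℝ H] [CompleteSpace H]
      [RKHS ℝ H X ℝ] (_ : ∀ z z' : X, RKHS.kernel H z z' (1 : ℝ) = k z z')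
      (Ω : Type v) [MeasurableSpace Ω] (P : Measure Ω) [IsProbabilityMeasure P]
      (T : ℕ) (_ : 1 ≤ T) (δ : ℝ) (_ : 0 < δ) (_ : δ < 1) (BT η : ℝ) (m : ℕ)
      (f : ℕ → H) (x : ℕ → Ω → X) (ε : ℕ → Ω → ℝ)
      (_ : ∀ t ∈ Set.Icc 1 T, ‖f t‖ ≤ B)
      (_ : ∑ t ∈ Finset.Ico 1 T, ‖f (t + 1) - f t‖ ≤ BT)
      (_ : IsRun P k lam R B (δ / T) η T (fun t => ⇑(f t)) x ε),
      (b / T ≤ BT → IsTuned k φ lam T BT η m →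
        ENNReal.ofReal (1 - δ) ≤ P {ω | dynamicRegret (fun t => ⇑(f t)) x T ω ≤
          C * (1 + Real.log (T / δ)) ^ p * (combinedGain k (φ m) lam η T ^ (7 / 8 : ℝ) *
            BT ^ (1 / 4 : ℝ) * (T : ℝ) ^ (3 / 4 : ℝ))}) ∧
      (b ≤ BT → IsTuned k φ lam T 1 η m →
        ENNReal.ofReal (1 - δ) ≤ P {ω | dynamicRegret (fun t => ⇑(f t)) x T ω ≤
          C * (1 + Real.log (T / δ)) ^ p * (combinedGain k (φ m) lam η T ^ (7 / 8 : ℝ) *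
            BT * (T : ℝ) ^ (3 / 4 : ℝ))})

/-! ### The squared exponential kernel on the cube and its quadrature Fourier features -/

/-- The cube `[0,1]^d`. -/
def cube (d : ℕ) : Set (EuclideanSpace ℝ (Fin d)) := {z | ∀ j, z j ∈ Set.Icc (0 : ℝ) 1}

/-- The squared exponential kernel with scale `l`. -/
def seKernel {d : ℕ} (l : ℝ) (z z' : cube d) : ℝ :=
  Real.exp (-‖(z : EuclideanSpace ℝ (Fin d)) - z'‖ ^ 2 / (2 * l ^ 2))

/-- The physicists' Hermite polynomials: `H_0 = 1`, `H_{n+1} = 2 X H_n - H_n'`. -/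
def hermiteH : ℕ → Polynomial ℝ
  | 0 => 1
  | n + 1 => 2 * Polynomial.X * hermiteH n - Polynomial.derivative (hermiteH n)

/-- The Gauss-Hermite nodes: the real roots of `H_m`. -/
def nodes (m : ℕ) : Finset ℝ := (hermiteH m).roots.toFinset

/-- The normalized Gauss-Hermite weight of the node `r` (for a total weight of `1`). -/
def nodeWeight (m : ℕ) (r : ℝ) : ℝ :=
  2 ^ (m - 1) * (m.factorial : ℝ) / ((m : ℝ) ^ 2 * ((hermiteH (m - 1)).eval r) ^ 2)

/-- The quadrature Fourier features with `m` nodes per coordinate: for every `ρ` in the product grid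
of nodes one cosine (`false`) and one sine (`true`). -/
def qff (d : ℕ) (l : ℝ) (m : ℕ) (z : cube d) (i : (Fin d → nodes m) × Bool) : ℝ :=
  √(∏ j, nodeWeight m (i.1 j)) *
    if i.2 then Real.sin (√2 / l * ∑ j, (i.1 j : ℝ) * (z : EuclideanSpace ℝ (Fin d)) j)
    else Real.cos (√2 / l * ∑ j, (i.1 j : ℝ) * (z : EuclideanSpace ℝ (Fin d)) j)

end

end WGP

/-! In the RKHS the algorithm is ridge regression with features √w_i k(x_i,·) and regularizer λw_t,
so means, variances and determinants become statements about α I + ∑ v_i ⊗ v_i. The error of the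
posterior mean against the current reward function splits into three parts, each a multiple of σ_t.
Regularization contributes B. The noise contributes the rest of β_t: ∑ w_i ε_i k(x_i,·) is
self-normalized with respect to the doubly weighted operator, which w_i² ≤ w_t w_i bounds by w_t
times the singly weighted one. The drift is treated by Abel summation, an increment being damped by
√η for every later round (`abs_mean_sub_le`). Optimism then bounds the regret of a round by 2β_tσ_t
plus twice the drift, and the drift sums to O((1-η)^{-3/2} B_T) (`sum_drift_le`).

By Cauchy–Schwarz it remains to bound ∑σ_t². The growing regularizer breaks the usual telescoping of
determinants, but in dimension N each growth by 1/η costs only a factor η^N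
(`prod_one_add_ridgeVar_le`). So the kernel is replaced by the features, with N ≤ 2m^d and Gram
error κ = O((e/4)^m), which changes ∑σ_t² by O(κT²) (`sum_ridgeVar_le`). The tuning of m keeps κT²
bounded. With L = 1 + log(T/δ), the gains are O(L m^d) while m = O(L + log γ̇), and these two facts
force m = O(L). Hence N and β_t are polylogarithmic, and the regret is a polylogarithm times √T +
T√(1-η) + (1-η)^{-3/2} B_T (`exists_regret_bound`). For the prescribed η, each term is at most the
target times a negative power of γ̇ and powers of the budget bounded through b (`order_known`,
`order_unknown`). The gain is bounded below by that of a constant tuple, unless k vanishes on the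
diagonal, when there is no regret.

The self-normalized tail bound is the method of mixtures with one scalar Gaussian per round, so no
Gaussian measure on the RKHS is needed (`mixtureValue_succ`).

For the squared exponential kernel the features are tensor Gauss–Hermite quadrature.
Christoffel–Darboux gives real simple nodes, the weights and exactness. At a node, powers expand in
Hermite polynomials of degree below m with coefficients between 0 and the true ones, so the error
for a cosine is dominated by a tail of an exponential series (`abs_sum_nodeWeight_cos_sub_le`). -/

namespace WGP

/-! ### Ridge regression in an inner product space. -/

section Ridge

variable {E : Type*} [NormedAddCommGroup E] [InnerProductSpace ℝ E]

/-- The operator `α I + ∑_{i < n} v_i ⊗ v_i`. -/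
noncomputable def ridgeOp (α : ℝ) (v : ℕ → E) (n : ℕ) (x : E) : E :=
  α • x + ∑ i ∈ Finset.range n, inner ℝ (v i) x • v i

/-- The inverse of `α I + ∑_{i < n} v_i ⊗ v_i`, by Sherman–Morrison updates. -/
noncomputable def ridgeInv (α : ℝ) (v : ℕ → E) : ℕ → E →ₗ[ℝ] E
  | 0 => α⁻¹ • LinearMap.id
  | n + 1 => ridgeInv α v n - (1 + inner ℝ (v n) (ridgeInv α v n (v n)))⁻¹ •
      (innerₛₗ ℝ (ridgeInv α v n (v n))).smulRight (ridgeInv α v n (v n))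

/-- The leverage `⟨v_n, (α I + ∑_{i < n} v_i ⊗ v_i)⁻¹ v_n⟩`. -/
noncomputable def leverage (α : ℝ) (v : ℕ → E) (n : ℕ) : ℝ :=
  inner ℝ (v n) (ridgeInv α v n (v n))

/-- The regularized variance `α ⟨x, (α I + ∑_{i < n} v_i ⊗ v_i)⁻¹ x⟩`. -/
noncomputable def ridgeVar (α : ℝ) (v : ℕ → E) (n : ℕ) (x : E) : ℝ :=
  α * inner ℝ x (ridgeInv α v n x)

lemma ridgeInv_zero_apply (α : ℝ) (v : ℕ → E) (x : E) : ridgeInv α v 0 x = α⁻¹ • x := by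
  simp [ridgeInv]

lemma ridgeInv_succ_apply (α : ℝ) (v : ℕ → E) (n : ℕ) (x : E) :
    ridgeInv α v (n + 1) x = ridgeInv α v n x -
      ((1 + leverage α v n)⁻¹ * inner ℝ (ridgeInv α v n (v n)) x) • ridgeInv α v n (v n) := by
  simp [ridgeInv, leverage, smul_smul]

lemma ridgeOp_add (α : ℝ) (v : ℕ → E) (n : ℕ) (x y : E) :
    ridgeOp α v n (x + y) = ridgeOp α v n x + ridgeOp α v n y := by
  simp only [ridgeOp, inner_add_right, add_smul, smul_add, Finset.sum_add_distrib]; abel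

lemma ridgeOp_smul (α : ℝ) (v : ℕ → E) (n : ℕ) (c : ℝ) (x : E) :
    ridgeOp α v n (c • x) = c • ridgeOp α v n x := by
  simp only [ridgeOp, inner_smul_right, mul_smul, smul_add, Finset.smul_sum, smul_comm c α]

lemma ridgeOp_sub (α : ℝ) (v : ℕ → E) (n : ℕ) (x y : E) :
    ridgeOp α v n (x - y) = ridgeOp α v n x - ridgeOp α v n y := by
  rw [sub_eq_add_neg, ridgeOp_add, ← neg_one_smul ℝ, ridgeOp_smul, neg_one_smul, sub_eq_add_neg]

lemma ridgeOp_succ (α : ℝ) (v : ℕ → E) (n : ℕ) (x : E) :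
    ridgeOp α v (n + 1) x = ridgeOp α v n x + inner ℝ (v n) x • v n := by
  simp only [ridgeOp, Finset.sum_range_succ]; abel

lemma inner_ridgeOp (α : ℝ) (v : ℕ → E) (n : ℕ) (x y : E) :
    inner ℝ x (ridgeOp α v n y) =
      α * inner ℝ x y + ∑ i ∈ Finset.range n, inner ℝ (v i) x * inner ℝ (v i) y := by
  simp only [ridgeOp, inner_add_right, inner_smul_right, inner_sum]
  congr 1
  exact Finset.sum_congr rfl fun i _ => by rw [real_inner_comm x (v i)]; ring

lemma inner_ridgeOp_self (α : ℝ) (v : ℕ → E) (n : ℕ) (x : E) :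
    inner ℝ x (ridgeOp α v n x) = α * ‖x‖ ^ 2 + ∑ i ∈ Finset.range n, inner ℝ (v i) x ^ 2 := by
  rw [inner_ridgeOp, real_inner_self_eq_norm_sq]; simp only [sq]

lemma ridgeOp_injective {α : ℝ} (hα : 0 < α) (v : ℕ → E) (n : ℕ) :
    Function.Injective (ridgeOp α v n) := by
  intro x y h
  have h0 : ridgeOp α v n (x - y) = 0 := by rw [ridgeOp_sub, h, sub_self]
  have h1 := inner_ridgeOp_self α v n (x - y)
  rw [h0, inner_zero_right] at h1
  have h2 : 0 ≤ ∑ i ∈ Finset.range n, inner ℝ (v i) (x - y) ^ 2 :=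
    Finset.sum_nonneg fun i _ => sq_nonneg _
  have h3 : 0 ≤ α * ‖x - y‖ ^ 2 := by positivity
  have h4 : α * ‖x - y‖ ^ 2 = 0 := by linarith
  have h5 : ‖x - y‖ = 0 := by simpa [hα.ne'] using h4
  exact sub_eq_zero.1 (norm_eq_zero.1 h5)

/-- The two claims need a joint induction: together they give a nonnegative leverage, hence 1 +
leverage ≠ 0, which the next Sherman–Morrison update divides by. -/
lemma ridgeInv_symm_and_ridgeOp_ridgeInv {α : ℝ} (hα : 0 < α) (v : ℕ → E) (n : ℕ) :
    (∀ x y, inner ℝ (ridgeInv α v n x) y = inner ℝ x (ridgeInv α v n y)) ∧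
      ∀ x, ridgeOp α v n (ridgeInv α v n x) = x := by
  induction n with
  | zero =>
    refine ⟨fun x y => ?_, fun x => ?_⟩
    · simp [ridgeInv_zero_apply, inner_smul_left, inner_smul_right]
    · simp [ridgeInv_zero_apply, ridgeOp, smul_smul, hα.ne']
  | succ n ih =>
    obtain ⟨hs, hi⟩ := ih
    have hτ : 0 ≤ leverage α v n := by
      have : leverage α v n = inner ℝ (ridgeInv α v n (v n))
          (ridgeOp α v n (ridgeInv α v n (v n))) := by rw [hi, hs, leverage]
      rw [this, inner_ridgeOp_self]
      have : 0 ≤ ∑ i ∈ Finset.range n, inner ℝ (v i) (ridgeInv α v n (v n)) ^ 2 :=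
        Finset.sum_nonneg fun i _ => sq_nonneg _
      positivity
    refine ⟨fun x y => ?_, fun x => ?_⟩
    · simp only [ridgeInv_succ_apply, inner_sub_left, inner_sub_right, inner_smul_left,
        inner_smul_right, hs]
      rw [← hs x (v n), real_inner_comm (v n) (ridgeInv α v n x), conj_trivial]
      ring
    · rw [ridgeOp_succ, ridgeInv_succ_apply, ridgeOp_sub, ridgeOp_smul, hi, hi, inner_sub_right,
        inner_smul_right, hs, sub_add, ← sub_smul]
      have : (1 + leverage α v n)⁻¹ * inner ℝ (v n) (ridgeInv α v n x) -
          (inner ℝ (v n) (ridgeInv α v n x) - (1 + leverage α v n)⁻¹ *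
            inner ℝ (v n) (ridgeInv α v n x) * inner ℝ (v n) (ridgeInv α v n (v n))) = 0 := by
        change _ - (_ - _ * leverage α v n) = 0
        field_simp
        ring
      rw [this, zero_smul, sub_zero]

lemma inner_ridgeInv_comm {α : ℝ} (hα : 0 < α) (v : ℕ → E) (n : ℕ) (x y : E) :
    inner ℝ (ridgeInv α v n x) y = inner ℝ x (ridgeInv α v n y) :=
  (ridgeInv_symm_and_ridgeOp_ridgeInv hα v n).1 x y

lemma ridgeOp_ridgeInv {α : ℝ} (hα : 0 < α) (v : ℕ → E) (n : ℕ) (x : E) :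
    ridgeOp α v n (ridgeInv α v n x) = x :=
  (ridgeInv_symm_and_ridgeOp_ridgeInv hα v n).2 x

lemma ridgeInv_ridgeOp {α : ℝ} (hα : 0 < α) (v : ℕ → E) (n : ℕ) (x : E) :
    ridgeInv α v n (ridgeOp α v n x) = x :=
  ridgeOp_injective hα v n (ridgeOp_ridgeInv hα v n _)

lemma inner_ridgeInv_self {α : ℝ} (hα : 0 < α) (v : ℕ → E) (n : ℕ) (x : E) :
    inner ℝ x (ridgeInv α v n x) = α * ‖ridgeInv α v n x‖ ^ 2 +
      ∑ i ∈ Finset.range n, inner ℝ (v i) (ridgeInv α v n x) ^ 2 := by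
  rw [← inner_ridgeOp_self, ridgeOp_ridgeInv hα, inner_ridgeInv_comm hα]

lemma inner_ridgeInv_self_nonneg {α : ℝ} (hα : 0 < α) (v : ℕ → E) (n : ℕ) (x : E) :
    0 ≤ inner ℝ x (ridgeInv α v n x) := by
  rw [inner_ridgeInv_self hα]
  have := Finset.sum_nonneg fun i (_ : i ∈ Finset.range n) =>
    sq_nonneg (inner ℝ (v i) (ridgeInv α v n x))
  positivity

lemma leverage_nonneg {α : ℝ} (hα : 0 < α) (v : ℕ → E) (n : ℕ) : 0 ≤ leverage α v n :=
  inner_ridgeInv_self_nonneg hα v n _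

lemma ridgeVar_nonneg {α : ℝ} (hα : 0 < α) (v : ℕ → E) (n : ℕ) (x : E) : 0 ≤ ridgeVar α v n x :=
  mul_nonneg hα.le (inner_ridgeInv_self_nonneg hα v n _)

/-- Variational upper bound for the regularized variance. -/
lemma ridgeVar_le {α : ℝ} (hα : 0 < α) (v : ℕ → E) (n : ℕ) (x : E) (u : ℕ → ℝ) :
    ridgeVar α v n x ≤
      ‖x - ∑ i ∈ Finset.range n, u i • v i‖ ^ 2 + α * ∑ i ∈ Finset.range n, u i ^ 2 := by
  set y := ridgeInv α v n x with hy
  set q := x - ∑ i ∈ Finset.range n, u i • v i with hq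
  have h1 : inner ℝ x y = inner ℝ q y + ∑ i ∈ Finset.range n, u i * inner ℝ (v i) y := by
    rw [hq, inner_sub_left, sum_inner]
    simp [inner_smul_left]
  have h2 := inner_ridgeInv_self hα v n x
  rw [← hy] at h2
  -- Young's inequality for the pair q, αy, and below for each pair u_i, ⟨v_i, y⟩; equality at the
  -- optimal coefficients.
  have h3 : 0 ≤ ‖q - α • y‖ ^ 2 := sq_nonneg _
  rw [norm_sub_sq_real, norm_smul, inner_smul_right, Real.norm_of_nonneg hα.le] at h3
  have h4 : 0 ≤ ∑ i ∈ Finset.range n, (u i - inner ℝ (v i) y) ^ 2 :=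
    Finset.sum_nonneg fun i _ => sq_nonneg _
  have h5 : ∑ i ∈ Finset.range n, (u i - inner ℝ (v i) y) ^ 2 =
      ∑ i ∈ Finset.range n, u i ^ 2 - 2 * ∑ i ∈ Finset.range n, u i * inner ℝ (v i) y +
        ∑ i ∈ Finset.range n, inner ℝ (v i) y ^ 2 := by
    rw [Finset.mul_sum, ← Finset.sum_sub_distrib, ← Finset.sum_add_distrib]
    exact Finset.sum_congr rfl fun i _ => by ring
  rw [h5] at h4
  have h6 := mul_nonneg hα.le h4
  rw [ridgeVar, ← hy]
  nlinarith

/-- The coefficients ⟨v_i, P x⟩, with P the inverse, attain the variational bound: their residual is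
α P x. -/
lemma ridgeVar_eq {α : ℝ} (hα : 0 < α) (v : ℕ → E) (n : ℕ) (x : E) :
    ridgeVar α v n x =
      ‖x - ∑ i ∈ Finset.range n, inner ℝ (v i) (ridgeInv α v n x) • v i‖ ^ 2 +
        α * ∑ i ∈ Finset.range n, inner ℝ (v i) (ridgeInv α v n x) ^ 2 := by
  have h : x - ∑ i ∈ Finset.range n, inner ℝ (v i) (ridgeInv α v n x) • v i =
      α • ridgeInv α v n x := by
    rw [sub_eq_iff_eq_add]
    exact (ridgeOp_ridgeInv hα v n x).symm
  rw [h, norm_smul, Real.norm_of_nonneg hα.le, ridgeVar, inner_ridgeInv_self hα]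
  ring

lemma ridgeVar_le_norm_sq {α : ℝ} (hα : 0 < α) (v : ℕ → E) (n : ℕ) (x : E) :
    ridgeVar α v n x ≤ ‖x‖ ^ 2 := by
  simpa using ridgeVar_le hα v n x 0

/-- Cauchy–Schwarz for the operator `α I + ∑ v_i ⊗ v_i` and its inverse. -/
lemma inner_sq_le_ridge {α : ℝ} (hα : 0 < α) (v : ℕ → E) (n : ℕ) (q s : E) :
    inner ℝ q s ^ 2 ≤ inner ℝ q (ridgeOp α v n q) * inner ℝ s (ridgeInv α v n s) := by
  -- The quadratic form of the operator at c q − P s, as a polynomial in c; its discriminant gives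
  -- the claim.
  have key : ∀ c : ℝ, 0 ≤ inner ℝ q (ridgeOp α v n q) * (c * c) + (-2 * inner ℝ q s) * c +
      inner ℝ s (ridgeInv α v n s) := by
    intro c
    have h1 : 0 ≤ inner ℝ (c • q - ridgeInv α v n s)
        (ridgeOp α v n (c • q - ridgeInv α v n s)) := by
      rw [inner_ridgeOp_self]
      have := Finset.sum_nonneg fun i (_ : i ∈ Finset.range n) =>
        sq_nonneg (inner ℝ (v i) (c • q - ridgeInv α v n s))
      positivity
    have h2 : inner ℝ (ridgeInv α v n s) (ridgeOp α v n q) = inner ℝ q s := by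
      rw [inner_ridgeInv_comm hα, ridgeInv_ridgeOp hα, real_inner_comm]
    rw [ridgeOp_sub, ridgeOp_smul, ridgeOp_ridgeInv hα, inner_sub_left, inner_sub_right,
      inner_sub_right, inner_smul_left, inner_smul_right, inner_smul_left, inner_smul_right,
      h2, real_inner_comm s (ridgeInv α v n s)] at h1
    simp only [conj_trivial] at h1
    linarith
  have := discrim_le_zero key
  rw [discrim] at this
  linarith

/-- The update of the self-normalized square. -/
lemma inner_ridgeInv_succ_update {α : ℝ} (hα : 0 < α) (v : ℕ → E) (n : ℕ) (s : E) (e : ℝ) :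
    inner ℝ (s + e • v n) (ridgeInv α v (n + 1) (s + e • v n)) = inner ℝ s (ridgeInv α v n s) +
      (2 * e * inner ℝ (v n) (ridgeInv α v n s) + e ^ 2 * leverage α v n -
        inner ℝ (v n) (ridgeInv α v n s) ^ 2) / (1 + leverage α v n) := by
  have hτ := leverage_nonneg hα v n
  have h1 : inner ℝ s (ridgeInv α v n (v n)) = inner ℝ (v n) (ridgeInv α v n s) := by
    rw [← inner_ridgeInv_comm hα, real_inner_comm]
  have h2 : inner ℝ (ridgeInv α v n (v n)) s = inner ℝ (v n) (ridgeInv α v n s) :=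
    inner_ridgeInv_comm hα _ _ _ _
  have h3 : inner ℝ (ridgeInv α v n (v n)) (v n) = leverage α v n :=
    inner_ridgeInv_comm hα _ _ _ _
  rw [ridgeInv_succ_apply, inner_sub_right, inner_smul_right, map_add, map_smul]
  simp only [inner_add_left, inner_add_right, inner_smul_left, inner_smul_right, h1, h2, h3,
    conj_trivial]
  change _ + _ * (_ + _ * leverage α v n) - _ * (_ + _ * leverage α v n) = _
  field_simp
  ring

/-! ### Matrix forms -/

lemma isUnit_gram_add {α : ℝ} (hα : 0 < α) {n : ℕ} (v : Fin n → E) :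
    IsUnit (Matrix.gram ℝ v + α • (1 : Matrix (Fin n) (Fin n) ℝ)) :=
  (Matrix.PosDef.posSemidef_add (Matrix.posSemidef_gram ℝ v)
    (Matrix.PosDef.one.smul hα)).isUnit

/-- Push-through identity: applying `ridgeOp` to the left side, the coefficient of v_i is row i of
(G + α)u = b, and `ridgeOp` is injective. It translates matrix formulas into operators. -/
lemma sum_inv_gram_smul {α : ℝ} (hα : 0 < α) (v : ℕ → E) (n : ℕ) (b : Fin n → ℝ) :
    ∑ i : Fin n, ((Matrix.gram ℝ (fun i : Fin n => v i) +
      α • (1 : Matrix (Fin n) (Fin n) ℝ))⁻¹.mulVec b) i • v i =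
      ridgeInv α v n (∑ i : Fin n, b i • v i) := by
  set G := Matrix.gram ℝ (fun i : Fin n => v i) + α • (1 : Matrix (Fin n) (Fin n) ℝ) with hG
  set u := G⁻¹.mulVec b with hu
  have hGu : G.mulVec u = b := by
    rw [hu, Matrix.mulVec_mulVec, Matrix.mul_nonsing_inv _
      ((Matrix.isUnit_iff_isUnit_det _).1 (isUnit_gram_add hα _)), Matrix.one_mulVec]
  apply ridgeOp_injective hα v n
  rw [ridgeOp_ridgeInv hα, ridgeOp, Finset.smul_sum,
    Finset.sum_range fun i => inner ℝ (v i) (∑ j : Fin n, u j • v j) • v i,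
    ← Finset.sum_add_distrib]
  refine Finset.sum_congr rfl fun i _ => ?_
  rw [smul_smul, ← add_smul, ← congrFun hGu i, hG, Matrix.add_mulVec, Matrix.smul_mulVec,
    Matrix.one_mulVec, inner_sum]
  congr 1
  simp only [Pi.add_apply, Pi.smul_apply, smul_eq_mul, Matrix.mulVec, dotProduct,
    Matrix.gram_apply, inner_smul_right]
  rw [add_comm]
  congr 1
  exact Finset.sum_congr rfl fun j _ => by ring

lemma dotProduct_inv_gram {α : ℝ} (hα : 0 < α) (v : ℕ → E) (n : ℕ) (b : Fin n → ℝ) (x : E) :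
    (fun i : Fin n => inner ℝ (v i) x) ⬝ᵥ ((Matrix.gram ℝ (fun i : Fin n => v i) +
      α • (1 : Matrix (Fin n) (Fin n) ℝ))⁻¹.mulVec b) =
      inner ℝ x (ridgeInv α v n (∑ i : Fin n, b i • v i)) := by
  rw [← sum_inv_gram_smul hα, inner_sum, dotProduct]
  exact Finset.sum_congr rfl fun i _ => by rw [inner_smul_right, real_inner_comm]; ring

/-- The vector ∑ ⟨v_i, x⟩ v_i is `ridgeOp` x − αx, whose image under the inverse is x − α P x. -/
lemma ridgeVar_eq_schur {α : ℝ} (hα : 0 < α) (v : ℕ → E) (n : ℕ) (x : E) :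
    inner ℝ x x - (fun i : Fin n => inner ℝ (v i) x) ⬝ᵥ
      ((Matrix.gram ℝ (fun i : Fin n => v i) +
        α • (1 : Matrix (Fin n) (Fin n) ℝ))⁻¹.mulVec fun i : Fin n => inner ℝ (v i) x) =
      ridgeVar α v n x := by
  rw [dotProduct_inv_gram hα, ridgeVar]
  have h : ∑ i : Fin n, inner ℝ (v i) x • v i = ridgeOp α v n x - α • x := by
    rw [ridgeOp, Finset.sum_range fun i => inner ℝ (v i) x • v i]; abel
  rw [h, map_sub, ridgeInv_ridgeOp hα, map_smul, inner_sub_right, inner_smul_right]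
  ring

/-- Schur complement of the leading block: it equals α plus the regularized variance of v_n, that is
α(1 + leverage). -/
lemma det_gram_add_succ {α : ℝ} (hα : 0 < α) (v : ℕ → E) (n : ℕ) :
    (Matrix.gram ℝ (fun i : Fin (n + 1) => v i) +
      α • (1 : Matrix (Fin (n + 1)) (Fin (n + 1)) ℝ)).det =
    (Matrix.gram ℝ (fun i : Fin n => v i) + α • (1 : Matrix (Fin n) (Fin n) ℝ)).det *
      (α * (1 + leverage α v n)) := by
  set G := Matrix.gram ℝ (fun i : Fin n => v i) + α • (1 : Matrix (Fin n) (Fin n) ℝ) with hG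
  have hu : IsUnit G := isUnit_gram_add hα _
  let _ := hu.invertible
  rw [← Matrix.det_submatrix_equiv_self (finSumFinEquiv (m := n) (n := 1))]
  have hb : (Matrix.gram ℝ (fun i : Fin (n + 1) => v i) +
      α • (1 : Matrix (Fin (n + 1)) (Fin (n + 1)) ℝ)).submatrix
        (finSumFinEquiv (m := n) (n := 1)) (finSumFinEquiv (m := n) (n := 1)) =
      Matrix.fromBlocks G (Matrix.of fun i (_ : Fin 1) => inner ℝ (v i) (v n))
        (Matrix.of fun (_ : Fin 1) j => inner ℝ (v n) (v j))
        (Matrix.of fun (_ : Fin 1) (_ : Fin 1) => inner ℝ (v n) (v n) + α) := by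
    ext i j
    rcases i with i | i <;> rcases j with j | j
    · simp [hG, Matrix.gram_apply, Matrix.one_apply]
    · have : Fin.castAdd 1 i ≠ Fin.natAdd n j := by
        intro h; have := congrArg Fin.val h; simp at this; omega
      have hj : (j : ℕ) = 0 := by omega
      simp [Matrix.gram_apply, this]
    · have : Fin.natAdd n i ≠ Fin.castAdd 1 j := by
        intro h; have := congrArg Fin.val h; simp at this; omega
      have hj : (i : ℕ) = 0 := by omega
      simp [Matrix.gram_apply, this]
    · have hi : (i : ℕ) = 0 := by omega
      have hj : (j : ℕ) = 0 := by omega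
      simp [Matrix.gram_apply, Subsingleton.elim i j]
  rw [hb, Matrix.det_fromBlocks₁₁, Matrix.det_fin_one, Matrix.invOf_eq_nonsing_inv]
  congr 1
  have h1 := ridgeVar_eq_schur hα v n (v n)
  rw [← hG] at h1
  rw [mul_add, mul_one]
  change _ = α + ridgeVar α v n (v n)
  rw [← h1, Matrix.sub_apply, Matrix.mul_assoc]
  simp only [Matrix.of_apply, Matrix.mul_apply, dotProduct, Matrix.mulVec, real_inner_comm (v n)]
  ring

/-- Turns an information gain into a sum over rounds, which can be compared term by term. -/
lemma det_one_add_gram {α : ℝ} (hα : 0 < α) (v : ℕ → E) (n : ℕ) :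
    ((1 : Matrix (Fin n) (Fin n) ℝ) + α⁻¹ • Matrix.gram ℝ (fun i : Fin n => v i)).det =
      ∏ i ∈ Finset.range n, (1 + leverage α v i) := by
  have h1 : (1 : Matrix (Fin n) (Fin n) ℝ) + α⁻¹ • Matrix.gram ℝ (fun i : Fin n => v i) =
      α⁻¹ • (Matrix.gram ℝ (fun i : Fin n => v i) + α • (1 : Matrix (Fin n) (Fin n) ℝ)) := by
    rw [smul_add, smul_smul, inv_mul_cancel₀ hα.ne', one_smul, add_comm]
  have h2 : ∀ n, (Matrix.gram ℝ (fun i : Fin n => v i) +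
      α • (1 : Matrix (Fin n) (Fin n) ℝ)).det =
      α ^ n * ∏ i ∈ Finset.range n, (1 + leverage α v i) := by
    intro n
    induction n with
    | zero => simp
    | succ n ih => rw [det_gram_add_succ hα, ih, Finset.prod_range_succ]; ring
  rw [h1, Matrix.det_smul, h2, Fintype.card_fin, ← mul_assoc, ← mul_pow,
    inv_mul_cancel₀ hα.ne', one_pow, one_mul]

end Ridge

/-! ### Determinants in finite dimension. -/

section Determinant

lemma det_one_add_smul_of_isHermitian {ι : Type*} [Fintype ι] [DecidableEq ι] {A : Matrix ι ι ℝ}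
    (hA : A.IsHermitian) (c : ℝ) : (1 + c • A).det = ∏ i, (1 + c * hA.eigenvalues i) := by
  have h1 : 1 + c • A = Unitary.conjStarAlgAut ℝ _ hA.eigenvectorUnitary
      (Matrix.diagonal fun i => 1 + c * hA.eigenvalues i) := by
    have : (Matrix.diagonal fun i => 1 + c * hA.eigenvalues i) =
        1 + c • Matrix.diagonal ((RCLike.ofReal : ℝ → ℝ) ∘ hA.eigenvalues) := by
      rw [← Matrix.diagonal_one, ← Matrix.diagonal_smul, Matrix.diagonal_add]; rfl
    rw [this, map_add, map_one, map_smul, ← hA.spectral_theorem]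
  rw [h1, Unitary.conjStarAlgAut_apply, Matrix.det_mul_comm, ← mul_assoc]
  simp

variable {ι : Type*} [Fintype ι]

/-- By Sylvester's identity ΦΦᵀ may be exchanged for ΦᵀΦ, so the number of factors is the dimension
of the features and not the number of rounds. The same eigenvalues serve every c. -/
lemma exists_eigenvalues_gram {n : ℕ} (v : Fin n → EuclideanSpace ℝ ι) :
    ∃ a : ι → ℝ, (∀ i, 0 ≤ a i) ∧ ∑ i, a i = ∑ i, ‖v i‖ ^ 2 ∧
      ∀ c : ℝ, ((1 : Matrix (Fin n) (Fin n) ℝ) + c • Matrix.gram ℝ v).det =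
        ∏ i, (1 + c * a i) := by
  classical
  let Φ : Matrix (Fin n) ι ℝ := Matrix.of fun i j => v i j
  have hP : (Φ.conjTranspose * Φ).PosSemidef := Matrix.posSemidef_conjTranspose_mul_self Φ
  have hG : Matrix.gram ℝ v = Φ * Φ.conjTranspose := by
    ext i j
    simp [Φ, Matrix.gram_apply, Matrix.mul_apply, PiLp.inner_apply, mul_comm]
  refine ⟨hP.1.eigenvalues, hP.eigenvalues_nonneg, ?_, fun c => ?_⟩
  · have h1 := hP.1.trace_eq_sum_eigenvalues
    simp only [RCLike.ofReal_real_eq_id, id] at h1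
    rw [← h1, Matrix.trace_mul_comm, Matrix.trace]
    refine Finset.sum_congr rfl fun i _ => ?_
    rw [Matrix.diag_apply, ← hG, Matrix.gram_apply, real_inner_self_eq_norm_sq]
  · rw [hG, ← Matrix.smul_mul, Matrix.det_one_add_mul_comm, Matrix.mul_smul,
      det_one_add_smul_of_isHermitian hP.1]

lemma det_one_add_gram_le {n : ℕ} (v : Fin n → EuclideanSpace ℝ ι) {c : ℝ} (hc : 0 ≤ c) :
    ((1 : Matrix (Fin n) (Fin n) ℝ) + c • Matrix.gram ℝ v).det ≤
      (1 + c * ∑ i, ‖v i‖ ^ 2) ^ Fintype.card ι := by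
  obtain ⟨a, ha, hs, hd⟩ := exists_eigenvalues_gram v
  rw [hd, ← hs, ← Finset.card_univ, ← Finset.prod_const]
  refine Finset.prod_le_prod (fun i _ => ?_) fun i _ => ?_
  · have := mul_nonneg hc (ha i); linarith
  · have := mul_le_mul_of_nonneg_left (Finset.single_le_sum (fun j _ => ha j)
      (Finset.mem_univ i)) hc
    linarith

/-- Factor by factor, η(1 + ca) ≤ 1 + ηca. This is the price of one growth of the regularizer, and
the only reason for passing to finite dimension in the variance sum. -/
lemma pow_mul_det_one_add_gram_le {n : ℕ} (v : Fin n → EuclideanSpace ℝ ι) {c η : ℝ} (hc : 0 ≤ c)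
    (hη : 0 ≤ η) (hη1 : η ≤ 1) :
    η ^ Fintype.card ι * ((1 : Matrix (Fin n) (Fin n) ℝ) + c • Matrix.gram ℝ v).det ≤
      ((1 : Matrix (Fin n) (Fin n) ℝ) + (η * c) • Matrix.gram ℝ v).det := by
  obtain ⟨a, ha, hs, hd⟩ := exists_eigenvalues_gram v
  rw [hd, hd, ← Finset.card_univ, ← Finset.prod_const, ← Finset.prod_mul_distrib]
  refine Finset.prod_le_prod (fun i _ => ?_) fun i _ => ?_
  · have := mul_nonneg hc (ha i); positivity
  · rw [mul_add, mul_one, mul_assoc]; linarith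

lemma prod_one_add_leverage_le {α : ℝ} (hα : 0 < α) (v : ℕ → EuclideanSpace ℝ ι) (n : ℕ) :
    ∏ i ∈ Finset.range n, (1 + leverage α v i) ≤
      (1 + α⁻¹ * ∑ i ∈ Finset.range n, ‖v i‖ ^ 2) ^ Fintype.card ι := by
  rw [← det_one_add_gram hα, Finset.sum_range fun i => ‖v i‖ ^ 2]
  exact det_one_add_gram_le _ (inv_nonneg.2 hα.le)

lemma pow_mul_prod_one_add_leverage_le {α η : ℝ} (hα : 0 < α) (hη : 0 < η) (hη1 : η ≤ 1)
    (v : ℕ → EuclideanSpace ℝ ι) (n : ℕ) :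
    η ^ Fintype.card ι * ∏ i ∈ Finset.range n, (1 + leverage α v i) ≤
      ∏ i ∈ Finset.range n, (1 + leverage (α / η) v i) := by
  rw [← det_one_add_gram hα, ← det_one_add_gram (div_pos hα hη), inv_div, div_eq_mul_inv]
  exact pow_mul_det_one_add_gram_le _ (inv_nonneg.2 hα.le) hη.le hη1

end Determinant

/-! ### Perturbation of regularized variances. -/

section Comparison

variable {E F : Type*} [NormedAddCommGroup E] [InnerProductSpace ℝ E]
  [NormedAddCommGroup F] [InnerProductSpace ℝ F]

/-- The optimal coefficients for β are admissible in the variational bound for α. -/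
lemma ridgeVar_mono {α β : ℝ} (hα : 0 < α) (h : α ≤ β) (v : ℕ → E) (n : ℕ) (x : E) :
    ridgeVar α v n x ≤ ridgeVar β v n x := by
  rw [ridgeVar_eq (hα.trans_le h)]
  refine (ridgeVar_le hα v n x fun i => inner ℝ (v i) (ridgeInv β v n x)).trans ?_
  gcongr

lemma norm_sub_sum_smul_sq (v : ℕ → E) (n : ℕ) (x : E) (u : ℕ → ℝ) :
    ‖x - ∑ i ∈ Finset.range n, u i • v i‖ ^ 2 = inner ℝ x x -
      2 * ∑ i ∈ Finset.range n, u i * inner ℝ x (v i) +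
      ∑ i ∈ Finset.range n, ∑ j ∈ Finset.range n, u i * u j * inner ℝ (v i) (v j) := by
  rw [norm_sub_sq_real, inner_sum, ← real_inner_self_eq_norm_sq,
    ← real_inner_self_eq_norm_sq (∑ i ∈ Finset.range n, u i • v i), sum_inner]
  simp only [inner_sum, inner_smul_left, inner_smul_right, conj_trivial]
  refine congrArg _ (Finset.sum_congr rfl fun i _ => Finset.sum_congr rfl fun j _ => ?_)
  ring

/-- Regularized variances depend continuously on the Gram matrix. -/
lemma ridgeVar_le_of_gram_close {α ε c w : ℝ} (hα : 0 < α) (hε : 0 ≤ ε)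
    (v : ℕ → E) (v' : ℕ → F) (n : ℕ) (x : E) (x' : F)
    (h1 : |inner ℝ x x - inner ℝ x' x'| ≤ ε * (c * c))
    (h2 : ∀ i < n, |inner ℝ x (v i) - inner ℝ x' (v' i)| ≤ ε * (c * w))
    (h3 : ∀ i < n, ∀ j < n, |inner ℝ (v i) (v j) - inner ℝ (v' i) (v' j)| ≤ ε * (w * w)) :
    ridgeVar α v n x ≤ ridgeVar α v' n x' + 2 * ε * (c ^ 2 + w ^ 2 * n * (‖x'‖ ^ 2 / α)) := by
  -- The optimal coefficients for the primed family are tested on the other one; the objective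
  -- changes by at most ε(c + w ∑|u_i|)², and ∑u_i² ≤ ‖x'‖²/α.
  set u : ℕ → ℝ := fun i => inner ℝ (v' i) (ridgeInv α v' n x') with hu
  have hle := ridgeVar_le hα v n x u
  have heq := ridgeVar_eq hα v' n x'
  have hb := ridgeVar_le_norm_sq hα v' n x'
  change ridgeVar α v' n x' = ‖x' - ∑ i ∈ Finset.range n, u i • v' i‖ ^ 2 +
        α * ∑ i ∈ Finset.range n, u i ^ 2 at heq
  have hu2 : ∑ i ∈ Finset.range n, u i ^ 2 ≤ ‖x'‖ ^ 2 / α := by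
    rw [le_div_iff₀ hα]
    have := sq_nonneg ‖x' - ∑ i ∈ Finset.range n, u i • v' i‖
    linarith
  set s := ∑ i ∈ Finset.range n, |u i| with hs
  have hs2 : s ^ 2 ≤ n * ∑ i ∈ Finset.range n, u i ^ 2 := by
    have := sq_sum_le_card_mul_sum_sq (s := Finset.range n) (f := fun i => |u i|)
    simpa only [sq_abs, Finset.card_range] using this
  have hs0 : 0 ≤ s := Finset.sum_nonneg fun i _ => abs_nonneg _
  have k2 : -(∑ i ∈ Finset.range n, u i * inner ℝ x (v i)) +
      ∑ i ∈ Finset.range n, u i * inner ℝ x' (v' i) ≤ ε * (c * w) * s := by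
    rw [neg_add_eq_sub, ← Finset.sum_sub_distrib, hs, Finset.mul_sum]
    refine Finset.sum_le_sum fun i hi => ?_
    rw [← mul_sub]
    refine (le_abs_self _).trans ?_
    rw [abs_mul, abs_sub_comm, mul_comm]
    exact mul_le_mul_of_nonneg_right (h2 i (Finset.mem_range.1 hi)) (abs_nonneg _)
  have k3 : ∑ i ∈ Finset.range n, ∑ j ∈ Finset.range n, u i * u j * inner ℝ (v i) (v j) -
      ∑ i ∈ Finset.range n, ∑ j ∈ Finset.range n, u i * u j * inner ℝ (v' i) (v' j) ≤
      ε * (w * w) * s ^ 2 := by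
    rw [sq s, hs, Finset.sum_mul_sum, Finset.mul_sum, ← Finset.sum_sub_distrib]
    refine Finset.sum_le_sum fun i hi => ?_
    rw [← Finset.sum_sub_distrib, Finset.mul_sum]
    refine Finset.sum_le_sum fun j hj => ?_
    rw [← mul_sub, ← abs_mul]
    refine (le_abs_self _).trans ?_
    rw [abs_mul, mul_comm]
    exact mul_le_mul_of_nonneg_right (h3 i (Finset.mem_range.1 hi) j (Finset.mem_range.1 hj))
      (abs_nonneg _)
  rw [norm_sub_sum_smul_sq] at hle heq
  have k1 := (abs_le.1 h1).2
  have k4 : ε * (c * c) + 2 * (ε * (c * w) * s) + ε * (w * w) * s ^ 2 ≤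
      2 * ε * (c ^ 2 + w ^ 2 * n * (‖x'‖ ^ 2 / α)) := by
    have e1 : ε * (c * c) + 2 * (ε * (c * w) * s) + ε * (w * w) * s ^ 2 = ε * (c + w * s) ^ 2 := by
      ring
    have e2 : (c + w * s) ^ 2 ≤ 2 * (c ^ 2 + w ^ 2 * s ^ 2) := by nlinarith [sq_nonneg (c - w * s)]
    have e3 : s ^ 2 ≤ n * (‖x'‖ ^ 2 / α) := hs2.trans (by gcongr)
    rw [e1]
    calc ε * (c + w * s) ^ 2 ≤ ε * (2 * (c ^ 2 + w ^ 2 * (n * (‖x'‖ ^ 2 / α)))) := by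
          refine mul_le_mul_of_nonneg_left (e2.trans ?_) hε
          gcongr
      _ = _ := by ring
  linarith

end Comparison

/-- The elliptical potential with exponential weights, in finite dimension. -/
lemma prod_one_add_ridgeVar_le {ι : Type*} [Fintype ι] {lam η : ℝ} (hlam : 0 < lam) (hη : 0 < η)
    (hη1 : η ≤ 1) (φ : ℕ → EuclideanSpace ℝ ι) (n : ℕ) :
    (η ^ Fintype.card ι) ^ n * ∏ s ∈ Finset.range n, (1 + lam⁻¹ *
        ridgeVar (lam * weight η s) (fun i => √(weight η (i + 1)) • φ i) s (φ s)) ≤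
      ∏ i ∈ Finset.range n,
        (1 + leverage (lam * weight η n) (fun i => √(weight η (i + 1)) • φ i) i) := by
  set v : ℕ → EuclideanSpace ℝ ι := fun i => √(weight η (i + 1)) • φ i with hv
  have hw : ∀ s, 0 < weight η s := fun s => inv_pos.2 (pow_pos hη s)
  induction n with
  | zero => simp
  | succ n ih =>
    -- The new round divides the regularizer by η, which costs η^N in the product over earlier
    -- rounds.
    have hstep : lam * weight η (n + 1) = lam * weight η n / η := by
      simp only [weight, pow_succ]; field_simp
    have h1 := pow_mul_prod_one_add_leverage_le (mul_pos hlam (hw n)) hη hη1 v n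
    rw [← hstep] at h1
    -- The factor √w_{n+1} of the feature enters twice and cancels w_{n+1} in the new regularizer,
    -- so the last leverage is a variance over λ; raising the regularizer only increases it.
    have h2 : lam⁻¹ * ridgeVar (lam * weight η n) v n (φ n) ≤
        leverage (lam * weight η (n + 1)) v n := by
      have e : leverage (lam * weight η (n + 1)) v n =
          lam⁻¹ * ridgeVar (lam * weight η (n + 1)) v n (φ n) := by
        have e1 : v n = √(weight η (n + 1)) • φ n := rfl
        rw [leverage, ridgeVar, e1, map_smul, inner_smul_left, inner_smul_right, conj_trivial,
          ← mul_assoc, Real.mul_self_sqrt (hw _).le]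
        field_simp
      rw [e]
      refine mul_le_mul_of_nonneg_left (ridgeVar_mono (mul_pos hlam (hw n)) ?_ _ _ _)
        (inv_nonneg.2 hlam.le)
      rw [hstep, le_div_iff₀ hη]
      exact mul_le_of_le_one_right (mul_pos hlam (hw n)).le hη1
    have h3 : 0 ≤ lam⁻¹ * ridgeVar (lam * weight η n) v n (φ n) :=
      mul_nonneg (inv_nonneg.2 hlam.le) (ridgeVar_nonneg (mul_pos hlam (hw n)) _ _ _)
    rw [pow_succ, Finset.prod_range_succ, Finset.prod_range_succ]
    calc _ = η ^ Fintype.card ι * ((η ^ Fintype.card ι) ^ n * ∏ s ∈ Finset.range n, (1 + lam⁻¹ *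
          ridgeVar (lam * weight η s) v s (φ s))) *
          (1 + lam⁻¹ * ridgeVar (lam * weight η n) v n (φ n)) := by ring
      _ ≤ η ^ Fintype.card ι * (∏ i ∈ Finset.range n, (1 + leverage (lam * weight η n) v i)) *
          (1 + leverage (lam * weight η (n + 1)) v n) := by
        gcongr
        refine mul_nonneg (pow_nonneg hη.le _) (Finset.prod_nonneg fun i _ => ?_)
        have := leverage_nonneg (mul_pos hlam (hw n)) v i
        linarith
      _ ≤ _ := by
        refine mul_le_mul_of_nonneg_right h1 ?_
        linarith

/-! ### One step of the method of mixtures. -/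

section Mixture

open ProbabilityTheory ENNReal

/-- The conditional bound says that the measure with density exp(re − r²/2), restricted to the
σ-algebra m, is at most P. Stated this way it applies to every m-measurable M without integrability.
-/
lemma lintegral_mul_exp_const_le {Ω : Type*} {m mΩ : MeasurableSpace Ω} {P : Measure Ω}
    [IsProbabilityMeasure P] (hm : m ≤ mΩ) {e : Ω → ℝ} (he : Measurable e) (r : ℝ)
    (hi : Integrable (fun ω => Real.exp (r * e ω)) P)
    (hs : P[fun ω => Real.exp (r * e ω) | m] ≤ᵐ[P] fun _ => Real.exp (r ^ 2 / 2))
    {M : Ω → ℝ≥0∞} (hM : Measurable[m] M) :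
    ∫⁻ ω, M ω * ENNReal.ofReal (Real.exp (r * e ω - r ^ 2 / 2)) ∂P ≤ ∫⁻ ω, M ω ∂P := by
  set g : Ω → ℝ≥0∞ := fun ω => ENNReal.ofReal (Real.exp (r * e ω - r ^ 2 / 2)) with hg
  have hgm : Measurable g := by fun_prop
  have hint : Integrable (fun ω => Real.exp (r * e ω - r ^ 2 / 2)) P := by
    simpa only [Real.exp_sub, div_eq_mul_inv] using hi.mul_const _
  have hle : (P.withDensity g).trim hm ≤ P.trim hm := by
    refine Measure.le_iff.2 fun A hA => ?_
    rw [trim_measurableSet_eq hm hA, trim_measurableSet_eq hm hA, withDensity_apply _ (hm A hA),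
      hg, ← ofReal_integral_eq_lintegral_ofReal hint.integrableOn
        (Filter.Eventually.of_forall fun ω => (Real.exp_pos _).le)]
    refine ENNReal.ofReal_le_of_le_toReal ?_
    have h1 : ∫ ω in A, Real.exp (r * e ω) ∂P ≤ P.real A * Real.exp (r ^ 2 / 2) := by
      rw [← setIntegral_condExp hm hi hA, ← smul_eq_mul, ← setIntegral_const]
      exact setIntegral_mono_ae integrable_condExp.integrableOn
        (integrable_const _).integrableOn hs
    simp only [Real.exp_sub, integral_div]
    rw [div_le_iff₀ (Real.exp_pos _)]
    exact h1
  calc ∫⁻ ω, M ω * g ω ∂P = ∫⁻ ω, M ω ∂(P.withDensity g) := by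
        rw [lintegral_withDensity_eq_lintegral_mul _ hgm (hM.mono hm le_rfl)]
        simp only [Pi.mul_apply, mul_comm]
    _ = ∫⁻ ω, M ω ∂((P.withDensity g).trim hm) := (lintegral_trim hm hM).symm
    _ ≤ ∫⁻ ω, M ω ∂(P.trim hm) := lintegral_mono' hle le_rfl
    _ = _ := lintegral_trim hm hM

/-- A predictable multiplier with countably many values is constant on each event {J = j}, which
belongs to m. -/
lemma lintegral_mul_exp_floor_le {Ω : Type*} {m mΩ : MeasurableSpace Ω} {P : Measure Ω}
    [IsProbabilityMeasure P] (hm : m ≤ mΩ) {e : Ω → ℝ} (he : Measurable e)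
    (hi : ∀ r, Integrable (fun ω => Real.exp (r * e ω)) P)
    (hs : ∀ r, P[fun ω => Real.exp (r * e ω) | m] ≤ᵐ[P] fun _ => Real.exp (r ^ 2 / 2))
    {M : Ω → ℝ≥0∞} (hM : Measurable[m] M) {J : Ω → ℤ} (hJ : Measurable[m] J) (q : ℤ → ℝ) :
    ∫⁻ ω, M ω * ENNReal.ofReal (Real.exp (q (J ω) * e ω - q (J ω) ^ 2 / 2)) ∂P ≤
      ∫⁻ ω, M ω ∂P := by
  have hset : ∀ j : ℤ, MeasurableSet[m] (J ⁻¹' {j}) := fun j => hJ (measurableSet_singleton j)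
  have hdec : ∀ N : Ω → ℝ≥0∞, ∀ ω, N ω = ∑' j : ℤ, (J ⁻¹' {j}).indicator N ω := by
    intro N ω
    rw [tsum_eq_single (J ω)]
    · simp
    · intro j hj
      exact Set.indicator_of_notMem (fun h => hj (by simpa using h.symm)) _
  have hMm := hM.mono hm le_rfl
  have hJm := hJ.mono hm le_rfl
  have hmeas : ∀ j : ℤ, Measurable fun ω => (J ⁻¹' {j}).indicator (fun ω =>
      M ω * ENNReal.ofReal (Real.exp (q (J ω) * e ω - q (J ω) ^ 2 / 2))) ω := by
    intro j
    refine Measurable.indicator ?_ (hm _ (hset j))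
    have : Measurable fun ω => q (J ω) := (measurable_from_top (f := q)).comp hJm
    fun_prop
  calc _ = ∫⁻ ω, ∑' j : ℤ, (J ⁻¹' {j}).indicator (fun ω =>
        M ω * ENNReal.ofReal (Real.exp (q (J ω) * e ω - q (J ω) ^ 2 / 2))) ω ∂P :=
        lintegral_congr fun ω => hdec _ ω
    _ = ∑' j : ℤ, ∫⁻ ω, (J ⁻¹' {j}).indicator (fun ω =>
        M ω * ENNReal.ofReal (Real.exp (q (J ω) * e ω - q (J ω) ^ 2 / 2))) ω ∂P :=
        lintegral_tsum fun j => (hmeas j).aemeasurable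
    _ ≤ ∑' j : ℤ, ∫⁻ ω, (J ⁻¹' {j}).indicator M ω ∂P := by
        refine ENNReal.tsum_le_tsum fun j => ?_
        refine le_trans (le_of_eq ?_) (lintegral_mul_exp_const_le hm he (q j) (hi _) (hs _)
          (hM.indicator (hset j)))
        refine lintegral_congr fun ω => ?_
        by_cases h : ω ∈ J ⁻¹' {j}
        · rw [Set.indicator_of_mem h, Set.indicator_of_mem h, show J ω = j from h]
        · rw [Set.indicator_of_notMem h, Set.indicator_of_notMem h, zero_mul]
    _ = ∫⁻ ω, ∑' j : ℤ, (J ⁻¹' {j}).indicator M ω ∂P :=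
        (lintegral_tsum fun j => (hMm.indicator (hm _ (hset j))).aemeasurable).symm
    _ = _ := lintegral_congr fun ω => (hdec _ ω).symm

/-- Any predictable multiplier h is the limit of ⌊h(k+1)⌋/(k+1); Fatou's lemma passes to the limit.
-/
lemma lintegral_mul_exp_le {Ω : Type*} {m mΩ : MeasurableSpace Ω} {P : Measure Ω}
    [IsProbabilityMeasure P] (hm : m ≤ mΩ) {e : Ω → ℝ} (he : Measurable e)
    (hi : ∀ r, Integrable (fun ω => Real.exp (r * e ω)) P)
    (hs : ∀ r, P[fun ω => Real.exp (r * e ω) | m] ≤ᵐ[P] fun _ => Real.exp (r ^ 2 / 2))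
    {M : Ω → ℝ≥0∞} (hM : Measurable[m] M) {h : Ω → ℝ} (hh : Measurable[m] h) :
    ∫⁻ ω, M ω * ENNReal.ofReal (Real.exp (h ω * e ω - h ω ^ 2 / 2)) ∂P ≤ ∫⁻ ω, M ω ∂P := by
  let J : ℕ → Ω → ℤ := fun k ω => ⌊h ω * ((k : ℝ) + 1)⌋
  let q : ℕ → ℤ → ℝ := fun k j => (j : ℝ) / ((k : ℝ) + 1)
  have hJ : ∀ k, Measurable[m] (J k) := fun k => Int.measurable_floor.comp (hh.mul_const _)
  let G : ℕ → Ω → ℝ≥0∞ := fun k ω =>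
    M ω * ENNReal.ofReal (Real.exp (q k (J k ω) * e ω - q k (J k ω) ^ 2 / 2))
  have hG : ∀ k, Measurable (G k) := by
    intro k
    have h1 : Measurable fun ω => q k (J k ω) :=
      (measurable_from_top (f := q k)).comp ((hJ k).mono hm le_rfl)
    exact (hM.mono hm le_rfl).mul (((h1.mul he).sub ((h1.pow_const 2).div_const 2)).exp.ennreal_ofReal)
  have hlim : ∀ ω, Filter.Tendsto (fun k => q k (J k ω)) Filter.atTop (nhds (h ω)) := by
    intro ω
    have h1 : Filter.Tendsto (fun k : ℕ => h ω - 1 / ((k : ℝ) + 1)) Filter.atTop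
        (nhds (h ω)) := by
      simpa using tendsto_const_nhds.sub (tendsto_one_div_add_atTop_nhds_zero_nat (𝕜 := ℝ))
    refine tendsto_of_tendsto_of_tendsto_of_le_of_le h1 tendsto_const_nhds (fun k => ?_)
      fun k => ?_
    · have hk : (0 : ℝ) < (k : ℝ) + 1 := by positivity
      have := Int.lt_floor_add_one (h ω * ((k : ℝ) + 1))
      simp only [q, J]
      rw [sub_le_iff_le_add, ← add_div, le_div_iff₀ hk]
      exact this.le
    · have hk : (0 : ℝ) < (k : ℝ) + 1 := by positivity
      simp only [q, J]
      rw [div_le_iff₀ hk]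
      exact Int.floor_le _
  have hlimG : ∀ ω, Filter.Tendsto (fun k => G k ω) Filter.atTop
      (nhds (M ω * ENNReal.ofReal (Real.exp (h ω * e ω - h ω ^ 2 / 2)))) := by
    intro ω
    refine ENNReal.Tendsto.const_mul (ENNReal.tendsto_ofReal ?_) (Or.inl ?_)
    · exact (Real.continuous_exp.tendsto _).comp
        (((hlim ω).mul_const _).sub (((hlim ω).pow 2).div_const 2))
    · simp [Real.exp_pos]
  calc _ = ∫⁻ ω, Filter.liminf (fun k => G k ω) Filter.atTop ∂P :=
        lintegral_congr fun ω => ((hlimG ω).liminf_eq).symm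
    _ ≤ Filter.liminf (fun k => ∫⁻ ω, G k ω ∂P) Filter.atTop := lintegral_liminf_le hG
    _ ≤ ∫⁻ ω, M ω ∂P := by
        refine Filter.liminf_le_of_le (by isBoundedDefault) fun b hb => ?_
        obtain ⟨k, hk⟩ := hb.exists
        exact hk.trans (lintegral_mul_exp_floor_le hm he hi hs hM (hJ k) (q k))

/-- Completing the square: the integrand is a constant times the density of the normal law with
variance 1/(1+τ) and mean √τ(e − a)/(1+τ). -/
lemma lintegral_gaussian_mixture (a e : ℝ) {τ : ℝ} (hτ : 0 ≤ τ) :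
    ∫⁻ z, ENNReal.ofReal (Real.exp ((a + √τ * z) * e - (a + √τ * z) ^ 2 / 2))
        ∂(gaussianReal 0 1) =
      ENNReal.ofReal (Real.exp ((2 * e * a + e ^ 2 * τ - a ^ 2) / (2 * (1 + τ))) / √(1 + τ)) := by
  rw [gaussianReal_of_var_ne_zero _ one_ne_zero,
    lintegral_withDensity_eq_lintegral_mul _ (measurable_gaussianPDF _ _) (by fun_prop)]
  have h1τ : 0 < 1 + τ := by linarith
  set V : NNReal := ⟨(1 + τ)⁻¹, (inv_pos.2 h1τ).le⟩ with hV
  have hVr : (V : ℝ) = (1 + τ)⁻¹ := rfl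
  have hV0 : V ≠ 0 := fun h => (inv_pos.2 h1τ).ne' (by rw [← hVr, h]; rfl)
  set μ := √τ * (e - a) / (1 + τ) with hμ
  set c := Real.exp ((2 * e * a + e ^ 2 * τ - a ^ 2) / (2 * (1 + τ))) / √(1 + τ) with hc
  have hc0 : 0 ≤ c := by positivity
  have key : ∀ z, (gaussianPDF 0 1 * fun z => ENNReal.ofReal
      (Real.exp ((a + √τ * z) * e - (a + √τ * z) ^ 2 / 2))) z =
      ENNReal.ofReal c * gaussianPDF μ V z := by
    intro z
    rw [Pi.mul_apply, gaussianPDF, gaussianPDF, ← ENNReal.ofReal_mul (gaussianPDFReal_nonneg _ _ _),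
      ← ENNReal.ofReal_mul hc0]
    congr 1
    rw [gaussianPDFReal, gaussianPDFReal, hVr, hc]
    have hs : √(2 * Real.pi * (1 + τ)⁻¹) = √(2 * Real.pi) / √(1 + τ) := by
      rw [← div_eq_mul_inv, Real.sqrt_div (by positivity)]
    rw [hs]
    have hq : 0 < √(1 + τ) := Real.sqrt_pos.2 h1τ
    have hp : 0 < √(2 * Real.pi) := by positivity
    have hexp : Real.exp (-(z - 0) ^ 2 / (2 * ((1 : NNReal) : ℝ))) *
        Real.exp ((a + √τ * z) * e - (a + √τ * z) ^ 2 / 2) =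
        Real.exp ((2 * e * a + e ^ 2 * τ - a ^ 2) / (2 * (1 + τ))) *
          Real.exp (-(z - μ) ^ 2 / (2 * (1 + τ)⁻¹)) := by
      rw [← Real.exp_add, ← Real.exp_add]
      congr 1
      rw [hμ, NNReal.coe_one]
      field_simp
      have := Real.sq_sqrt hτ
      ring_nf
      simp only [this]
      ring
    calc _ = (√(2 * Real.pi))⁻¹ * (Real.exp (-(z - 0) ^ 2 / (2 * ((1 : NNReal) : ℝ))) *
        Real.exp ((a + √τ * z) * e - (a + √τ * z) ^ 2 / 2)) := by
          rw [NNReal.coe_one, mul_one]; ring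
      _ = _ := by rw [hexp]; field_simp
  rw [lintegral_congr key, lintegral_const_mul _ (measurable_gaussianPDF _ _),
    lintegral_gaussianPDF_eq_one _ hV0, mul_one]

/-- One step of the method of mixtures with a one-dimensional Gaussian. -/
lemma lintegral_mul_mixture_le {Ω : Type*} {m mΩ : MeasurableSpace Ω} {P : Measure Ω}
    [IsProbabilityMeasure P] (hm : m ≤ mΩ) {e : Ω → ℝ} (he : Measurable e)
    (hi : ∀ r, Integrable (fun ω => Real.exp (r * e ω)) P)
    (hs : ∀ r, P[fun ω => Real.exp (r * e ω) | m] ≤ᵐ[P] fun _ => Real.exp (r ^ 2 / 2))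
    {M : Ω → ℝ≥0∞} (hM : Measurable[m] M) {a τ : Ω → ℝ} (ha : Measurable[m] a)
    (hτ : Measurable[m] τ) (hτ0 : ∀ ω, 0 ≤ τ ω) :
    ∫⁻ ω, M ω * ENNReal.ofReal (Real.exp ((2 * e ω * a ω + e ω ^ 2 * τ ω - a ω ^ 2) /
        (2 * (1 + τ ω))) / √(1 + τ ω)) ∂P ≤ ∫⁻ ω, M ω ∂P := by
  have ha' := ha.mono hm le_rfl
  have hτ' := hτ.mono hm le_rfl
  have hM' := hM.mono hm le_rfl
  calc _ = ∫⁻ ω, ∫⁻ z, M ω * ENNReal.ofReal (Real.exp ((a ω + √(τ ω) * z) * e ω -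
        (a ω + √(τ ω) * z) ^ 2 / 2)) ∂(gaussianReal 0 1) ∂P := by
        refine lintegral_congr fun ω => ?_
        rw [lintegral_const_mul _ (by fun_prop), lintegral_gaussian_mixture _ _ (hτ0 ω)]
    _ = ∫⁻ z, ∫⁻ ω, M ω * ENNReal.ofReal (Real.exp ((a ω + √(τ ω) * z) * e ω -
        (a ω + √(τ ω) * z) ^ 2 / 2)) ∂P ∂(gaussianReal 0 1) := by
        refine lintegral_lintegral_swap (Measurable.aemeasurable ?_)
        have h1 : Measurable fun p : Ω × ℝ => M p.1 := hM'.comp measurable_fst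
        have h2 : Measurable fun p : Ω × ℝ => a p.1 := ha'.comp measurable_fst
        have h3 : Measurable fun p : Ω × ℝ => √(τ p.1) := (hτ'.comp measurable_fst).sqrt
        have h4 : Measurable fun p : Ω × ℝ => e p.1 := he.comp measurable_fst
        have h5 : Measurable fun p : Ω × ℝ => a p.1 + √(τ p.1) * p.2 :=
          h2.add (h3.mul measurable_snd)
        exact h1.mul (((h5.mul h4).sub ((h5.pow_const 2).div_const 2)).exp.ennreal_ofReal)
    -- For fixed z the multiplier a + √τ z is predictable.
    _ ≤ ∫⁻ _, ∫⁻ ω, M ω ∂P ∂(gaussianReal 0 1) :=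
        lintegral_mono fun z => lintegral_mul_exp_le hm he hi hs hM
          (ha.add (hτ.sqrt.mul_const z))
    _ = _ := by simp

end Mixture

/-! ### Self-normalized tail bound. -/

section SelfNormalized

open ENNReal

variable {E : Type*} [NormedAddCommGroup E] [InnerProductSpace ℝ E]

lemma one_le_prod_leverage {α : ℝ} (hα : 0 < α) (v : ℕ → E) (n : ℕ) :
    1 ≤ ∏ i ∈ Finset.range n, (1 + leverage α v i) := by
  refine Finset.prod_induction _ (fun x => 1 ≤ x)
    (fun a b => one_le_mul_of_one_le_of_one_le) le_rfl fun i _ => ?_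
  have := leverage_nonneg hα v i
  linarith

/-- The recursion only involves Gram entries, so `E` needs neither a measurable structure nor
separability. -/
lemma measurable_inner_ridgeInv {Ω : Type*} {m : MeasurableSpace Ω} {α : ℝ} (hα : 0 < α)
    {v : Ω → ℕ → E} {N : ℕ}
    (hv : ∀ i < N, ∀ j < N, Measurable fun ω => (inner ℝ (v ω i) (v ω j) : ℝ)) {n : ℕ}
    (hn : n ≤ N) : ∀ i < N, ∀ j < N,
      Measurable fun ω => (inner ℝ (v ω i) (ridgeInv α (v ω) n (v ω j)) : ℝ) := by
  induction n with
  | zero =>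
    intro i hi j hj
    simp only [ridgeInv_zero_apply, inner_smul_right]
    exact (hv i hi j hj).const_mul _
  | succ n ih =>
    intro i hi j hj
    have h := ih (Nat.le_of_succ_le hn)
    simp only [ridgeInv_succ_apply, inner_sub_right, inner_smul_right,
      inner_ridgeInv_comm hα, leverage]
    have h1 := h i hi j hj
    have h2 := h n hn n hn
    have h3 := h n hn j hj
    have h4 := h i hi n hn
    exact h1.sub ((((h2.const_add 1).inv).mul h3).mul h4)

/-- The supermartingale of the method of mixtures. -/
noncomputable def mixtureValue (α : ℝ) (v : ℕ → E) (e : ℕ → ℝ) (n : ℕ) : ℝ :=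
  Real.exp (inner ℝ (∑ i ∈ Finset.range n, e i • v i)
    (ridgeInv α v n (∑ i ∈ Finset.range n, e i • v i)) / 2) /
    √(∏ i ∈ Finset.range n, (1 + leverage α v i))

/-- The new factor is the closed form of `lintegral_gaussian_mixture` with a the value at v_n of the
ridge estimate from the past and τ the leverage. Mixing one scalar per round thus reproduces a
Gaussian mixture on the whole space. -/
lemma mixtureValue_succ {α : ℝ} (hα : 0 < α) (v : ℕ → E) (e : ℕ → ℝ) (n : ℕ) :
    mixtureValue α v e (n + 1) = mixtureValue α v e n *
      (Real.exp ((2 * e n * (∑ i ∈ Finset.range n, e i * inner ℝ (v n) (ridgeInv α v n (v i))) +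
        e n ^ 2 * leverage α v n -
        (∑ i ∈ Finset.range n, e i * inner ℝ (v n) (ridgeInv α v n (v i))) ^ 2) /
        (2 * (1 + leverage α v n))) / √(1 + leverage α v n)) := by
  have ha : ∑ i ∈ Finset.range n, e i * inner ℝ (v n) (ridgeInv α v n (v i)) =
      inner ℝ (v n) (ridgeInv α v n (∑ i ∈ Finset.range n, e i • v i)) := by
    simp only [map_sum, map_smul, inner_sum, inner_smul_right]
  have h0 : 0 ≤ ∏ i ∈ Finset.range n, (1 + leverage α v i) :=
    Finset.prod_nonneg fun i _ => by have := leverage_nonneg hα v i; linarith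
  rw [ha, mixtureValue, mixtureValue, Finset.sum_range_succ, inner_ridgeInv_succ_update hα,
    Finset.prod_range_succ, Real.sqrt_mul h0, add_div, Real.exp_add, div_div,
    mul_comm (2 : ℝ) (1 + leverage α v n),
    div_mul_div_comm]

lemma measurable_mixtureValue {Ω : Type*} {m : MeasurableSpace Ω} {α : ℝ} (hα : 0 < α)
    {v : Ω → ℕ → E} {e : ℕ → Ω → ℝ} {n : ℕ}
    (hv : ∀ i < n, ∀ j < n, Measurable fun ω => (inner ℝ (v ω i) (v ω j) : ℝ))
    (he : ∀ i < n, Measurable (e i)) :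
    Measurable fun ω => mixtureValue α (v ω) (fun i => e i ω) n := by
  simp only [mixtureValue, map_sum, map_smul, sum_inner, inner_sum, inner_smul_left,
    inner_smul_right, conj_trivial]
  refine Measurable.div (Measurable.exp (Measurable.div_const ?_ 2)) (Measurable.sqrt ?_)
  · refine Finset.measurable_sum _ fun i hi => ?_
    have hi' := Finset.mem_range.1 hi
    refine (he _ hi').mul (Finset.measurable_sum _ fun j hj => ?_)
    have hj' := Finset.mem_range.1 hj
    exact (he _ hj').mul (measurable_inner_ridgeInv hα hv le_rfl _ hj' _ hi')
  · refine Finset.measurable_prod _ fun i hi => ?_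
    have hi' := Finset.mem_range.1 hi
    exact (measurable_inner_ridgeInv hα hv hi'.le _ hi' _ hi').const_add 1

/-- Each round integrates out by `lintegral_mul_mixture_le`; stage n only needs the earlier noise
and the Gram entries up to n to be measurable for F n. -/
lemma lintegral_mixtureValue_le_one {Ω : Type*} [mΩ : MeasurableSpace Ω] {P : Measure Ω}
    [IsProbabilityMeasure P] {α : ℝ} (hα : 0 < α) {v : Ω → ℕ → E} {e : ℕ → Ω → ℝ} {t : ℕ}
    {F : ℕ → MeasurableSpace Ω} (hF : ∀ n < t, F n ≤ mΩ)
    (hv : ∀ n < t, ∀ i ≤ n, ∀ j ≤ n, Measurable[F n] fun ω => (inner ℝ (v ω i) (v ω j) : ℝ))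
    (he : ∀ n < t, ∀ i < n, Measurable[F n] (e i)) (hem : ∀ n < t, Measurable (e n))
    (hi : ∀ n < t, ∀ r : ℝ, Integrable (fun ω => Real.exp (r * e n ω)) P)
    (hs : ∀ n < t, ∀ r : ℝ,
      P[fun ω => Real.exp (r * e n ω) | F n] ≤ᵐ[P] fun _ => Real.exp (r ^ 2 / 2))
    {n : ℕ} (hn : n ≤ t) :
    ∫⁻ ω, ENNReal.ofReal (mixtureValue α (v ω) (fun i => e i ω) n) ∂P ≤ 1 := by
  induction n with
  | zero => simp [mixtureValue]
  | succ n ih =>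
    have hn' : n < t := hn
    refine le_trans (le_of_eq ?_) ((lintegral_mul_mixture_le (hF n hn') (hem n hn') (hi n hn')
      (hs n hn')
      (M := fun ω => ENNReal.ofReal (mixtureValue α (v ω) (fun i => e i ω) n))
      (a := fun ω => ∑ i ∈ Finset.range n,
        e i ω * inner ℝ (v ω n) (ridgeInv α (v ω) n (v ω i)))
      (τ := fun ω => leverage α (v ω) n) ?_ ?_ ?_ fun ω => leverage_nonneg hα _ _).trans
      (ih hn'.le))
    · refine lintegral_congr fun ω => ?_
      have h0 : 0 ≤ mixtureValue α (v ω) (fun i => e i ω) n := by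
        rw [mixtureValue]; positivity
      rw [mixtureValue_succ hα, ENNReal.ofReal_mul h0]
    · exact (measurable_mixtureValue (m := F n) hα
        (fun i hi j hj => hv n hn' i hi.le j hj.le) (he n hn')).ennreal_ofReal
    · refine Finset.measurable_sum _ fun i hi => ?_
      have hi' := Finset.mem_range.1 hi
      exact (he n hn' i hi').mul (measurable_inner_ridgeInv (m := F n) (N := n + 1) hα
        (fun i hi j hj => hv n hn' i (Nat.le_of_lt_succ hi) j (Nat.le_of_lt_succ hj))
        (Nat.le_succ n) n (Nat.lt_succ_self n) i (by omega))
    · exact measurable_inner_ridgeInv (m := F n) (N := n + 1) hα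
        (fun i hi j hj => hv n hn' i (Nat.le_of_lt_succ hi) j (Nat.le_of_lt_succ hj))
        (Nat.le_succ n) n (Nat.lt_succ_self n) n (Nat.lt_succ_self n)

/-- Markov's inequality for the mixture at level 1/δ, after taking logarithms. -/
lemma measure_mixtureValue_ge_le {Ω : Type*} [mΩ : MeasurableSpace Ω] {P : Measure Ω}
    [IsProbabilityMeasure P] {α : ℝ} (hα : 0 < α) {v : Ω → ℕ → E} {e : ℕ → Ω → ℝ} {t : ℕ}
    {F : ℕ → MeasurableSpace Ω} (hF : ∀ n < t, F n ≤ mΩ)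
    (hv : ∀ n < t, ∀ i ≤ n, ∀ j ≤ n, Measurable[F n] fun ω => (inner ℝ (v ω i) (v ω j) : ℝ))
    (he : ∀ n < t, ∀ i < n, Measurable[F n] (e i)) (hem : ∀ n < t, Measurable (e n))
    (hi : ∀ n < t, ∀ r : ℝ, Integrable (fun ω => Real.exp (r * e n ω)) P)
    (hs : ∀ n < t, ∀ r : ℝ,
      P[fun ω => Real.exp (r * e n ω) | F n] ≤ᵐ[P] fun _ => Real.exp (r ^ 2 / 2))
    {δ : ℝ} (hδ : 0 < δ) :
    P {ω | 2 * Real.log (1 / δ) + Real.log (∏ i ∈ Finset.range t, (1 + leverage α (v ω) i)) ≤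
      inner ℝ (∑ i ∈ Finset.range t, e i ω • v ω i)
        (ridgeInv α (v ω) t (∑ i ∈ Finset.range t, e i ω • v ω i))} ≤ ENNReal.ofReal δ := by
  have hm : Measurable fun ω => mixtureValue α (v ω) (fun i => e i ω) t := by
    refine measurable_mixtureValue hα (fun i hi j hj => ?_) fun i hi => hem i hi
    rcases le_total i j with h | h
    · exact (hv j hj i h j le_rfl).mono (hF j hj) le_rfl
    · exact (hv i hi i le_rfl j h).mono (hF i hi) le_rfl
  have h1 := lintegral_mixtureValue_le_one hα hF hv he hem hi hs le_rfl
  have h2 := mul_meas_ge_le_lintegral hm.ennreal_ofReal (μ := P) (ENNReal.ofReal (1 / δ))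
  have h3 := h2.trans h1
  rw [one_div, ENNReal.ofReal_inv_of_pos hδ] at h3
  have hδ0 : ENNReal.ofReal δ ≠ 0 := by simpa using hδ
  have h4 := mul_le_mul_right h3 (ENNReal.ofReal δ)
  rw [← mul_assoc, ENNReal.mul_inv_cancel hδ0 ENNReal.ofReal_ne_top, one_mul, mul_one] at h4
  refine le_trans (measure_mono fun ω hω => ?_) h4
  simp only [Set.mem_ofPred_eq] at hω ⊢
  rw [← ENNReal.ofReal_inv_of_pos hδ]
  refine ENNReal.ofReal_le_ofReal ?_
  have hD : 0 < ∏ i ∈ Finset.range t, (1 + leverage α (v ω) i) :=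
    Finset.prod_pos fun i _ => by have := leverage_nonneg hα (v ω) i; linarith
  rw [mixtureValue, le_div_iff₀ (Real.sqrt_pos.2 hD), ← Real.log_le_iff_le_exp (by positivity),
    Real.log_mul (by positivity) (by positivity), Real.log_sqrt hD.le, ← one_div]
  linarith

/-- The self-normalized tail bound for a fixed time, for conditionally `R`-sub-Gaussian noise. -/
lemma measure_selfNormalized_le {Ω : Type*} [mΩ : MeasurableSpace Ω] {P : Measure Ω}
    [IsProbabilityMeasure P] {α R : ℝ} (hα : 0 < α) (hR : 0 ≤ R) {v : Ω → ℕ → E}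
    {e : ℕ → Ω → ℝ} {t : ℕ} {F : ℕ → MeasurableSpace Ω} (hF : ∀ n < t, F n ≤ mΩ)
    (hv : ∀ n < t, ∀ i ≤ n, ∀ j ≤ n, Measurable[F n] fun ω => (inner ℝ (v ω i) (v ω j) : ℝ))
    (he : ∀ n < t, ∀ i < n, Measurable[F n] (e i)) (hem : ∀ n < t, Measurable (e n))
    (hi : ∀ n < t, ∀ r : ℝ, Integrable (fun ω => Real.exp (r * e n ω)) P)
    (hs : ∀ n < t, ∀ r : ℝ,
      P[fun ω => Real.exp (r * e n ω) | F n] ≤ᵐ[P] fun _ => Real.exp (r ^ 2 * R ^ 2 / 2))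
    {δ : ℝ} (hδ : 0 < δ) (hδ1 : δ ≤ 1) :
    P {ω | R ^ 2 * (2 * Real.log (1 / δ) +
        Real.log (∏ i ∈ Finset.range t, (1 + leverage α (v ω) i))) <
      inner ℝ (∑ i ∈ Finset.range t, e i ω • v ω i)
        (ridgeInv α (v ω) t (∑ i ∈ Finset.range t, e i ω • v ω i))} ≤ ENNReal.ofReal δ := by
  -- Rescaling the noise by any positive r ≥ R reduces to the 1-sub-Gaussian case.
  have hpos : ∀ r : ℝ, 0 < r → R ≤ r → P {ω | r ^ 2 * (2 * Real.log (1 / δ) +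
        Real.log (∏ i ∈ Finset.range t, (1 + leverage α (v ω) i))) ≤
      inner ℝ (∑ i ∈ Finset.range t, e i ω • v ω i)
        (ridgeInv α (v ω) t (∑ i ∈ Finset.range t, e i ω • v ω i))} ≤ ENNReal.ofReal δ := by
    intro r hr hRr
    have hex : ∀ n (s : ℝ), (fun ω => Real.exp (s * (r⁻¹ * e n ω))) =
        fun ω => Real.exp (s * r⁻¹ * e n ω) := fun n s => by simp only [mul_assoc]
    have := measure_mixtureValue_ge_le (P := P) hα (v := v) (e := fun i ω => r⁻¹ * e i ω) hF hv
      (fun n hn i hi => (he n hn i hi).const_mul _) (fun n hn => (hem n hn).const_mul _)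
      (fun n hn s => by rw [hex]; exact hi n hn _)
      (fun n hn s => by
        rw [hex]
        refine (hs n hn (s * r⁻¹)).trans (Filter.Eventually.of_forall fun _ => ?_)
        refine Real.exp_le_exp.2 ?_
        have h1 : R ^ 2 ≤ r ^ 2 := pow_le_pow_left₀ hR hRr 2
        rw [mul_pow]
        have h2 : s ^ 2 * r⁻¹ ^ 2 * R ^ 2 ≤ s ^ 2 * r⁻¹ ^ 2 * r ^ 2 := by gcongr
        have h3 : s ^ 2 * r⁻¹ ^ 2 * r ^ 2 = s ^ 2 := by field_simp
        linarith) hδ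
    refine le_trans (measure_mono fun ω hω => ?_) this
    simp only [Set.mem_ofPred_eq] at hω ⊢
    have hS : ∑ i ∈ Finset.range t, (r⁻¹ * e i ω) • v ω i =
        r⁻¹ • ∑ i ∈ Finset.range t, e i ω • v ω i := by
      simp only [mul_smul, Finset.smul_sum]
    rw [hS, map_smul, inner_smul_left, inner_smul_right, conj_trivial, ← mul_assoc,
      ← mul_inv, ← sq, le_inv_mul_iff₀ (by positivity)]
    exact hω
  rcases hR.eq_or_lt with h0 | h0
  -- For R = 0 division by R is impossible: take r = 1/(n+1). The events increase with n, and their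
  -- union contains the strict event, which is why the inequality in the statement is strict.
  · subst h0
    set K : Ω → ℝ := fun ω => 2 * Real.log (1 / δ) +
        Real.log (∏ i ∈ Finset.range t, (1 + leverage α (v ω) i)) with hK
    set Z : Ω → ℝ := fun ω => inner ℝ (∑ i ∈ Finset.range t, e i ω • v ω i)
        (ridgeInv α (v ω) t (∑ i ∈ Finset.range t, e i ω • v ω i)) with hZ
    have hK0 : ∀ ω, 0 ≤ K ω := by
      intro ω
      have h1 : 0 ≤ Real.log (1 / δ) := Real.log_nonneg (by rwa [le_div_iff₀ hδ, one_mul])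
      have h2 : 0 ≤ Real.log (∏ i ∈ Finset.range t, (1 + leverage α (v ω) i)) := by
        exact Real.log_nonneg (one_le_prod_leverage hα (v ω) t)
      simp only [hK]; linarith
    let A : ℕ → Set Ω := fun n => {ω | (1 / ((n : ℝ) + 1)) ^ 2 * K ω ≤ Z ω}
    have hA : ∀ n, P (A n) ≤ ENNReal.ofReal δ := fun n =>
      hpos (1 / ((n : ℝ) + 1)) (by positivity) (by positivity)
    have hmono : Monotone A := by
      intro n k hnk ω hω
      refine le_trans ?_ (show (1 / ((n : ℝ) + 1)) ^ 2 * K ω ≤ Z ω from hω)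
      have h1 := hK0 ω
      have h2 : (n : ℝ) ≤ k := by exact_mod_cast hnk
      gcongr
    have hsub : {ω | (0 : ℝ) ^ 2 * K ω < Z ω} ⊆ ⋃ n, A n := by
      intro ω hω
      have hω' : 0 < Z ω := by simpa using hω
      have hlim : Filter.Tendsto (fun n : ℕ => (1 / ((n : ℝ) + 1)) ^ 2 * K ω) Filter.atTop
          (nhds 0) := by
        simpa using ((tendsto_one_div_add_atTop_nhds_zero_nat (𝕜 := ℝ)).pow 2).mul_const (K ω)
      obtain ⟨n, hn⟩ := (hlim.eventually (gt_mem_nhds hω')).exists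
      exact Set.mem_iUnion.2 ⟨n, hn.le⟩
    refine (measure_mono hsub).trans ?_
    rw [hmono.measure_iUnion]
    exact iSup_le hA
  · refine le_trans (measure_mono fun ω hω => ?_) (hpos R h0 le_rfl)
    exact le_of_lt (Set.mem_ofPred_eq ▸ hω)

end SelfNormalized

/-! ### From matrices with weights to ridge operators; gains and variance sums. -/

section Bridge

variable {E F : Type*} [NormedAddCommGroup E] [InnerProductSpace ℝ E]
  [NormedAddCommGroup F] [InnerProductSpace ℝ F]

lemma weight_pos {η : ℝ} (hη : 0 < η) (s : ℕ) : 0 < weight η s := inv_pos.2 (pow_pos hη s)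

lemma weight_mono {η : ℝ} (hη : 0 < η) (hη1 : η ≤ 1) : Monotone (weight η) := by
  intro s t h
  exact inv_anti₀ (pow_pos hη t) (pow_le_pow_of_le_one hη.le hη1 h)

/-- The features `√w_i ψ_i` of the weighted regression. -/
noncomputable def rootWeighted (η : ℝ) (ψ : ℕ → E) (i : ℕ) : E := √(weight η (i + 1)) • ψ i

/-- The features `w_i ψ_i` of the doubly weighted information gain. -/
noncomputable def fullWeighted (η : ℝ) (ψ : ℕ → E) (i : ℕ) : E := weight η (i + 1) • ψ i

lemma regularizedMatrix_eq {X : Type*} {k : X → X → ℝ} {φ : X → E}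
    (hk : ∀ z z', inner ℝ (φ z) (φ z') = k z z') (lam η : ℝ) (t : ℕ) (xs : ℕ → X) :
    regularizedMatrix k lam η (fun i : Fin t => xs i) =
      Matrix.gram ℝ (fun i : Fin t => rootWeighted η (fun i => φ (xs i)) i) +
        (lam * weight η t) • (1 : Matrix (Fin t) (Fin t) ℝ) := by
  rw [regularizedMatrix]
  congr 1
  ext i j
  simp only [weightedKernelMatrix, Matrix.of_apply, Matrix.gram_apply, rootWeighted,
    inner_smul_left, inner_smul_right, hk, conj_trivial]
  ring

lemma weightedKernelVector_eq {X : Type*} {k : X → X → ℝ} {φ : X → E}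
    (hk : ∀ z z', inner ℝ (φ z) (φ z') = k z z') (η : ℝ) (t : ℕ) (xs : ℕ → X) (z : X) :
    weightedKernelVector k η (fun i : Fin t => xs i) z =
      fun i : Fin t => inner ℝ (rootWeighted η (fun i => φ (xs i)) i) (φ z) := by
  ext i
  simp only [weightedKernelVector, rootWeighted, inner_smul_left, hk, conj_trivial]

lemma posteriorVar_eq {X : Type*} {k : X → X → ℝ} {φ : X → E}
    (hk : ∀ z z', inner ℝ (φ z) (φ z') = k z z') {lam η : ℝ} (hlam : 0 < lam) (hη : 0 < η)
    (t : ℕ) (xs : ℕ → X) (z : X) :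
    posteriorVar k lam η (fun i : Fin t => xs i) z =
      ridgeVar (lam * weight η t) (rootWeighted η fun i => φ (xs i)) t (φ z) := by
  rw [posteriorVar, regularizedMatrix_eq hk, weightedKernelVector_eq hk,
    ← ridgeVar_eq_schur (mul_pos hlam (weight_pos hη t)), hk]

/-- An observation meets √w_i twice, in W y and in the weighted feature; hence `fullWeighted` in the
sum and `rootWeighted` in the operator. -/
lemma posteriorMean_eq {X : Type*} {k : X → X → ℝ} {φ : X → E}
    (hk : ∀ z z', inner ℝ (φ z) (φ z') = k z z') {lam η : ℝ} (hlam : 0 < lam) (hη : 0 < η)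
    (t : ℕ) (xs : ℕ → X) (y : ℕ → ℝ) (z : X) :
    posteriorMean k lam η (fun i : Fin t => xs i) (fun i : Fin t => y i) z =
      inner ℝ (φ z) (ridgeInv (lam * weight η t) (rootWeighted η fun i => φ (xs i)) t
        (∑ i ∈ Finset.range t, y i • fullWeighted η (fun i => φ (xs i)) i)) := by
  rw [posteriorMean, regularizedMatrix_eq hk, weightedKernelVector_eq hk,
    dotProduct_inv_gram (mul_pos hlam (weight_pos hη t)),
    Finset.sum_range fun i => y i • fullWeighted η (fun i => φ (xs i)) i]
  congr 3
  funext i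
  rw [rootWeighted, fullWeighted, smul_smul, smul_smul, mul_right_comm,
    Real.mul_self_sqrt (weight_pos hη _).le, mul_comm]

lemma det_doubleGain_eq {X : Type*} {k : X → X → ℝ} {φ : X → E}
    (hk : ∀ z z', inner ℝ (φ z) (φ z') = k z z') {lam η : ℝ} (hlam : 0 < lam) (hη : 0 < η)
    (t : ℕ) (xs : ℕ → X) :
    ((1 : Matrix (Fin t) (Fin t) ℝ) + (lam * weight η t ^ 2)⁻¹ • Matrix.of fun i j : Fin t =>
      weight η ((i : ℕ) + 1) * weight η ((j : ℕ) + 1) * k (xs i) (xs j)).det =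
      ∏ i ∈ Finset.range t,
        (1 + leverage (lam * weight η t ^ 2) (fullWeighted η fun i => φ (xs i)) i) := by
  have hw := weight_pos hη t
  rw [← det_one_add_gram (by positivity)]
  congr 3
  ext i j
  simp only [Matrix.of_apply, Matrix.gram_apply, fullWeighted, inner_smul_left, inner_smul_right,
    hk, conj_trivial]
  ring

lemma det_featureGain_eq {X : Type*} {k : X → X → ℝ} {φ : X → E}
    (hk : ∀ z z', inner ℝ (φ z) (φ z') = k z z') {lam η : ℝ} (hlam : 0 < lam) (hη : 0 < η)
    (t : ℕ) (xs : ℕ → X) :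
    ((1 : Matrix (Fin t) (Fin t) ℝ) + (lam * weight η t)⁻¹ •
      weightedKernelMatrix k η (fun i : Fin t => xs i)).det =
      ∏ i ∈ Finset.range t,
        (1 + leverage (lam * weight η t) (rootWeighted η fun i => φ (xs i)) i) := by
  have hw := weight_pos hη t
  rw [← det_one_add_gram (by positivity)]
  congr 3
  ext i j
  simp only [weightedKernelMatrix, Matrix.of_apply, Matrix.gram_apply, rootWeighted,
    inner_smul_left, inner_smul_right, hk, conj_trivial]
  ring

/-! ### Bounds for the information gains -/

/-- Since w_i ≤ w_t, the weights disappear after division by λw_t and each round adds at most A/λ to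
the trace. -/
lemma prod_leverage_rootWeighted_le {ι : Type*} [Fintype ι] {lam η A : ℝ} (hlam : 0 < lam)
    (hη : 0 < η) (hη1 : η ≤ 1) (ψ : ℕ → EuclideanSpace ℝ ι) (hψ : ∀ i, ‖ψ i‖ ^ 2 ≤ A) (t : ℕ) :
    ∏ i ∈ Finset.range t, (1 + leverage (lam * weight η t) (rootWeighted η ψ) i) ≤
      (1 + t * (A / lam)) ^ Fintype.card ι := by
  have hw := weight_pos hη t
  refine (prod_one_add_leverage_le (by positivity) _ _).trans ?_
  have h1 : ∑ i ∈ Finset.range t, ‖rootWeighted η ψ i‖ ^ 2 ≤ t * (weight η t * A) := by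
    rw [← nsmul_eq_mul]
    refine (Finset.sum_le_card_nsmul _ _ (weight η t * A) fun i hi => ?_).trans_eq
      (by rw [Finset.card_range])
    rw [rootWeighted, norm_smul, mul_pow, Real.norm_of_nonneg (Real.sqrt_nonneg _),
      Real.sq_sqrt (weight_pos hη _).le]
    exact mul_le_mul (weight_mono hη hη1 (Finset.mem_range.1 hi)) (hψ i) (sq_nonneg _) hw.le
  have h2 : (lam * weight η t)⁻¹ * ∑ i ∈ Finset.range t, ‖rootWeighted η ψ i‖ ^ 2 ≤
      t * (A / lam) := by
    refine (mul_le_mul_of_nonneg_left h1 (by positivity)).trans_eq ?_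
    field_simp
  have h3 : 0 ≤ (lam * weight η t)⁻¹ * ∑ i ∈ Finset.range t, ‖rootWeighted η ψ i‖ ^ 2 := by
    positivity
  gcongr

lemma prod_leverage_fullWeighted_le {ι : Type*} [Fintype ι] {lam η A : ℝ} (hlam : 0 < lam)
    (hη : 0 < η) (hη1 : η ≤ 1) (ψ : ℕ → EuclideanSpace ℝ ι) (hψ : ∀ i, ‖ψ i‖ ^ 2 ≤ A) (t : ℕ) :
    ∏ i ∈ Finset.range t, (1 + leverage (lam * weight η t ^ 2) (fullWeighted η ψ) i) ≤
      (1 + t * (A / lam)) ^ Fintype.card ι := by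
  have hw := weight_pos hη t
  refine (prod_one_add_leverage_le (by positivity) _ _).trans ?_
  have h1 : ∑ i ∈ Finset.range t, ‖fullWeighted η ψ i‖ ^ 2 ≤ t * (weight η t ^ 2 * A) := by
    rw [← nsmul_eq_mul]
    refine (Finset.sum_le_card_nsmul _ _ (weight η t ^ 2 * A) fun i hi => ?_).trans_eq
      (by rw [Finset.card_range])
    rw [fullWeighted, norm_smul, mul_pow, Real.norm_of_nonneg (weight_pos hη _).le]
    exact mul_le_mul (pow_le_pow_left₀ (weight_pos hη _).le
      (weight_mono hη hη1 (Finset.mem_range.1 hi)) 2) (hψ i) (sq_nonneg _) (by positivity)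
  have h2 : (lam * weight η t ^ 2)⁻¹ * ∑ i ∈ Finset.range t, ‖fullWeighted η ψ i‖ ^ 2 ≤
      t * (A / lam) := by
    refine (mul_le_mul_of_nonneg_left h1 (by positivity)).trans_eq ?_
    field_simp
  have h3 : 0 ≤ (lam * weight η t ^ 2)⁻¹ * ∑ i ∈ Finset.range t, ‖fullWeighted η ψ i‖ ^ 2 := by
    positivity
  gcongr

/-- Replacing the features by finite-dimensional ones in the doubly weighted gain. -/
lemma log_prod_leverage_fullWeighted_le {ι : Type*} [Fintype ι] {lam η A κ : ℝ} (hlam : 0 < lam)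
    (hη : 0 < η) (hη1 : η ≤ 1) (hκ : 0 ≤ κ) (ψ : ℕ → E) (ψ' : ℕ → EuclideanSpace ℝ ι)
    (hψ : ∀ i, ‖ψ' i‖ ^ 2 ≤ A) (hc : ∀ i j, |inner ℝ (ψ i) (ψ j) - inner ℝ (ψ' i) (ψ' j)| ≤ κ)
    (t : ℕ) :
    Real.log (∏ i ∈ Finset.range t,
        (1 + leverage (lam * weight η t ^ 2) (fullWeighted η ψ) i)) ≤
      Fintype.card ι * Real.log (1 + t * (A / lam)) +
        t * (2 * κ / lam * (1 + t * (A / lam))) := by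
  have hw := weight_pos hη t
  have hα : 0 < lam * weight η t ^ 2 := by positivity
  have hA : 0 ≤ A := (sq_nonneg _).trans (hψ 0)
  have hmono : ∀ i < t, weight η (i + 1) ≤ weight η t := fun i hi => weight_mono hη hη1 hi
  have hcl : ∀ i < t, ∀ j < t, |inner ℝ (fullWeighted η ψ i) (fullWeighted η ψ j) -
      inner ℝ (fullWeighted η ψ' i) (fullWeighted η ψ' j)| ≤
      κ * (weight η t * weight η t) := by
    intro i hi j hj
    simp only [fullWeighted, inner_smul_left, inner_smul_right, conj_trivial]
    rw [← mul_sub, ← mul_sub, abs_mul, abs_mul, abs_of_pos (weight_pos hη _),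
      abs_of_pos (weight_pos hη _), ← mul_assoc, mul_comm]
    have hwi := weight_pos hη (i + 1)
    have hwj := weight_pos hη (j + 1)
    exact mul_le_mul (hc i j) (mul_le_mul (hmono j hj) (hmono i hi) hwi.le hw.le) (by positivity)
      hκ
  set err := 2 * κ / lam * (1 + t * (A / lam)) with herr
  have herr0 : 0 ≤ err := by positivity
  -- The perturbation scales like w_t², as does the regularizer, so the error per leverage is free
  -- of weights.
  have hlev : ∀ i ∈ Finset.range t, leverage (lam * weight η t ^ 2) (fullWeighted η ψ) i ≤
      leverage (lam * weight η t ^ 2) (fullWeighted η ψ') i + err := by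
    intro i hi
    have hi := Finset.mem_range.1 hi
    have h1 := ridgeVar_le_of_gram_close (c := weight η t) (w := weight η t) hα hκ
      (fullWeighted η ψ) (fullWeighted η ψ') i (fullWeighted η ψ i) (fullWeighted η ψ' i)
      (hcl i hi i hi) (fun j hj => hcl i hi j (hj.trans hi))
      (fun j hj l hl => hcl j (hj.trans hi) l (hl.trans hi))
    have h2 : ‖fullWeighted η ψ' i‖ ^ 2 / (lam * weight η t ^ 2) ≤ A / lam := by
      rw [div_le_div_iff₀ hα hlam, fullWeighted, norm_smul, mul_pow,
        Real.norm_of_nonneg (weight_pos hη _).le]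
      have := mul_le_mul (pow_le_pow_left₀ (weight_pos hη _).le (hmono i hi) 2) (hψ i)
        (sq_nonneg _) (by positivity)
      nlinarith
    have h3 : (i : ℝ) ≤ t := by exact_mod_cast hi.le
    have h4 : 2 * κ * (weight η t ^ 2 + weight η t ^ 2 * i *
        (‖fullWeighted η ψ' i‖ ^ 2 / (lam * weight η t ^ 2))) ≤
        (lam * weight η t ^ 2) * err := by
      calc _ ≤ 2 * κ * (weight η t ^ 2 + weight η t ^ 2 * t * (A / lam)) := by gcongr
        _ = _ := by rw [herr]; field_simp
    have h5 := h1.trans (add_le_add_right h4 _)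
    rw [ridgeVar, ridgeVar, ← mul_add] at h5
    exact le_of_mul_le_mul_left h5 hα
  have hlog : ∀ i ∈ Finset.range t,
      Real.log (1 + leverage (lam * weight η t ^ 2) (fullWeighted η ψ) i) ≤
      Real.log (1 + leverage (lam * weight η t ^ 2) (fullWeighted η ψ') i) + err := by
    intro i hi
    have h1 := leverage_nonneg hα (fullWeighted η ψ) i
    have h2 := leverage_nonneg hα (fullWeighted η ψ') i
    rw [← sub_le_iff_le_add', ← Real.log_div (by linarith) (by linarith)]
    refine (Real.log_le_sub_one_of_pos (by positivity)).trans ?_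
    rw [sub_le_iff_le_add', div_le_iff₀ (by linarith)]
    have := hlev i hi
    nlinarith
  have hne : ∀ i ∈ Finset.range t, 1 + leverage (lam * weight η t ^ 2) (fullWeighted η ψ) i ≠ 0 :=
    fun i _ => by have := leverage_nonneg hα (fullWeighted η ψ) i; linarith
  have hne' : ∀ i ∈ Finset.range t,
      1 + leverage (lam * weight η t ^ 2) (fullWeighted η ψ') i ≠ 0 :=
    fun i _ => by have := leverage_nonneg hα (fullWeighted η ψ') i; linarith
  rw [Real.log_prod hne]
  calc _ ≤ ∑ i ∈ Finset.range t,
        (Real.log (1 + leverage (lam * weight η t ^ 2) (fullWeighted η ψ') i) + err) :=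
        Finset.sum_le_sum hlog
    _ = Real.log (∏ i ∈ Finset.range t,
        (1 + leverage (lam * weight η t ^ 2) (fullWeighted η ψ') i)) + t * err := by
        rw [Finset.sum_add_distrib, Real.log_prod hne', Finset.sum_const, Finset.card_range,
          nsmul_eq_mul]
    _ ≤ _ := by
        refine add_le_add_left ?_ _
        rw [← Real.log_pow]
        exact Real.log_le_log (zero_lt_one.trans_le (one_le_prod_leverage hα _ _))
          (prod_leverage_fullWeighted_le hlam hη hη1 ψ' hψ t)

/-- The sum of the posterior variances along the actions. -/
lemma sum_ridgeVar_le {ι : Type*} [Fintype ι] {lam η A κ : ℝ} (hlam : 0 < lam)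
    (hη : 0 < η) (hη1 : η ≤ 1) (hκ : 0 ≤ κ) (ψ : ℕ → E) (ψ' : ℕ → EuclideanSpace ℝ ι)
    (hψ : ∀ i, ‖ψ' i‖ ^ 2 ≤ A) (hc : ∀ i j, |inner ℝ (ψ i) (ψ j) - inner ℝ (ψ' i) (ψ' j)| ≤ κ)
    (T : ℕ) :
    ∑ t ∈ Finset.range T, ridgeVar (lam * weight η t) (rootWeighted η ψ) t (ψ t) ≤
      (lam + A) * (Fintype.card ι * Real.log (1 + T * (A / lam)) +
        T * (Fintype.card ι * Real.log (1 / η))) + T * (2 * κ * (1 + T * (A / lam))) := by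
  have hA : 0 ≤ A := (sq_nonneg _).trans (hψ 0)
  have hclose : ∀ t ∈ Finset.range T,
      ridgeVar (lam * weight η t) (rootWeighted η ψ) t (ψ t) ≤
      ridgeVar (lam * weight η t) (rootWeighted η ψ') t (ψ' t) +
        2 * κ * (1 + T * (A / lam)) := by
    intro t ht
    have ht := Finset.mem_range.1 ht
    have hw := weight_pos hη t
    have hα : 0 < lam * weight η t := by positivity
    have hsq : ∀ i < t, √(weight η (i + 1)) ≤ √(weight η t) := fun i hi =>
      Real.sqrt_le_sqrt (weight_mono hη hη1 hi)
    have h1 := ridgeVar_le_of_gram_close (c := 1) (w := √(weight η t)) hα hκ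
      (rootWeighted η ψ) (rootWeighted η ψ') t (ψ t) (ψ' t) (by simpa using hc t t)
      (fun i hi => by
        simp only [rootWeighted, inner_smul_right]
        rw [← mul_sub, abs_mul, abs_of_nonneg (Real.sqrt_nonneg _), mul_comm, one_mul]
        exact mul_le_mul (hc t i) (hsq i hi) (Real.sqrt_nonneg _) hκ)
      (fun i hi j hj => by
        simp only [rootWeighted, inner_smul_left, inner_smul_right, conj_trivial]
        rw [← mul_sub, ← mul_sub, abs_mul, abs_mul, abs_of_nonneg (Real.sqrt_nonneg _),
          abs_of_nonneg (Real.sqrt_nonneg _), ← mul_assoc, mul_comm]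
        exact mul_le_mul (hc i j) (mul_le_mul (hsq j hj) (hsq i hi) (Real.sqrt_nonneg _)
          (Real.sqrt_nonneg _)) (by positivity) hκ)
    refine h1.trans (add_le_add_right ?_ _)
    have h3 : (t : ℝ) ≤ T := by exact_mod_cast ht.le
    rw [Real.sq_sqrt hw.le]
    calc _ ≤ 2 * κ * (1 ^ 2 + weight η t * T * (A / (lam * weight η t))) := by
          gcongr; exact hψ t
      _ = _ := by field_simp
  -- From log(1 + r/λ) ≥ r/(λ + r) and r ≤ A.
  have hlog : ∀ t ∈ Finset.range T,
      ridgeVar (lam * weight η t) (rootWeighted η ψ') t (ψ' t) ≤ (lam + A) *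
        Real.log (1 + lam⁻¹ * ridgeVar (lam * weight η t) (rootWeighted η ψ') t (ψ' t)) := by
    intro t _
    have hα : 0 < lam * weight η t := mul_pos hlam (weight_pos hη t)
    set r := ridgeVar (lam * weight η t) (rootWeighted η ψ') t (ψ' t) with hr
    have h0 : 0 ≤ r := ridgeVar_nonneg hα _ _ _
    have h1 : r ≤ A := (ridgeVar_le_norm_sq hα _ _ _).trans (hψ t)
    have h2 := Real.one_sub_inv_le_log_of_pos (x := 1 + lam⁻¹ * r) (by positivity)
    have h3 : 1 - (1 + lam⁻¹ * r)⁻¹ = r / (lam + r) := by field_simp; ring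
    rw [h3, div_le_iff₀ (by positivity)] at h2
    have h4 : 0 ≤ Real.log (1 + lam⁻¹ * r) := Real.log_nonneg (by
      have : 0 ≤ lam⁻¹ * r := by positivity
      linarith)
    nlinarith
  have hp := prod_one_add_ridgeVar_le hlam hη hη1 ψ' T
  have hpos : ∀ t ∈ Finset.range T,
      0 < 1 + lam⁻¹ * ridgeVar (lam * weight η t) (rootWeighted η ψ') t (ψ' t) := by
    intro t _
    have := ridgeVar_nonneg (mul_pos hlam (weight_pos hη t)) (rootWeighted η ψ') t (ψ' t)
    positivity
  have hp2 := hp.trans (prod_leverage_rootWeighted_le hlam hη hη1 ψ' hψ T)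
  -- Logarithms turn the factor η^{NT} of the discounted potential into the term T N log(1/η).
  have hl := Real.log_le_log (mul_pos (pow_pos (pow_pos hη _) _) (Finset.prod_pos hpos)) hp2
  rw [Real.log_mul (pow_pos (pow_pos hη _) _).ne' (Finset.prod_pos hpos).ne', Real.log_pow,
    Real.log_pow, Real.log_pow, Real.log_prod fun t ht => (hpos t ht).ne'] at hl
  have hl2 : ∑ t ∈ Finset.range T, Real.log (1 + lam⁻¹ *
      ridgeVar (lam * weight η t) (rootWeighted η ψ') t (ψ' t)) ≤
      Fintype.card ι * Real.log (1 + T * (A / lam)) +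
        T * (Fintype.card ι * Real.log (1 / η)) := by
    rw [one_div, Real.log_inv]
    linarith
  calc _ ≤ ∑ t ∈ Finset.range T, ((lam + A) *
        Real.log (1 + lam⁻¹ * ridgeVar (lam * weight η t) (rootWeighted η ψ') t (ψ' t)) +
          2 * κ * (1 + T * (A / lam))) :=
        Finset.sum_le_sum fun t ht => (hclose t ht).trans (add_le_add_left (hlog t ht) _)
    _ = (lam + A) * ∑ t ∈ Finset.range T,
        Real.log (1 + lam⁻¹ * ridgeVar (lam * weight η t) (rootWeighted η ψ') t (ψ' t)) +
          T * (2 * κ * (1 + T * (A / lam))) := by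
        rw [Finset.sum_add_distrib, ← Finset.mul_sum, Finset.sum_const, Finset.card_range,
          nsmul_eq_mul]
    _ ≤ _ := by gcongr

end Bridge

/-! ### The drift of the reward functions. -/

section Drift

variable {E : Type*} [NormedAddCommGroup E]

/-- The price of the drift of the reward functions at the end of round `t`. -/
noncomputable def drift (lam η : ℝ) (f : ℕ → E) (t : ℕ) : ℝ :=
  (√(lam * (1 - η)))⁻¹ * ∑ j ∈ Finset.range t, ‖f (j + 2) - f (j + 1)‖ * √η ^ (t - 1 - j)

lemma drift_nonneg (lam η : ℝ) (f : ℕ → E) (t : ℕ) : 0 ≤ drift lam η f t :=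
  mul_nonneg (inv_nonneg.2 (Real.sqrt_nonneg _)) (Finset.sum_nonneg fun _ _ => by positivity)

lemma sum_weight_le {η : ℝ} (hη : 0 < η) (hη1 : η < 1) (n : ℕ) :
    ∑ i ∈ Finset.range n, weight η (i + 1) ≤ weight η n / (1 - η) := by
  have h1 : 0 < 1 - η := by linarith
  induction n with
  | zero => simp [weight, h1.le]
  | succ n ih =>
    rw [Finset.sum_range_succ]
    have : weight η n = weight η (n + 1) * η := by
      simp only [weight, pow_succ]; field_simp
    rw [this] at ih
    calc _ ≤ weight η (n + 1) * η / (1 - η) + weight η (n + 1) := by linarith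
      _ = _ := by field_simp; ring

lemma norm_sub_le_sum_drift (f : ℕ → E) {i t : ℕ} (h : i ≤ t) :
    ‖f (i + 1) - f (t + 1)‖ ≤ ∑ j ∈ Finset.Ico i t, ‖f (j + 2) - f (j + 1)‖ := by
  induction t, h using Nat.le_induction with
  | base => simp
  | succ t ht ih =>
    rw [Finset.sum_Ico_succ_top ht]
    calc ‖f (i + 1) - f (t + 1 + 1)‖ = ‖(f (i + 1) - f (t + 1)) - (f (t + 2) - f (t + 1))‖ := by
          congr 1; abel
      _ ≤ _ := (norm_sub_le _ _).trans (add_le_add_left ih _)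

/-- Exchanging the sums charges each increment with a geometric series of ratio √η, at most 1/(1 −
√η) ≤ 2/(1 − η). -/
lemma sum_drift_le {lam η BT : ℝ} (hlam : 0 < lam) (hη : 0 < η) (hη1 : η < 1) (f : ℕ → E)
    (T : ℕ) (hBT : ∑ t ∈ Finset.Ico 1 T, ‖f (t + 1) - f t‖ ≤ BT) :
    ∑ t ∈ Finset.range T, drift lam η f t ≤
      2 / √lam * ((√(1 - η))⁻¹ * (1 - η)⁻¹ * BT) := by
  have h1η : 0 < 1 - η := by linarith
  set s := √η with hs
  have hs0 : 0 ≤ s := Real.sqrt_nonneg _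
  have hs2 : s ^ 2 = η := Real.sq_sqrt hη.le
  have hs1 : s < 1 := by nlinarith
  have hgeo : ∀ n : ℕ, ∑ i ∈ Finset.range n, s ^ i ≤ 2 * (1 - η)⁻¹ := by
    intro n
    have h1 := mul_neg_geom_sum s n
    have h2 : 0 ≤ s ^ n := pow_nonneg hs0 n
    have h3 : 0 ≤ ∑ i ∈ Finset.range n, s ^ i := Finset.sum_nonneg fun i _ => pow_nonneg hs0 i
    rw [← div_eq_mul_inv, le_div_iff₀ h1η, ← hs2]
    nlinarith
  have hΔ : ∑ j ∈ Finset.range (T - 1), ‖f (j + 2) - f (j + 1)‖ ≤ BT := by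
    refine le_trans (le_of_eq ?_) hBT
    rw [Finset.sum_Ico_eq_sum_range]
    exact Finset.sum_congr rfl fun j _ => by rw [add_comm 1 j]
  simp only [drift]
  rw [← Finset.mul_sum]
  have hsw : ∑ t ∈ Finset.range T, ∑ j ∈ Finset.range t,
      ‖f (j + 2) - f (j + 1)‖ * s ^ (t - 1 - j) =
      ∑ j ∈ Finset.range (T - 1), ∑ t ∈ Finset.Ico (j + 1) T,
        ‖f (j + 2) - f (j + 1)‖ * s ^ (t - 1 - j) := by
    refine Finset.sum_comm' fun t j => ?_
    simp only [Finset.mem_range, Finset.mem_Ico]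
    omega
  rw [hsw]
  have hin : ∑ j ∈ Finset.range (T - 1), ∑ t ∈ Finset.Ico (j + 1) T,
        ‖f (j + 2) - f (j + 1)‖ * s ^ (t - 1 - j) ≤ BT * (2 * (1 - η)⁻¹) := by
    calc _ ≤ ∑ j ∈ Finset.range (T - 1), ‖f (j + 2) - f (j + 1)‖ * (2 * (1 - η)⁻¹) := by
          refine Finset.sum_le_sum fun j _ => ?_
          rw [← Finset.mul_sum]
          refine mul_le_mul_of_nonneg_left ?_ (norm_nonneg _)
          rw [Finset.sum_Ico_eq_sum_range]
          refine le_trans (le_of_eq (Finset.sum_congr rfl fun i _ => ?_)) (hgeo (T - (j + 1)))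
          congr 1
          omega
      _ ≤ _ := by
          rw [← Finset.sum_mul]
          exact mul_le_mul_of_nonneg_right hΔ (by positivity)
  calc _ ≤ (√(lam * (1 - η)))⁻¹ * (BT * (2 * (1 - η)⁻¹)) :=
        mul_le_mul_of_nonneg_left hin (by positivity)
    _ = _ := by rw [Real.sqrt_mul hlam.le]; field_simp

end Drift

/-! ### Confidence bounds and the regret of one round. -/

section Confidence

variable {E : Type*} [NormedAddCommGroup E] [InnerProductSpace ℝ E]

/-- The bias caused by the drift. -/
lemma abs_drift_term_le {lam η : ℝ} (hlam : 0 < lam) (hη : 0 < η) (hη1 : η < 1) (ψ : ℕ → E)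
    (hψ : ∀ i, ‖ψ i‖ ≤ 1) (f : ℕ → E) (t : ℕ) (x : E) :
    |inner ℝ x (ridgeInv (lam * weight η t) (rootWeighted η ψ) t
      (∑ i ∈ Finset.range t, inner ℝ (ψ i) (f (i + 1) - f (t + 1)) • fullWeighted η ψ i))| ≤
      drift lam η f t * √(ridgeVar (lam * weight η t) (rootWeighted η ψ) t x) := by
  have hw := weight_pos hη t
  have hα : 0 < lam * weight η t := mul_pos hlam hw
  have h1η : 0 < 1 - η := by linarith
  set P := ridgeInv (lam * weight η t) (rootWeighted η ψ) t with hP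
  set c : ℕ → ℝ := fun i => inner ℝ (ψ i) (P x) with hc
  set Δ : ℕ → ℝ := fun j => ‖f (j + 2) - f (j + 1)‖ with hΔ
  set σ := √(ridgeVar (lam * weight η t) (rootWeighted η ψ) t x) with hσ
  have hcs : ∑ i ∈ Finset.range t, weight η (i + 1) * c i ^ 2 ≤ inner ℝ x (P x) := by
    rw [hP, inner_ridgeInv_self hα, ← hP]
    have : ∑ i ∈ Finset.range t, weight η (i + 1) * c i ^ 2 =
        ∑ i ∈ Finset.range t, inner ℝ (rootWeighted η ψ i) (P x) ^ 2 := by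
      refine Finset.sum_congr rfl fun i _ => ?_
      rw [rootWeighted, inner_smul_left, mul_pow, conj_trivial,
        Real.sq_sqrt (weight_pos hη _).le]
    rw [this]
    have : 0 ≤ lam * weight η t * ‖P x‖ ^ 2 := by positivity
    linarith
  -- Cauchy–Schwarz over the first j+1 rounds, whose total weight is at most w_{j+1}/(1−η) = w_t
  -- η^{t−1−j}/(1−η); this is the source of the damping.
  have hprefix : ∀ j < t, ∑ i ∈ Finset.range (j + 1), weight η (i + 1) * |c i| ≤
      (√(lam * (1 - η)))⁻¹ * √η ^ (t - 1 - j) * σ := by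
    intro j hj
    have h1 : (∑ i ∈ Finset.range (j + 1), weight η (i + 1) * |c i|) ^ 2 ≤
        (∑ i ∈ Finset.range (j + 1), weight η (i + 1)) *
          ∑ i ∈ Finset.range (j + 1), weight η (i + 1) * c i ^ 2 := by
      refine Finset.sum_sq_le_sum_mul_sum_of_sq_le_mul _ (fun i _ => (weight_pos hη _).le)
        (fun i _ => mul_nonneg (weight_pos hη _).le (sq_nonneg _)) fun i _ => ?_
      rw [mul_pow, sq_abs]; exact le_of_eq (by ring)
    have h2 : ∑ i ∈ Finset.range (j + 1), weight η (i + 1) * c i ^ 2 ≤ inner ℝ x (P x) :=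
      (Finset.sum_le_sum_of_subset_of_nonneg (Finset.range_mono hj) fun i _ _ =>
        mul_nonneg (weight_pos hη _).le (sq_nonneg _)).trans hcs
    have h3 : weight η (j + 1) = weight η t * η ^ (t - 1 - j) := by
      have : η ^ t = η ^ (j + 1) * η ^ (t - 1 - j) := by rw [← pow_add]; congr 1; omega
      simp only [weight, this]; field_simp
    have hx0 : 0 ≤ inner ℝ x (P x) := inner_ridgeInv_self_nonneg hα _ _ _
    refine abs_le_of_sq_le_sq' ?_ (by positivity) |>.2
    have hσ2 : σ ^ 2 = lam * weight η t * inner ℝ x (P x) :=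
      Real.sq_sqrt (ridgeVar_nonneg hα _ _ _)
    calc _ ≤ (weight η (j + 1) / (1 - η)) * inner ℝ x (P x) :=
          h1.trans (mul_le_mul (sum_weight_le hη hη1 _) h2 (Finset.sum_nonneg fun i _ =>
            mul_nonneg (weight_pos hη _).le (sq_nonneg _))
            (div_nonneg (weight_pos hη _).le h1η.le))
      _ = _ := by
        rw [mul_pow, mul_pow, inv_pow, Real.sq_sqrt (by positivity), ← pow_mul, mul_comm _ 2,
          pow_mul, Real.sq_sqrt hη.le, hσ2, h3]
        field_simp
  have hinner : inner ℝ x (P (∑ i ∈ Finset.range t,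
      inner ℝ (ψ i) (f (i + 1) - f (t + 1)) • fullWeighted η ψ i)) =
      ∑ i ∈ Finset.range t, inner ℝ (ψ i) (f (i + 1) - f (t + 1)) * (weight η (i + 1) * c i) := by
    rw [map_sum, inner_sum]
    refine Finset.sum_congr rfl fun i _ => ?_
    rw [map_smul, fullWeighted, map_smul, inner_smul_right, inner_smul_right,
      ← inner_ridgeInv_comm hα, real_inner_comm (ψ i)]
  rw [hinner]
  calc _ ≤ ∑ i ∈ Finset.range t, |inner ℝ (ψ i) (f (i + 1) - f (t + 1)) *
        (weight η (i + 1) * c i)| := Finset.abs_sum_le_sum_abs _ _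
    _ ≤ ∑ i ∈ Finset.range t, ∑ j ∈ Finset.Ico i t, Δ j * (weight η (i + 1) * |c i|) := by
        refine Finset.sum_le_sum fun i hi => ?_
        rw [← Finset.sum_mul, abs_mul, abs_mul, abs_of_pos (weight_pos hη _)]
        have hwi := weight_pos hη (i + 1)
        refine mul_le_mul_of_nonneg_right ?_ (by positivity)
        refine (abs_real_inner_le_norm _ _).trans ?_
        refine (mul_le_mul_of_nonneg_right (hψ i) (norm_nonneg _)).trans ?_
        rw [one_mul]
        exact norm_sub_le_sum_drift f (Finset.mem_range.1 hi).le
    -- Abel summation: the increment from f_{j+1} to f_{j+2} affects exactly the indices i ≤ j.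
    _ = ∑ j ∈ Finset.range t, ∑ i ∈ Finset.range (j + 1), Δ j * (weight η (i + 1) * |c i|) := by
        refine Finset.sum_comm' fun i j => ?_
        simp only [Finset.mem_range, Finset.mem_Ico]
        omega
    _ ≤ ∑ j ∈ Finset.range t, Δ j * ((√(lam * (1 - η)))⁻¹ * √η ^ (t - 1 - j) * σ) := by
        refine Finset.sum_le_sum fun j hj => ?_
        rw [← Finset.mul_sum]
        exact mul_le_mul_of_nonneg_left (hprefix j (Finset.mem_range.1 hj)) (norm_nonneg _)
    _ = _ := by
        rw [drift, Finset.mul_sum, Finset.sum_mul]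
        exact Finset.sum_congr rfl fun j _ => by ring

/-- The noise term is controlled by its self-normalized size. -/
lemma abs_noise_term_le {lam η ρ : ℝ} (hlam : 0 < lam) (hη : 0 < η) (hη1 : η < 1) (hρ : 0 ≤ ρ)
    (ψ : ℕ → E) (t : ℕ) (S x : E)
    (hS : inner ℝ S (ridgeInv (lam * weight η t ^ 2) (fullWeighted η ψ) t S) ≤ ρ ^ 2) :
    |inner ℝ x (ridgeInv (lam * weight η t) (rootWeighted η ψ) t S)| ≤
      1 / √lam * ρ * √(ridgeVar (lam * weight η t) (rootWeighted η ψ) t x) := by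
  have hw := weight_pos hη t
  have hα : 0 < lam * weight η t := mul_pos hlam hw
  have hα2 : 0 < lam * weight η t ^ 2 := by positivity
  set P := ridgeInv (lam * weight η t) (rootWeighted η ψ) t with hP
  have h1 := inner_sq_le_ridge hα2 (fullWeighted η ψ) t (P x) S
  -- The doubly weighted operator is at most w_t times the singly weighted one, because w_i² ≤ w_t
  -- w_i.
  have h2 : inner ℝ (P x) (ridgeOp (lam * weight η t ^ 2) (fullWeighted η ψ) t (P x)) ≤
      weight η t * inner ℝ x (P x) := by
    rw [inner_ridgeOp_self, hP, inner_ridgeInv_self hα, ← hP, mul_add, Finset.mul_sum]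
    refine add_le_add (by rw [sq (weight η t)]; exact le_of_eq (by ring))
      (Finset.sum_le_sum fun i hi => ?_)
    rw [fullWeighted, rootWeighted, inner_smul_left, inner_smul_left, mul_pow, mul_pow,
      conj_trivial, conj_trivial, Real.sq_sqrt (weight_pos hη _).le, sq (weight η (i + 1)),
      mul_assoc]
    have hwi := weight_pos hη (i + 1)
    exact mul_le_mul_of_nonneg_right (weight_mono hη hη1.le (Finset.mem_range.1 hi))
      (by positivity)
  have hx0 : 0 ≤ inner ℝ x (P x) := inner_ridgeInv_self_nonneg hα _ _ _
  refine Real.abs_le_sqrt (y := 1 / lam * ρ ^ 2 *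
    ridgeVar (lam * weight η t) (rootWeighted η ψ) t x) ?_ |>.trans_eq ?_
  · rw [hP, ← inner_ridgeInv_comm hα, ← hP]
    refine h1.trans ((mul_le_mul h2 hS (inner_ridgeInv_self_nonneg hα2 _ _ _)
      (by positivity)).trans_eq ?_)
    rw [ridgeVar, ← hP]
    field_simp
  · rw [Real.sqrt_mul (by positivity), Real.sqrt_mul (by positivity), Real.sqrt_sq hρ,
      Real.sqrt_div zero_le_one, Real.sqrt_one]

/-- Cauchy–Schwarz for the inverse operator, together with α⟨g, P g⟩ ≤ ‖g‖². -/
lemma abs_regularization_term_le {α : ℝ} (hα : 0 < α) (v : ℕ → E) (t : ℕ) (x g : E) {B : ℝ}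
    (hB : 0 ≤ B) (hg : ‖g‖ ≤ B) :
    |inner ℝ x (ridgeInv α v t (α • g))| ≤ B * √(ridgeVar α v t x) := by
  have h1 := inner_sq_le_ridge hα v t (ridgeInv α v t x) g
  rw [ridgeOp_ridgeInv hα, inner_ridgeInv_comm hα, inner_ridgeInv_comm hα] at h1
  have h2 := ridgeVar_le_norm_sq hα v t g
  have h3 : ‖g‖ ^ 2 ≤ B ^ 2 := pow_le_pow_left₀ (norm_nonneg _) hg 2
  have h4 := inner_ridgeInv_self_nonneg hα v t x
  refine (Real.abs_le_sqrt (y := B ^ 2 * ridgeVar α v t x) ?_).trans_eq ?_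
  · rw [map_smul, inner_smul_right, mul_pow]
    calc α ^ 2 * inner ℝ x (ridgeInv α v t g) ^ 2 ≤ α ^ 2 *
          (inner ℝ x (ridgeInv α v t x) * inner ℝ g (ridgeInv α v t g)) := by gcongr
      _ = ridgeVar α v t g * ridgeVar α v t x := by simp only [ridgeVar]; ring
      _ ≤ _ := mul_le_mul_of_nonneg_right (h2.trans h3) (ridgeVar_nonneg hα _ _ _)
  · rw [Real.sqrt_mul (sq_nonneg _), Real.sqrt_sq hB]

/-- The deviation of the weighted posterior mean from the current reward function. -/
lemma abs_mean_sub_le {lam η ρ B : ℝ} (hlam : 0 < lam) (hη : 0 < η) (hη1 : η < 1) (hρ : 0 ≤ ρ)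
    (hB : 0 ≤ B) (ψ : ℕ → E) (hψ : ∀ i, ‖ψ i‖ ≤ 1) (f : ℕ → E) (e : ℕ → ℝ) (t : ℕ)
    (hf : ‖f (t + 1)‖ ≤ B)
    (hS : inner ℝ (∑ i ∈ Finset.range t, e i • fullWeighted η ψ i)
      (ridgeInv (lam * weight η t ^ 2) (fullWeighted η ψ) t
        (∑ i ∈ Finset.range t, e i • fullWeighted η ψ i)) ≤ ρ ^ 2) (x : E) :
    |inner ℝ x (ridgeInv (lam * weight η t) (rootWeighted η ψ) t
        (∑ i ∈ Finset.range t, (inner ℝ (ψ i) (f (i + 1)) + e i) • fullWeighted η ψ i)) -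
      inner ℝ x (f (t + 1))| ≤ (B + 1 / √lam * ρ + drift lam η f t) *
        √(ridgeVar (lam * weight η t) (rootWeighted η ψ) t x) := by
  have hw := weight_pos hη t
  have hα : 0 < lam * weight η t := mul_pos hlam hw
  have h1 := abs_drift_term_le hlam hη hη1 ψ hψ f t x
  have h2 := abs_noise_term_le hlam hη hη1 hρ ψ t _ x hS
  have h3 := abs_regularization_term_le hα (rootWeighted η ψ) t x (f (t + 1)) hB hf
  set S := ∑ i ∈ Finset.range t, e i • fullWeighted η ψ i with hSdef
  set D := ∑ i ∈ Finset.range t, inner ℝ (ψ i) (f (i + 1) - f (t + 1)) • fullWeighted η ψ i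
    with hD
  -- Data generated by the constant f_{t+1} would be V f_{t+1} − αf_{t+1} with V the ridge operator;
  -- its inverse returns f_{t+1} and the regularization bias. What remains is drift and noise.
  have hsum : ∑ i ∈ Finset.range t, (inner ℝ (ψ i) (f (i + 1)) + e i) • fullWeighted η ψ i =
      D + S + (ridgeOp (lam * weight η t) (rootWeighted η ψ) t (f (t + 1)) -
        (lam * weight η t) • f (t + 1)) := by
    rw [ridgeOp, add_sub_cancel_left, hD, hSdef, ← Finset.sum_add_distrib,
      ← Finset.sum_add_distrib]
    refine Finset.sum_congr rfl fun i _ => ?_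
    rw [fullWeighted, rootWeighted, inner_smul_left, conj_trivial, inner_sub_right, smul_smul,
      smul_smul, smul_smul, smul_smul, mul_right_comm, Real.mul_self_sqrt (weight_pos hη _).le,
      ← add_smul, ← add_smul]
    congr 1
    ring
  rw [hsum, map_add, map_add, map_sub, ridgeInv_ridgeOp hα, inner_add_right, inner_add_right,
    inner_sub_right]
  rw [abs_le] at *
  constructor <;> linarith

/-- The regret of one round for an action that maximizes the upper confidence bound. -/
lemma round_regret_le {X : Type*} {k : X → X → ℝ} {φ : X → E}
    (hk : ∀ z z', inner ℝ (φ z) (φ z') = k z z') (hk1 : ∀ z, k z z ≤ 1) {lam η ρ B : ℝ}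
    (hlam : 0 < lam) (hη : 0 < η) (hη1 : η < 1) (hρ : 0 ≤ ρ) (hB : 0 ≤ B) (f : ℕ → E)
    (xs : ℕ → X) (e : ℕ → ℝ) (t : ℕ) (hf : ‖f (t + 1)‖ ≤ B)
    (hS : inner ℝ (∑ i ∈ Finset.range t, e i • fullWeighted η (fun i => φ (xs i)) i)
      (ridgeInv (lam * weight η t ^ 2) (fullWeighted η fun i => φ (xs i)) t
        (∑ i ∈ Finset.range t, e i • fullWeighted η (fun i => φ (xs i)) i)) ≤ ρ ^ 2)
    (hmax : ∀ z, posteriorMean k lam η (fun i : Fin t => xs i)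
        (fun i : Fin t => inner ℝ (φ (xs i)) (f (i + 1)) + e i) z +
          (B + 1 / √lam * ρ) * √(posteriorVar k lam η (fun i : Fin t => xs i) z) ≤
      posteriorMean k lam η (fun i : Fin t => xs i)
        (fun i : Fin t => inner ℝ (φ (xs i)) (f (i + 1)) + e i) (xs t) +
          (B + 1 / √lam * ρ) * √(posteriorVar k lam η (fun i : Fin t => xs i) (xs t))) (z : X) :
    inner ℝ (φ z) (f (t + 1)) - inner ℝ (φ (xs t)) (f (t + 1)) ≤
      2 * (B + 1 / √lam * ρ) *
        √(ridgeVar (lam * weight η t) (rootWeighted η fun i => φ (xs i)) t (φ (xs t))) +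
      2 * drift lam η f t := by
  have hα : 0 < lam * weight η t := mul_pos hlam (weight_pos hη t)
  have hφ : ∀ z, ‖φ z‖ ^ 2 ≤ 1 := fun z => by
    rw [← real_inner_self_eq_norm_sq, hk]; exact hk1 z
  have hφ1 : ∀ z, ‖φ z‖ ≤ 1 := fun z => by
    have := hφ z
    nlinarith [norm_nonneg (φ z)]
  have h1 := abs_mean_sub_le hlam hη hη1 hρ hB (fun i => φ (xs i)) (fun i => hφ1 _) f e t hf hS
  have hz := abs_le.1 (h1 (φ z))
  have hx := abs_le.1 (h1 (φ (xs t)))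
  have hm := hmax z
  rw [posteriorMean_eq hk hlam hη t xs (fun i => inner ℝ (φ (xs i)) (f (i + 1)) + e i),
    posteriorMean_eq hk hlam hη t xs (fun i => inner ℝ (φ (xs i)) (f (i + 1)) + e i),
    posteriorVar_eq hk hlam hη, posteriorVar_eq hk hlam hη] at hm
  -- The width covers only B and the noise, so optimism does not absorb the drift. It is paid at z
  -- and at the action, where k ≤ 1 bounds the factor σ by 1.
  have hs : ∀ z, √(ridgeVar (lam * weight η t) (rootWeighted η fun i => φ (xs i)) t (φ z)) ≤ 1 :=
    fun z => Real.sqrt_le_one.2 ((ridgeVar_le_norm_sq hα _ _ _).trans (hφ z))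
  have hd := drift_nonneg lam η f t
  have h2 := mul_le_mul_of_nonneg_left (hs z) hd
  have h3 := mul_le_mul_of_nonneg_left (hs (xs t)) hd
  linarith [hz.1, hx.2]

end Confidence

/-! ### Upper and lower bounds for the maximum information gains. -/

section Gains

variable {E : Type*} [NormedAddCommGroup E] [InnerProductSpace ℝ E] {X ι : Type*} [Fintype ι]
  [Nonempty X]

lemma exists_extend {t : ℕ} (a : Fin t → X) : ∃ xs : ℕ → X, a = fun i : Fin t => xs i := by
  classical
  exact ⟨fun i => if h : i < t then a ⟨i, h⟩ else Classical.arbitrary X, by ext i; simp⟩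

variable {k : X → X → ℝ} {φ : X → E} {φ' : X → ι → ℝ} {lam η κ A : ℝ}

lemma inner_toLp (u v : ι → ℝ) :
    inner ℝ (WithLp.toLp 2 u : EuclideanSpace ℝ ι) (WithLp.toLp 2 v) = u ⬝ᵥ v := by
  simp [PiLp.inner_apply, dotProduct, mul_comm]

lemma half_log_det_double_le (hk : ∀ z z', inner ℝ (φ z) (φ z') = k z z') (hlam : 0 < lam)
    (hη : 0 < η) (hη1 : η ≤ 1) (hc : ∀ z z', |k z z' - φ' z ⬝ᵥ φ' z'| ≤ κ)
    (hA : ∀ z, φ' z ⬝ᵥ φ' z ≤ A) {t : ℕ} (a : Fin t → X) :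
    1 / 2 * Real.log ((1 : Matrix (Fin t) (Fin t) ℝ) +
      (lam * weight η t ^ 2)⁻¹ • Matrix.of fun i j : Fin t =>
        weight η ((i : ℕ) + 1) * weight η ((j : ℕ) + 1) * k (a i) (a j)).det ≤
      1 / 2 * (Fintype.card ι * Real.log (1 + t * (A / lam)) +
        t * (2 * κ / lam * (1 + t * (A / lam)))) := by
  obtain ⟨xs, rfl⟩ := exists_extend a
  rw [det_doubleGain_eq hk hlam hη]
  refine mul_le_mul_of_nonneg_left (log_prod_leverage_fullWeighted_le hlam hη hη1
    ((abs_nonneg _).trans (hc (xs 0) (xs 0))) _ (fun i => WithLp.toLp 2 (φ' (xs i)))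
    (fun i => ?_) (fun i j => ?_) t) (by norm_num)
  · rw [← real_inner_self_eq_norm_sq, inner_toLp]; exact hA _
  · rw [inner_toLp, hk]; exact hc _ _

lemma half_log_det_double_nonneg (hk : ∀ z z', inner ℝ (φ z) (φ z') = k z z') (hlam : 0 < lam)
    (hη : 0 < η) {t : ℕ} (a : Fin t → X) :
    0 ≤ 1 / 2 * Real.log ((1 : Matrix (Fin t) (Fin t) ℝ) +
      (lam * weight η t ^ 2)⁻¹ • Matrix.of fun i j : Fin t =>
        weight η ((i : ℕ) + 1) * weight η ((j : ℕ) + 1) * k (a i) (a j)).det := by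
  obtain ⟨xs, rfl⟩ := exists_extend a
  rw [det_doubleGain_eq hk hlam hη]
  have hw := weight_pos hη t
  exact mul_nonneg (by norm_num) (Real.log_nonneg (one_le_prod_leverage (by positivity) _ _))

lemma doubleGain_nonneg (hk : ∀ z z', inner ℝ (φ z) (φ z') = k z z') (hlam : 0 < lam)
    (hη : 0 < η) (t : ℕ) : 0 ≤ doubleGain k lam η t :=
  Real.iSup_nonneg fun a => half_log_det_double_nonneg hk hlam hη a

lemma doubleGain_le (hk : ∀ z z', inner ℝ (φ z) (φ z') = k z z') (hlam : 0 < lam)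
    (hη : 0 < η) (hη1 : η ≤ 1) (hc : ∀ z z', |k z z' - φ' z ⬝ᵥ φ' z'| ≤ κ)
    (hA : ∀ z, φ' z ⬝ᵥ φ' z ≤ A) (t : ℕ) :
    doubleGain k lam η t ≤ 1 / 2 * (Fintype.card ι * Real.log (1 + t * (A / lam)) +
        t * (2 * κ / lam * (1 + t * (A / lam)))) :=
  ciSup_le fun a => half_log_det_double_le hk hlam hη hη1 hc hA a

/-- A real supremum dominates its terms only if they are bounded; `half_log_det_double_le` is
uniform in the tuple. -/
lemma le_doubleGain (hk : ∀ z z', inner ℝ (φ z) (φ z') = k z z') (hlam : 0 < lam)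
    (hη : 0 < η) (hη1 : η ≤ 1) (hc : ∀ z z', |k z z' - φ' z ⬝ᵥ φ' z'| ≤ κ)
    (hA : ∀ z, φ' z ⬝ᵥ φ' z ≤ A) {t : ℕ} (a : Fin t → X) :
    1 / 2 * Real.log ((1 : Matrix (Fin t) (Fin t) ℝ) +
      (lam * weight η t ^ 2)⁻¹ • Matrix.of fun i j : Fin t =>
        weight η ((i : ℕ) + 1) * weight η ((j : ℕ) + 1) * k (a i) (a j)).det ≤
      doubleGain k lam η t := by
  refine le_ciSup (f := fun a : Fin t → X => 1 / 2 * Real.log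
    ((1 : Matrix (Fin t) (Fin t) ℝ) + (lam * weight η t ^ 2)⁻¹ • Matrix.of fun i j : Fin t =>
        weight η ((i : ℕ) + 1) * weight η ((j : ℕ) + 1) * k (a i) (a j)).det)
    ⟨1 / 2 * (Fintype.card ι * Real.log (1 + t * (A / lam)) +
      t * (2 * κ / lam * (1 + t * (A / lam)))), ?_⟩ a
  rintro _ ⟨a, rfl⟩
  exact half_log_det_double_le hk hlam hη hη1 hc hA a

lemma featureGain_le (hlam : 0 < lam) (hη : 0 < η) (hη1 : η ≤ 1)
    (hA : ∀ z, φ' z ⬝ᵥ φ' z ≤ A) (t : ℕ) :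
    featureGain φ' lam η t ≤ 1 / 2 * (Fintype.card ι * Real.log (1 + t * (A / lam))) := by
  refine ciSup_le fun a => ?_
  obtain ⟨xs, rfl⟩ := exists_extend a
  rw [det_featureGain_eq (φ := fun z => (WithLp.toLp 2 (φ' z) : EuclideanSpace ℝ ι))
    (fun z z' => inner_toLp _ _) hlam hη, ← Real.log_pow]
  have hw := weight_pos hη t
  refine mul_le_mul_of_nonneg_left (Real.log_le_log (zero_lt_one.trans_le
    (one_le_prod_leverage (by positivity) _ _)) (prod_leverage_rootWeighted_le hlam hη hη1 _
      (fun i => ?_) t)) (by norm_num)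
  rw [← real_inner_self_eq_norm_sq, inner_toLp]
  exact hA _

/-- A constant tuple of actions bounds the doubly weighted gain from below. -/
lemma half_log_le_doubleGain (hk : ∀ z z', inner ℝ (φ z) (φ z') = k z z') (hlam : 0 < lam)
    (hη : 0 < η) (hη1 : η ≤ 1) (hc : ∀ z z', |k z z' - φ' z ⬝ᵥ φ' z'| ≤ κ)
    (hA : ∀ z, φ' z ⬝ᵥ φ' z ≤ A) {t : ℕ} (ht : 1 ≤ t) (z : X) :
    1 / 2 * Real.log (1 + k z z / lam) ≤ doubleGain k lam η t := by
  refine le_trans ?_ (le_doubleGain hk hlam hη hη1 hc hA fun _ : Fin t => z)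
  have hw := weight_pos hη t
  have hz : 0 ≤ k z z := by rw [← hk]; exact real_inner_self_nonneg
  -- With equal actions the matrix has rank one, so the determinant is 1 plus a sum of nonnegative
  -- terms; the last round alone has weight w_t and contributes k z z / λ.
  have hM : ((lam * weight η t ^ 2)⁻¹ • Matrix.of fun i j : Fin t =>
      weight η ((i : ℕ) + 1) * weight η ((j : ℕ) + 1) * k z z) =
      Matrix.replicateCol Unit (fun i : Fin t => weight η ((i : ℕ) + 1)) *
        Matrix.replicateRow Unit (fun i : Fin t =>
          (lam * weight η t ^ 2)⁻¹ * k z z * weight η ((i : ℕ) + 1)) := by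
    ext i j
    simp [Matrix.mul_apply]
    ring
  rw [hM, Matrix.det_one_add_replicateCol_mul_replicateRow]
  refine mul_le_mul_of_nonneg_left (Real.log_le_log (by positivity) ?_) (by norm_num)
  refine add_le_add_right ?_ 1
  obtain ⟨s, rfl⟩ : ∃ s, t = s + 1 := ⟨t - 1, by omega⟩
  refine le_trans (le_of_eq ?_) (Finset.single_le_sum (fun i _ => ?_)
    (Finset.mem_univ (Fin.last s)))
  · simp only [Fin.val_last]
    field_simp
  · have := weight_pos hη ((i : ℕ) + 1)
    positivity

end Gains

lemma sum_sqrt_le (r : ℕ → ℝ) (hr : ∀ i, 0 ≤ r i) {V : ℝ} (T : ℕ)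
    (hV : ∑ i ∈ Finset.range T, r i ≤ V) :
    ∑ i ∈ Finset.range T, √(r i) ≤ √(T * V) := by
  refine Real.le_sqrt_of_sq_le ?_
  have := sq_sum_le_card_mul_sum_sq (s := Finset.range T) (f := fun i => √(r i))
  simp only [Real.sq_sqrt (hr _), Finset.card_range] at this
  exact this.trans (mul_le_mul_of_nonneg_left hV (Nat.cast_nonneg _))

/-! ### Kernel sections as features. -/

section Reproducing

variable {X : Type*} {H : Type*} [NormedAddCommGroup H] [InnerProductSpace ℝ H]
  [CompleteSpace H] [RKHS ℝ H X ℝ] {k : X → X → ℝ}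

lemma inner_kerFun_one (z : X) (g : H) : inner ℝ (RKHS.kerFun H z (1 : ℝ)) g = g z := by
  rw [RKHS.kerFun_inner]; simp

lemma inner_kerFun_kerFun (hH : ∀ z z' : X, RKHS.kernel H z z' (1 : ℝ) = k z z') (z z' : X) :
    inner ℝ (RKHS.kerFun H z (1 : ℝ)) (RKHS.kerFun H z' (1 : ℝ)) = k z z' := by
  rw [inner_kerFun_one, RKHS.kerFun_apply, hH]

/-- The squared distance of two kernel sections is a combination of kernel values, so z ↦ k(z,·) is
norm continuous. It provides measurability of the reward functions. -/
lemma continuous_rkhs_apply [TopologicalSpace X] (hk : Continuous fun z : X × X => k z.1 z.2)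
    (hH : ∀ z z' : X, RKHS.kernel H z z' (1 : ℝ) = k z z') (g : H) : Continuous g := by
  have hφ : Continuous fun z : X => RKHS.kerFun H z (1 : ℝ) := by
    refine continuous_iff_continuousAt.2 fun z₀ => tendsto_iff_norm_sub_tendsto_zero.2 ?_
    have h1 : ∀ z : X, ‖RKHS.kerFun H z (1 : ℝ) - RKHS.kerFun H z₀ (1 : ℝ)‖ =
        √(k z z - 2 * k z z₀ + k z₀ z₀) := by
      intro z
      rw [← inner_kerFun_kerFun hH, ← inner_kerFun_kerFun hH, ← inner_kerFun_kerFun hH,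
        real_inner_self_eq_norm_sq, real_inner_self_eq_norm_sq, ← norm_sub_sq_real,
        Real.sqrt_sq (norm_nonneg _)]
    simp only [h1]
    have h2 : Continuous fun z : X => √(k z z - 2 * k z z₀ + k z₀ z₀) := by
      have e1 : Continuous fun z : X => k z z := hk.comp (continuous_id.prodMk continuous_id)
      have e2 : Continuous fun z : X => k z z₀ := hk.comp (continuous_id.prodMk continuous_const)
      fun_prop
    have := h2.tendsto z₀
    simpa [show k z₀ z₀ - 2 * k z₀ z₀ + k z₀ z₀ = 0 by ring] using this
  have : (g : X → ℝ) = fun z => inner ℝ (RKHS.kerFun H z (1 : ℝ)) g := by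
    ext z; rw [inner_kerFun_one]
  rw [this]
  exact hφ.inner continuous_const

end Reproducing

/-! ### Measurability with respect to the history. -/

section History

variable {X : Type*} [MeasurableSpace X]

lemma history_le {Ω : Type*} [mΩ : MeasurableSpace Ω] {f : ℕ → X → ℝ} {x : ℕ → Ω → X}
    {ε : ℕ → Ω → ℝ} {T : ℕ} (hf : ∀ t, Measurable (f t))
    (hx : ∀ t ∈ Set.Icc 1 T, Measurable (x t)) (hε : ∀ t ∈ Set.Icc 1 T, Measurable (ε t))
    {n : ℕ} (hn : n < T) : history f x ε n ≤ mΩ := by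
  refine sup_le (iSup₂_le fun s hs => sup_le ?_ ?_) ?_
  · exact (hx s ⟨hs.1, hs.2.trans hn.le⟩).comap_le
  · have hs' : s ∈ Set.Icc 1 T := ⟨hs.1, hs.2.trans hn.le⟩
    exact (((hf s).comp (hx s hs')).add (hε s hs')).comap_le
  · exact (hx (n + 1) ⟨by omega, hn⟩).comap_le

lemma measurable_action_history {Ω : Type*} {f : ℕ → X → ℝ} {x : ℕ → Ω → X} {ε : ℕ → Ω → ℝ}
    {n i : ℕ} (hi : i ≤ n) : Measurable[history f x ε n] (x (i + 1)) := by
  rw [measurable_iff_comap_le]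
  rcases hi.lt_or_eq with h | rfl
  · exact (le_sup_left.trans (le_iSup₂ (f := fun s (_ : s ∈ Set.Icc 1 n) =>
      MeasurableSpace.comap (x s) inferInstance ⊔
        MeasurableSpace.comap (observation f x ε s) inferInstance) (i + 1) ⟨by omega, h⟩)).trans
      le_sup_left
  · exact le_sup_right

/-- The history contains observations rather than noise; past noise is recovered as y − f(x). -/
lemma measurable_noise_history {Ω : Type*} {f : ℕ → X → ℝ} {x : ℕ → Ω → X} {ε : ℕ → Ω → ℝ}
    (hf : ∀ t, Measurable (f t)) {n i : ℕ} (hi : i < n) :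
    Measurable[history f x ε n] (ε (i + 1)) := by
  have h1 : Measurable[history f x ε n] (observation f x ε (i + 1)) := by
    rw [measurable_iff_comap_le]
    exact (le_sup_right.trans (le_iSup₂ (f := fun s (_ : s ∈ Set.Icc 1 n) =>
      MeasurableSpace.comap (x s) inferInstance ⊔
        MeasurableSpace.comap (observation f x ε s) inferInstance) (i + 1) ⟨by omega, hi⟩)).trans
      le_sup_left
  have h2 : Measurable[history f x ε n] fun ω => f (i + 1) (x (i + 1) ω) :=
    (hf (i + 1)).comp (measurable_action_history hi.le)
  have h3 : ε (i + 1) = fun ω => observation f x ε (i + 1) ω - f (i + 1) (x (i + 1) ω) := by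
    ext ω; simp [observation]
  rw [h3]
  exact h1.sub h2

end History

/-! ### The regret bound on the event where all confidence bounds hold. -/

section HighProbability

variable {X : Type*} [TopologicalSpace X] [MeasurableSpace X] [BorelSpace X]
  [SecondCountableTopology X] {H : Type*} [NormedAddCommGroup H] [InnerProductSpace ℝ H]
  [CompleteSpace H] [RKHS ℝ H X ℝ] {k : X → X → ℝ}

/-- The dynamic regret of WGP-UCB with high probability, in terms of the confidence widths, the sum
of the posterior variances and the drift. -/
theorem le_measure_dynamicRegret_le {ι : Type*} [Fintype ι] {φ' : X → ι → ℝ} {κ A : ℝ}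
    (hk : Continuous fun z : X × X => k z.1 z.2) (hk1 : ∀ z, k z z ≤ 1)
    (hH : ∀ z z' : X, RKHS.kernel H z z' (1 : ℝ) = k z z')
    (hc : ∀ z z', |k z z' - φ' z ⬝ᵥ φ' z'| ≤ κ) (hA : ∀ z, φ' z ⬝ᵥ φ' z ≤ A)
    {lam R B η δ BT β : ℝ} (hlam : 0 < lam) (hR : 0 ≤ R) (hB : 0 ≤ B) (hη : 0 < η) (hη1 : η < 1)
    (hδ : 0 < δ) (hδ1 : δ < 1) {Ω : Type*} [MeasurableSpace Ω] {P : Measure Ω}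
    [IsProbabilityMeasure P] {T : ℕ} (hT : 1 ≤ T) {f : ℕ → H} {x : ℕ → Ω → X} {ε : ℕ → Ω → ℝ}
    (hf : ∀ t ∈ Set.Icc 1 T, ‖f t‖ ≤ B)
    (hBT : ∑ t ∈ Finset.Ico 1 T, ‖f (t + 1) - f t‖ ≤ BT)
    (hrun : IsRun P k lam R B (δ / T) η T (fun t => ⇑(f t)) x ε)
    (hβ : ∀ t < T, width k lam R B (δ / T) η t ≤ β) :
    ENNReal.ofReal (1 - δ) ≤ P {ω | dynamicRegret (fun t => ⇑(f t)) x T ω ≤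
      2 * β * √(T * ((lam + A) * (Fintype.card ι * Real.log (1 + T * (A / lam)) +
        T * (Fintype.card ι * Real.log (1 / η))) + T * (2 * κ * (1 + T * (A / lam))))) +
      2 * (2 / √lam * ((√(1 - η))⁻¹ * (1 - η)⁻¹ * BT))} := by
  have hT0 : (0 : ℝ) < T := by exact_mod_cast hT
  have hδT : 0 < δ / T := by positivity
  have hδT1 : δ / T ≤ 1 := by
    rw [div_le_one hT0]
    have : (1 : ℝ) ≤ T := by exact_mod_cast hT
    linarith
  set φ : X → H := fun z => RKHS.kerFun H z (1 : ℝ) with hφ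
  have hkφ : ∀ z z', inner ℝ (φ z) (φ z') = k z z' := inner_kerFun_kerFun hH
  have hev : ∀ (z : X) (g : H), inner ℝ (φ z) g = g z := inner_kerFun_one
  have hfm : ∀ t, Measurable (f t) := fun t => (continuous_rkhs_apply hk hH (f t)).measurable
  have hkm : Measurable fun z : X × X => k z.1 z.2 := hk.measurable
  have hΩ : Nonempty Ω := nonempty_of_isProbabilityMeasure P
  have hX : Nonempty X := ⟨x 0 (Classical.arbitrary Ω)⟩
  let v : Ω → ℕ → H := fun ω => fullWeighted η fun i => φ (x (i + 1) ω)
  let S : ℕ → Ω → H := fun t ω => ∑ i ∈ Finset.range t, ε (i + 1) ω • v ω i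
  -- Failure of the self-normalized bound after t rounds. The run uses confidence δ/T, so a union
  -- bound over the T rounds costs δ.
  let bad : ℕ → Set Ω := fun t => {ω | R ^ 2 * (2 * Real.log (1 / (δ / T)) +
      Real.log (∏ i ∈ Finset.range t, (1 + leverage (lam * weight η t ^ 2) (v ω) i))) <
      inner ℝ (S t ω) (ridgeInv (lam * weight η t ^ 2) (v ω) t (S t ω))}
  have hbad : ∀ t < T, P (bad t) ≤ ENNReal.ofReal (δ / T) := by
    intro t ht
    have hw := weight_pos hη t
    refine measure_selfNormalized_le (P := P) (v := v) (e := fun i => ε (i + 1)) (by positivity) hR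
      (F := history (fun t => ⇑(f t)) x ε) (fun n hn => history_le hfm hrun.measurable_action
        hrun.measurable_noise (hn.trans ht)) (fun n hn i hi j hj => ?_)
      (fun n hn i hi => measurable_noise_history hfm hi)
      (fun n hn => hrun.measurable_noise _ ⟨by omega, by omega⟩)
      (fun n hn r => hrun.integrable_exp_noise n (hn.trans ht) r)
      (fun n hn r => hrun.subGaussian_noise n (hn.trans ht) r) hδT hδT1
    simp only [v, fullWeighted, inner_smul_left, inner_smul_right, hkφ, conj_trivial]
    exact ((hkm.comp ((measurable_action_history hi).prodMk
      (measurable_action_history hj))).const_mul _).const_mul _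
  have hgood : ∀ᵐ ω ∂P, ω ∉ ⋃ t ∈ Finset.range T, bad t → dynamicRegret (fun t => ⇑(f t)) x T ω ≤
      2 * β * √(T * ((lam + A) * (Fintype.card ι * Real.log (1 + T * (A / lam)) +
        T * (Fintype.card ι * Real.log (1 / η))) + T * (2 * κ * (1 + T * (A / lam))))) +
      2 * (2 / √lam * ((√(1 - η))⁻¹ * (1 - η)⁻¹ * BT)) := by
    have hact := ae_all_iff.2 fun t : Finset.range T =>
      hrun.action_maximizes t (Finset.mem_range.1 t.2)
    filter_upwards [hact] with ω hω hnot
    have hnot' : ∀ t < T, ω ∉ bad t := fun t ht h =>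
      hnot (Set.mem_iUnion₂.2 ⟨t, Finset.mem_range.2 ht, h⟩)
    set xs : ℕ → X := fun i => x (i + 1) ω with hxs
    set ψ : ℕ → H := fun i => φ (xs i) with hψ
    set r : ℕ → ℝ := fun t => ridgeVar (lam * weight η t) (rootWeighted η ψ) t (ψ t) with hr
    have hround : ∀ t ∈ Finset.range T, (⨆ z, f (t + 1) z) - f (t + 1) (x (t + 1) ω) ≤
        2 * β * √(r t) + 2 * drift lam η f t := by
      intro t ht
      have ht' := Finset.mem_range.1 ht
      have hw := weight_pos hη t
      have hQ : 0 ≤ 2 * Real.log (1 / (δ / T)) + 2 * doubleGain k lam η t := by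
        have h1 : 0 ≤ Real.log (1 / (δ / T)) :=
          Real.log_nonneg (by rwa [le_div_iff₀ hδT, one_mul])
        have h2 := doubleGain_nonneg hkφ hlam hη t
        linarith
      have hS : inner ℝ (S t ω) (ridgeInv (lam * weight η t ^ 2) (v ω) t (S t ω)) ≤
          (R * √(2 * Real.log (1 / (δ / T)) + 2 * doubleGain k lam η t)) ^ 2 := by
        refine (not_lt.1 (hnot' t ht')).trans ?_
        rw [mul_pow, Real.sq_sqrt hQ]
        refine mul_le_mul_of_nonneg_left (add_le_add_right ?_ _) (sq_nonneg R)
        -- The log-determinant along the realized actions is at most twice the maximum gain, hence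
        -- the deterministic width.
        have h1 := le_doubleGain hkφ hlam hη hη1.le hc hA fun i : Fin t => xs i
        rw [det_doubleGain_eq hkφ hlam hη] at h1
        have h2 : Real.log (∏ i ∈ Finset.range t, (1 + leverage (lam * weight η t ^ 2) (v ω) i)) =
          Real.log (∏ i ∈ Finset.range t, (1 + leverage (lam * weight η t ^ 2)
            (fullWeighted η fun i => φ (xs i)) i)) := rfl
        linarith
      have hwid : width k lam R B (δ / T) η t = B + 1 / √lam *
          (R * √(2 * Real.log (1 / (δ / T)) + 2 * doubleGain k lam η t)) := by
        rw [width, mul_assoc]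
      have hz := round_regret_le hkφ hk1 hlam hη hη1
        (mul_nonneg hR (Real.sqrt_nonneg _)) hB f xs (fun i => ε (i + 1) ω) t
        (hf _ ⟨by omega, ht'⟩) hS (fun z => by
          have := hω ⟨t, ht⟩ z
          rw [ucb, ucb, hwid] at this
          simpa only [hev, observation] using this)
      rw [← hwid] at hz
      have hd : 0 ≤ √(r t) := Real.sqrt_nonneg _
      have hwβ := mul_le_mul_of_nonneg_right (hβ t ht') hd
      rw [sub_le_iff_le_add]
      refine ciSup_le fun z => ?_
      have h := hz z
      rw [hev, hev] at h
      have h3 : f (t + 1) z - f (t + 1) (xs t) ≤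
        2 * width k lam R B (δ / T) η t * √(r t) + 2 * drift lam η f t := h
      change f (t + 1) z ≤ _ + f (t + 1) (xs t)
      linarith
    have hreg : dynamicRegret (fun t => ⇑(f t)) x T ω =
        ∑ t ∈ Finset.range T, ((⨆ z, f (t + 1) z) - f (t + 1) (x (t + 1) ω)) := by
      rw [dynamicRegret, Finset.range_eq_Ico, Finset.sum_Ico_add'
        (fun t => (⨆ z, f t z) - f t (x t ω)) 0 T 1]
      refine Finset.sum_congr ?_ fun _ _ => rfl
      ext t
      simp only [Finset.mem_Icc, Finset.mem_Ico]
      omega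
    have hβ0 : 0 ≤ β := by
      refine le_trans ?_ (hβ 0 (by omega))
      rw [width]; positivity
    rw [hreg]
    refine (Finset.sum_le_sum hround).trans ?_
    rw [Finset.sum_add_distrib, ← Finset.mul_sum, ← Finset.mul_sum]
    refine add_le_add (mul_le_mul_of_nonneg_left ?_ (by positivity))
      (mul_le_mul_of_nonneg_left (sum_drift_le hlam hη hη1 f T hBT) (by norm_num))
    refine sum_sqrt_le r (fun t => ridgeVar_nonneg (mul_pos hlam (weight_pos hη t)) _ _ _) T ?_
    refine sum_ridgeVar_le hlam hη hη1.le ((abs_nonneg _).trans (hc (xs 0) (xs 0))) ψ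
      (fun i => WithLp.toLp 2 (φ' (xs i))) (fun i => ?_) (fun i j => ?_) T
    · rw [← real_inner_self_eq_norm_sq, inner_toLp]; exact hA _
    · rw [inner_toLp, hkφ]; exact hc _ _
  set G := {ω | dynamicRegret (fun t => ⇑(f t)) x T ω ≤
      2 * β * √(T * ((lam + A) * (Fintype.card ι * Real.log (1 + T * (A / lam)) +
        T * (Fintype.card ι * Real.log (1 / η))) + T * (2 * κ * (1 + T * (A / lam))))) +
      2 * (2 / √lam * ((√(1 - η))⁻¹ * (1 - η)⁻¹ * BT))} with hG
  have hcompl : P Gᶜ ≤ ENNReal.ofReal δ := by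
    calc P Gᶜ ≤ P (⋃ t ∈ Finset.range T, bad t) := by
          refine measure_mono_ae ?_
          filter_upwards [hgood] with ω hω hωG
          by_contra hn
          exact hωG (hω hn)
      _ ≤ ∑ t ∈ Finset.range T, P (bad t) := measure_biUnion_finset_le _ _
      _ ≤ ∑ t ∈ Finset.range T, ENNReal.ofReal (δ / T) :=
          Finset.sum_le_sum fun t ht => hbad t (Finset.mem_range.1 ht)
      _ = ENNReal.ofReal δ := by
          rw [← ENNReal.ofReal_sum_of_nonneg fun _ _ => hδT.le, Finset.sum_const,
            Finset.card_range, nsmul_eq_mul, mul_div_cancel₀ _ hT0.ne']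
  rw [ENNReal.ofReal_sub _ hδ.le, ENNReal.ofReal_one, tsub_le_iff_right]
  -- Subadditivity suffices, so measurability of `G` is not needed.
  have h1 := measure_univ_le_add_compl (μ := P) G
  rw [measure_univ] at h1
  exact h1.trans (add_le_add_right hcompl _)

end HighProbability

/-! ### Real inequalities for the tuning. -/

section RealBounds

/-- A number that is bounded by the logarithm of a power of itself. -/
lemma le_mul_of_le_log {m L K ν γ : ℝ} {d : ℕ} (hm : 1 ≤ m) (hL : 1 ≤ L) (hK : 1 ≤ K)
    (hν : 0 < ν) (hγ : 0 < γ) (h1 : m ≤ 1 + (3 * L + 3 / 2 * Real.log γ) / ν)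
    (h2 : γ ≤ K * L * m ^ d) :
    m ≤ 2 * (1 + (9 / 2 + 3 / 2 * K + 3 / 2 * (d * (3 * d / ν + 1))) / ν) * L := by
  -- In log m ≤ m/s + s this slope makes (3/2) d m/s at most mν/2, which the left side absorbs; the
  -- summand 1 keeps s positive when d = 0.
  set s : ℝ := 3 * d / ν + 1 with hs
  have hd : (0 : ℝ) ≤ d := Nat.cast_nonneg d
  have hs1 : 1 ≤ s := by
    have : 0 ≤ 3 * (d : ℝ) / ν := by positivity
    linarith
  have hs0 : 0 < s := by linarith
  have hlogγ : Real.log γ ≤ K + L + d * Real.log m := by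
    refine (Real.log_le_log hγ h2).trans ?_
    rw [Real.log_mul (by positivity) (by positivity), Real.log_mul (by positivity) (by positivity),
      Real.log_pow]
    have e1 := Real.log_le_sub_one_of_pos (show 0 < K by linarith)
    have e2 := Real.log_le_sub_one_of_pos (show 0 < L by linarith)
    linarith
  have hlogm : Real.log m ≤ m / s + s := by
    have e1 := Real.log_le_sub_one_of_pos (show 0 < m / s by positivity)
    have e2 := Real.log_le_sub_one_of_pos hs0
    rw [Real.log_div (by positivity) (by positivity)] at e1
    linarith
  have h3 : m * ν ≤ ν + (3 * L + 3 / 2 * Real.log γ) := by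
    have := mul_le_mul_of_nonneg_right h1 hν.le
    rwa [add_mul, one_mul, div_mul_cancel₀ _ hν.ne'] at this
  have h4 : 3 / 2 * (d * (m / s)) ≤ m * ν / 2 := by
    have : 3 * (d : ℝ) ≤ ν * s := by rw [hs]; field_simp; linarith
    have e : 3 / 2 * (d * (m / s)) = 3 * d * m / (2 * s) := by field_simp
    rw [e, div_le_iff₀ (by positivity)]
    nlinarith
  have h5 := mul_le_mul_of_nonneg_left hlogm hd
  have h6 : m * ν ≤ 2 * (ν + (9 / 2 * L + 3 / 2 * K + 3 / 2 * (d * s))) := by nlinarith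
  have h7 : 2 * (ν + (9 / 2 * L + 3 / 2 * K + 3 / 2 * (d * s))) ≤
      2 * (ν + (9 / 2 + 3 / 2 * K + 3 / 2 * (d * s))) * L := by
    have : 0 ≤ (ν + 3 / 2 * K + 3 / 2 * (d * s)) * (L - 1) :=
      mul_nonneg (by positivity) (by linarith)
    nlinarith
  have h8 : 2 * (1 + (9 / 2 + 3 / 2 * K + 3 / 2 * (d * s)) / ν) * L =
      2 * (ν + (9 / 2 + 3 / 2 * K + 3 / 2 * (d * s))) * L / ν := by field_simp
  rw [h8, le_div_iff₀ hν]
  exact h6.trans h7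

lemma log_four_div_exp_pos : 0 < Real.log (4 / Real.exp 1) := by
  refine Real.log_pos ?_
  rw [lt_div_iff₀ (Real.exp_pos _), one_mul]
  exact Real.exp_one_lt_d9.trans (by norm_num)

/-- The rounding error of at most 1 in m costs one factor 4/e. -/
lemma exp_div_four_pow_le {m : ℕ} {Y : ℝ} (hY : 0 < Y)
    (h : |(m : ℝ) - Real.logb (4 / Real.exp 1) Y| ≤ 1) :
    (Real.exp 1 / 4) ^ m ≤ 4 / Real.exp 1 / Y := by
  have hν := log_four_div_exp_pos
  have h4 : 0 < 4 / Real.exp 1 := by positivity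
  have h1 := (abs_le.1 h).1
  rw [Real.logb] at h1
  have h2 : Real.log Y ≤ (m + 1) * Real.log (4 / Real.exp 1) := by
    rw [← div_le_iff₀ hν]; linarith
  have h3 : Y ≤ (4 / Real.exp 1) ^ (m + 1) := by
    rw [← Real.log_le_log_iff hY (by positivity), Real.log_pow]
    push_cast
    exact h2
  have h5 : Real.exp 1 / 4 = (4 / Real.exp 1)⁻¹ := by rw [inv_div]
  rw [h5, inv_pow, le_div_iff₀ hY, inv_mul_le_iff₀ (by positivity), ← pow_succ]
  exact h3

lemma nodes_le {m : ℕ} {T γ L : ℝ} (hT : 1 ≤ T) (hγ : 0 < γ) (hL : Real.log T ≤ L)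
    (h : |(m : ℝ) - Real.logb (4 / Real.exp 1) (T ^ 3 * γ ^ (3 / 2 : ℝ))| ≤ 1) :
    (m : ℝ) ≤ 1 + (3 * L + 3 / 2 * Real.log γ) / Real.log (4 / Real.exp 1) := by
  have hν := log_four_div_exp_pos
  have h1 := (abs_le.1 h).2
  rw [Real.logb, Real.log_mul (by positivity) (by positivity), Real.log_pow,
    Real.log_rpow hγ] at h1
  push_cast at h1
  have : (3 * Real.log T + 3 / 2 * Real.log γ) / Real.log (4 / Real.exp 1) ≤
      (3 * L + 3 / 2 * Real.log γ) / Real.log (4 / Real.exp 1) := by gcongr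
  linarith

/-- The order of the regret for the tuning with a known budget. -/
lemma order_known {γ g b BT T h : ℝ} (hg : 0 < g) (hγ : g ≤ γ) (hb : 0 < b) (hT : 0 < T)
    (hBT : b / T ≤ BT)
    (hh : h = γ ^ (-(1 / 4) : ℝ) * BT ^ (1 / 2 : ℝ) * T ^ (-(1 / 2) : ℝ)) :
    √T + T * √h + (√h)⁻¹ * h⁻¹ * BT ≤
      (g ^ (-(7 / 8) : ℝ) * b ^ (-(1 / 4) : ℝ) + g⁻¹ + g ^ (-(1 / 2) : ℝ)) *
        (γ ^ (7 / 8 : ℝ) * BT ^ (1 / 4 : ℝ) * T ^ (3 / 4 : ℝ)) := by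
  have hγ0 : 0 < γ := hg.trans_le hγ
  have hBT0 : 0 < BT := (by positivity : 0 < b / T).trans_le hBT
  have hbT : b ≤ BT * T := by rwa [div_le_iff₀ hT] at hBT
  set D := γ ^ (7 / 8 : ℝ) * BT ^ (1 / 4 : ℝ) * T ^ (3 / 4 : ℝ) with hD
  have hD0 : 0 < D := by positivity
  -- In e1, e2, e3 each term is the target times negative powers of γ and, here, of BT·T; these are
  -- bounded through g ≤ γ and b ≤ BT·T.
  have e1 : √T = γ ^ (-(7 / 8) : ℝ) * (BT * T) ^ (-(1 / 4) : ℝ) * D := by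
    simp only [hD, Real.sqrt_eq_rpow, Real.rpow_def_of_pos hγ0, Real.rpow_def_of_pos hBT0,
      Real.rpow_def_of_pos hT, Real.rpow_def_of_pos (mul_pos hBT0 hT),
      Real.log_mul hBT0.ne' hT.ne', ← Real.exp_add]
    congr 1; ring
  have e2 : T * √h = γ⁻¹ * D := by
    have hT' : T = Real.exp (Real.log T) := (Real.exp_log hT).symm
    have hγ' : γ⁻¹ = Real.exp (-Real.log γ) := by rw [Real.exp_neg, Real.exp_log hγ0]
    rw [hγ']
    nth_rewrite 1 [hT']
    simp only [hh, hD, Real.sqrt_eq_rpow, Real.rpow_def_of_pos hγ0, Real.rpow_def_of_pos hBT0,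
      Real.rpow_def_of_pos hT, ← Real.exp_add, ← Real.exp_mul]
    congr 1; ring
  have e3 : (√h)⁻¹ * h⁻¹ * BT = γ ^ (-(1 / 2) : ℝ) * D := by
    have hB' : BT = Real.exp (Real.log BT) := (Real.exp_log hBT0).symm
    have : (√h)⁻¹ * h⁻¹ * BT = (√h)⁻¹ * h⁻¹ * Real.exp (Real.log BT) := by rw [← hB']
    rw [this]
    simp only [hh, hD, Real.sqrt_eq_rpow, Real.rpow_def_of_pos hγ0, Real.rpow_def_of_pos hBT0,
      Real.rpow_def_of_pos hT, ← Real.exp_add, ← Real.exp_mul, ← Real.exp_neg]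
    congr 1; ring
  rw [e1, e2, e3, ← add_mul, ← add_mul]
  refine mul_le_mul_of_nonneg_right ?_ hD0.le
  have k1 : γ ^ (-(7 / 8) : ℝ) ≤ g ^ (-(7 / 8) : ℝ) :=
    Real.rpow_le_rpow_of_nonpos hg hγ (by norm_num)
  have k2 : (BT * T) ^ (-(1 / 4) : ℝ) ≤ b ^ (-(1 / 4) : ℝ) :=
    Real.rpow_le_rpow_of_nonpos hb hbT (by norm_num)
  have k3 : γ ^ (-(1 / 2) : ℝ) ≤ g ^ (-(1 / 2) : ℝ) :=
    Real.rpow_le_rpow_of_nonpos hg hγ (by norm_num)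
  have k4 : γ⁻¹ ≤ g⁻¹ := inv_anti₀ hg hγ
  gcongr

/-- The order of the regret for the tuning with an unknown budget. -/
lemma order_unknown {γ g b BT T h : ℝ} (hg : 0 < g) (hγ : g ≤ γ) (hb : 0 < b) (hT : 1 ≤ T)
    (hBT : b ≤ BT)
    (hh : h = γ ^ (-(1 / 4) : ℝ) * 1 ^ (1 / 2 : ℝ) * T ^ (-(1 / 2) : ℝ)) :
    √T + T * √h + (√h)⁻¹ * h⁻¹ * BT ≤
      (g ^ (-(7 / 8) : ℝ) * b⁻¹ + g⁻¹ * b⁻¹ + g ^ (-(1 / 2) : ℝ)) *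
        (γ ^ (7 / 8 : ℝ) * BT * T ^ (3 / 4 : ℝ)) := by
  have hγ0 : 0 < γ := hg.trans_le hγ
  have hBT0 : 0 < BT := hb.trans_le hBT
  have hT0 : 0 < T := by linarith
  rw [Real.one_rpow, mul_one] at hh
  set D := γ ^ (7 / 8 : ℝ) * BT * T ^ (3 / 4 : ℝ) with hD
  have hD0 : 0 < D := by positivity
  -- The target is linear in BT, so the two terms free of BT carry BT⁻¹, bounded by b⁻¹; √T is first
  -- enlarged to T^{3/4}.
  have e1 : √T ≤ γ ^ (-(7 / 8) : ℝ) * BT⁻¹ * D := by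
    have : γ ^ (-(7 / 8) : ℝ) * BT⁻¹ * D = T ^ (3 / 4 : ℝ) := by
      rw [hD, Real.rpow_neg hγ0.le]; field_simp
    rw [this, Real.sqrt_eq_rpow]
    exact Real.rpow_le_rpow_of_exponent_le hT (by norm_num)
  have e2 : T * √h = γ⁻¹ * BT⁻¹ * D := by
    have hT' : T = Real.exp (Real.log T) := (Real.exp_log hT0).symm
    have hγ' : γ⁻¹ = Real.exp (-Real.log γ) := by rw [Real.exp_neg, Real.exp_log hγ0]
    have hD2 : γ⁻¹ * BT⁻¹ * D = γ⁻¹ * γ ^ (7 / 8 : ℝ) * T ^ (3 / 4 : ℝ) := by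
      rw [hD]; field_simp
    rw [hD2, hγ']
    nth_rewrite 1 [hT']
    simp only [hh, Real.sqrt_eq_rpow, Real.rpow_def_of_pos hγ0,
      Real.rpow_def_of_pos hT0, ← Real.exp_add, ← Real.exp_mul]
    congr 1; ring
  have e3 : (√h)⁻¹ * h⁻¹ * BT = γ ^ (-(1 / 2) : ℝ) * D := by
    have : (√h)⁻¹ * h⁻¹ = γ ^ (-(1 / 2) : ℝ) * γ ^ (7 / 8 : ℝ) * T ^ (3 / 4 : ℝ) := by
      simp only [hh, Real.sqrt_eq_rpow, Real.rpow_def_of_pos hγ0,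
        Real.rpow_def_of_pos hT0, ← Real.exp_add, ← Real.exp_mul, ← Real.exp_neg]
      congr 1; ring
    rw [this, hD]; ring
  rw [e2, e3]
  refine (add_le_add_left (add_le_add_left e1 _) _).trans ?_
  rw [← add_mul, ← add_mul]
  refine mul_le_mul_of_nonneg_right ?_ hD0.le
  have k1 : γ ^ (-(7 / 8) : ℝ) ≤ g ^ (-(7 / 8) : ℝ) :=
    Real.rpow_le_rpow_of_nonpos hg hγ (by norm_num)
  have k3 : γ ^ (-(1 / 2) : ℝ) ≤ g ^ (-(1 / 2) : ℝ) :=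
    Real.rpow_le_rpow_of_nonpos hg hγ (by norm_num)
  have k4 : γ⁻¹ ≤ g⁻¹ := inv_anti₀ hg hγ
  have k5 : BT⁻¹ ≤ b⁻¹ := inv_anti₀ hb hBT
  gcongr

end RealBounds

/-! ### The regret order for kernels with good features. -/

section Order

lemma log_one_div_le {η : ℝ} (hη : 1 / 2 ≤ η) (hη1 : η ≤ 1) : Real.log (1 / η) ≤ 2 * (1 - η) := by
  have hη0 : 0 < η := by linarith
  refine (Real.log_le_sub_one_of_pos (by positivity)).trans ?_
  rw [sub_le_iff_le_add, div_le_iff₀ hη0]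
  nlinarith

lemma log_one_add_mul_le {T Q L : ℝ} (hT : 1 ≤ T) (hQ : 0 < Q) (hL : 1 ≤ L)
    (hTL : Real.log T ≤ L) : Real.log (1 + T * Q) ≤ L * (1 + Q) := by
  have h1 : Real.log (1 + T * Q) ≤ Real.log (T * (1 + Q)) :=
    Real.log_le_log (by positivity) (by linarith)
  rw [Real.log_mul (by positivity) (by positivity)] at h1
  have h2 := Real.log_le_sub_one_of_pos (show 0 < 1 + Q by positivity)
  have h3 : Q ≤ L * Q := le_mul_of_one_le_left hQ.le hL
  linarith

lemma sqrt_le_of_le_mul {y K M : ℝ} (hK : 0 ≤ K) (hM : 1 ≤ M) (hy : y ≤ (2 + 2 * K) * M) :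
    √y ≤ (3 + 2 * K) * M := by
  have h1 : 1 ≤ (3 + 2 * K) * M := one_le_mul_of_one_le_of_one_le (by linarith) hM
  refine Real.sqrt_le_iff.2 ⟨by linarith, ?_⟩
  have h2 : (3 + 2 * K) * M ≤ ((3 + 2 * K) * M) ^ 2 := le_self_pow₀ h1 two_ne_zero
  linarith

lemma sqrt_mul_le_of_le {V K M T h : ℝ} (hK : 0 ≤ K) (hM : 1 ≤ M) (hT : 0 ≤ T) (hh : 0 ≤ h)
    (hV : V ≤ K * M * (1 + T * h)) : √(T * V) ≤ (1 + K) * M * (√T + T * √h) := by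
  have h1 : 1 ≤ (1 + K) * M := one_le_mul_of_one_le_of_one_le (by linarith) hM
  refine Real.sqrt_le_iff.2 ⟨by positivity, ?_⟩
  have e1 : T * (1 + T * h) ≤ (√T + T * √h) ^ 2 := by
    have q3 : 0 ≤ √T * (T * √h) := by positivity
    rw [add_sq, mul_pow, Real.sq_sqrt hT, Real.sq_sqrt hh]
    linarith
  have e2 : K * M ≤ ((1 + K) * M) ^ 2 := by
    have : (1 + K) * M ≤ ((1 + K) * M) ^ 2 := le_self_pow₀ h1 two_ne_zero
    linarith
  calc T * V ≤ T * (K * M * (1 + T * h)) := by gcongr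
    _ = K * M * (T * (1 + T * h)) := by ring
    _ ≤ ((1 + K) * M) ^ 2 * (√T + T * √h) ^ 2 := by gcongr
    _ = _ := by ring

/-- Used with s = 1 when η < 1/2, and with s = 0 for a kernel vanishing on the diagonal. -/
lemma dynamicRegret_le_trivial {X : Type*} {k : X → X → ℝ} {H : Type*} [NormedAddCommGroup H] [InnerProductSpace ℝ H]
    [CompleteSpace H] [RKHS ℝ H X ℝ] (hH : ∀ z z' : X, RKHS.kernel H z z' (1 : ℝ) = k z z')
    {s : ℝ} (hs : 0 ≤ s) (hks : ∀ z, k z z ≤ s ^ 2) {B : ℝ} {T : ℕ} {f : ℕ → H}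
    (hf : ∀ t ∈ Set.Icc 1 T, ‖f t‖ ≤ B) {Ω : Type*} (x : ℕ → Ω → X) (ω : Ω) :
    dynamicRegret (fun t => ⇑(f t)) x T ω ≤ T * (2 * (s * B)) := by
  have hX : Nonempty X := ⟨x 0 ω⟩
  have habs : ∀ t ∈ Finset.Icc 1 T, ∀ z, |f t z| ≤ s * B := by
    intro t ht z
    have h1 : ‖RKHS.kerFun H z (1 : ℝ)‖ ≤ s := by
      refine abs_le_of_sq_le_sq' ?_ hs |>.2
      rw [← real_inner_self_eq_norm_sq, inner_kerFun_kerFun hH]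
      exact hks z
    rw [← inner_kerFun_one]
    exact (abs_real_inner_le_norm _ _).trans
      (mul_le_mul h1 (hf t (Finset.mem_Icc.1 ht)) (norm_nonneg _) hs)
  rw [dynamicRegret]
  refine (Finset.sum_le_card_nsmul _ _ (2 * (s * B)) fun t ht => ?_).trans_eq (by simp)
  have h1 := (abs_le.1 (habs t ht (x t ω))).1
  have h2 : (⨆ z, f t z) ≤ s * B := ciSup_le fun z => (abs_le.1 (habs t ht z)).2
  linarith

variable {X : Type*} [TopologicalSpace X] [MeasurableSpace X] [BorelSpace X]
  [SecondCountableTopology X] {k : X → X → ℝ}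

set_option maxHeartbeats 1600000 in
/-- The regret of WGP-UCB for a tuned number of nodes, as a function of the discount factor. -/
theorem exists_regret_bound {ι : ℕ → Type*} [∀ m, Fintype (ι m)] {φ : ∀ m, X → ι m → ℝ}
    {d : ℕ} {C₀ lam R B : ℝ} (hk : Continuous fun z : X × X => k z.1 z.2) (hk1 : ∀ z, k z z ≤ 1)
    (hcard : ∀ m, Fintype.card (ι m) ≤ 2 * m ^ d)
    (hC₀ : ∀ m, 1 ≤ m → ∀ z z', |k z z' - φ m z ⬝ᵥ φ m z'| ≤ C₀ * (Real.exp 1 / 4) ^ m)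
    (hlam : 0 < lam) (hR : 0 ≤ R) (hB : 0 ≤ B) {z₀ : X} (hz₀ : 0 < k z₀ z₀) :
    ∃ K : ℝ, 0 ≤ K ∧
      ∀ (H : Type u) [NormedAddCommGroup H] [InnerProductSpace ℝ H] [CompleteSpace H]
        [RKHS ℝ H X ℝ] (_ : ∀ z z' : X, RKHS.kernel H z z' (1 : ℝ) = k z z')
        (Ω : Type v) [MeasurableSpace Ω] (P : Measure Ω) [IsProbabilityMeasure P]
        (T : ℕ) (_ : 1 ≤ T) (δ : ℝ) (_ : 0 < δ) (_ : δ < 1) (BT V η : ℝ) (m : ℕ)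
        (f : ℕ → H) (x : ℕ → Ω → X) (ε : ℕ → Ω → ℝ)
        (_ : ∀ t ∈ Set.Icc 1 T, ‖f t‖ ≤ B)
        (_ : ∑ t ∈ Finset.Ico 1 T, ‖f (t + 1) - f t‖ ≤ BT)
        (_ : IsRun P k lam R B (δ / T) η T (fun t => ⇑(f t)) x ε) (_ : IsTuned k φ lam T V η m),
        1 / 2 * Real.log (1 + k z₀ z₀ / lam) ≤ combinedGain k (φ m) lam η T ∧
        ENNReal.ofReal (1 - δ) ≤ P {ω | dynamicRegret (fun t => ⇑(f t)) x T ω ≤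
          K * (1 + Real.log (T / δ)) ^ (2 * d + 2) *
            (√T + T * √(1 - η) + (√(1 - η))⁻¹ * (1 - η)⁻¹ * BT)} := by
  set g : ℝ := 1 / 2 * Real.log (1 + k z₀ z₀ / lam) with hg
  have hg0 : 0 < g := by
    have : 0 < k z₀ z₀ / lam := by positivity
    exact mul_pos (by norm_num) (Real.log_pos (by linarith))
  set ν := Real.log (4 / Real.exp 1) with hνdef
  have hν : 0 < ν := log_four_div_exp_pos
  set C₁ := |C₀| with hC₁
  have hC₁0 : 0 ≤ C₁ := abs_nonneg _
  set A : ℝ := 1 + C₁ with hA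
  set Q : ℝ := A / lam with hQ
  have hQ0 : 0 < Q := by positivity
  -- The constants bound in turn: K₁ the product κT²; K₂ the gains against L m^d; K₃ the ratio m/L;
  -- K₄, K₅ and K₆ the gain, the width and the variance sum against powers of L; K₇ the regret, its
  -- 4B serving the case η < 1/2.
  obtain ⟨K₁, hK₁⟩ : ∃ y : ℝ, y = C₁ * (4 / Real.exp 1 * g ^ (-(3 / 2) : ℝ)) := ⟨_, rfl⟩
  have hK₁0 : 0 ≤ K₁ := by rw [hK₁]; positivity
  obtain ⟨K₂, hK₂⟩ : ∃ y : ℝ, y = (1 + Q) * (1 + K₁ / lam) := ⟨_, rfl⟩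
  have hK₂1 : 1 ≤ K₂ := by
    rw [hK₂]
    have : 0 ≤ K₁ / lam := by positivity
    nlinarith
  obtain ⟨K₃, hK₃⟩ : ∃ y : ℝ, y = 2 * (1 + (9 / 2 + 3 / 2 * K₂ + 3 / 2 * (d * (3 * d / ν + 1))) / ν) := ⟨_, rfl⟩
  have hK₃0 : 0 ≤ K₃ := by rw [hK₃]; positivity
  obtain ⟨K₄, hK₄⟩ : ∃ y : ℝ, y = K₂ * K₃ ^ d := ⟨_, rfl⟩
  have hK₄0 : 0 ≤ K₄ := by rw [hK₄]; positivity
  obtain ⟨K₅, hK₅⟩ : ∃ y : ℝ, y = B + 1 / √lam * R * (3 + 2 * K₄) := ⟨_, rfl⟩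
  have hK₅0 : 0 ≤ K₅ := by rw [hK₅]; positivity
  obtain ⟨K₆, hK₆⟩ : ∃ y : ℝ, y = (lam + A) * (2 * K₃ ^ d * (1 + Q) + 4 * K₃ ^ d) + 2 * K₁ * (1 + Q) := ⟨_, rfl⟩
  have hK₆0 : 0 ≤ K₆ := by rw [hK₆]; positivity
  obtain ⟨K₇, hK₇⟩ : ∃ y : ℝ, y = 2 * K₅ * (1 + K₆) + 4 / √lam + 4 * B := ⟨_, rfl⟩
  have hK₇0 : 0 ≤ K₇ := by rw [hK₇]; positivity
  refine ⟨K₇, hK₇0, ?_⟩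
  intro H _ _ _ _ hH Ω _ P _ T hT δ hδ hδ1 BT V η m f x ε hf hBT hrun htuned
  have hη := htuned.eta_pos
  have hη1 := htuned.eta_lt_one
  have hm1 := htuned.one_le_nodes
  have hX : Nonempty X := ⟨z₀⟩
  have hTr : (1 : ℝ) ≤ T := by exact_mod_cast hT
  have hT0 : (0 : ℝ) < T := by linarith
  have hmr : (1 : ℝ) ≤ m := by exact_mod_cast hm1
  have hBT0 : 0 ≤ BT := (Finset.sum_nonneg fun _ _ => norm_nonneg _).trans hBT
  set φH : X → H := fun z => RKHS.kerFun H z (1 : ℝ) with hφH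
  have hkφ : ∀ z z', inner ℝ (φH z) (φH z') = k z z' := inner_kerFun_kerFun hH
  set κ : ℝ := C₁ * (Real.exp 1 / 4) ^ m with hκ
  have hκ0 : 0 ≤ κ := by positivity
  have hc : ∀ z z', |k z z' - φ m z ⬝ᵥ φ m z'| ≤ κ := fun z z' =>
    (hC₀ m hm1 z z').trans (mul_le_mul_of_nonneg_right (le_abs_self _) (by positivity))
  have hκC : κ ≤ C₁ := by
    refine mul_le_of_le_one_right hC₁0 (pow_le_one₀ (by positivity) ?_)
    have := Real.exp_one_lt_d9
    linarith
  have hAφ : ∀ z, φ m z ⬝ᵥ φ m z ≤ A := fun z => by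
    have := (abs_le.1 (hc z z)).1
    have := hk1 z
    linarith
  set γ := combinedGain k (φ m) lam η T with hγdef
  have hgγ : g ≤ γ :=
    (half_log_le_doubleGain hkφ hlam hη hη1.le hc hAφ hT z₀).trans (le_max_left _ _)
  refine ⟨hgγ, ?_⟩
  have hγ0 : 0 < γ := hg0.trans_le hgγ
  set L : ℝ := 1 + Real.log (T / δ) with hL
  have hlogT : Real.log T ≤ L ∧ Real.log (T / δ) ≤ L ∧ 1 ≤ L := by
    have h1 := Real.log_nonneg hTr
    have h2 := Real.log_neg hδ hδ1
    rw [hL, Real.log_div hT0.ne' hδ.ne']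
    refine ⟨?_, ?_, ?_⟩ <;> linarith
  obtain ⟨hLT, hLδ, hL1⟩ := hlogT
  have hLQ : Real.log (1 + T * Q) ≤ L * (1 + Q) := log_one_add_mul_le hTr hQ0 hL1 hLT
  have hTQ0 : 0 ≤ T * Q := by positivity
  have hlogTQ0 : 0 ≤ Real.log (1 + T * Q) := Real.log_nonneg (by linarith)
  -- Of the T³ in the tuning only T² is needed; the factor γ^{3/2} is bounded below through g.
  have hκT : κ * T ^ 2 ≤ K₁ := by
    have h1 := exp_div_four_pow_le (Y := (T : ℝ) ^ 3 * γ ^ (3 / 2 : ℝ)) (by positivity)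
      htuned.nodes
    have h2 : γ ^ (-(3 / 2) : ℝ) ≤ g ^ (-(3 / 2) : ℝ) :=
      Real.rpow_le_rpow_of_nonpos hg0 hgγ (by norm_num)
    have h3 : 4 / Real.exp 1 / ((T : ℝ) ^ 3 * γ ^ (3 / 2 : ℝ)) * T ^ 2 =
        4 / Real.exp 1 * γ ^ (-(3 / 2) : ℝ) / T := by
      rw [Real.rpow_neg hγ0.le]
      field_simp
    calc κ * T ^ 2 ≤ C₁ * (4 / Real.exp 1 / ((T : ℝ) ^ 3 * γ ^ (3 / 2 : ℝ))) * T ^ 2 := by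
          rw [hκ]; gcongr
      _ = C₁ * (4 / Real.exp 1 * γ ^ (-(3 / 2) : ℝ) / T) := by rw [mul_assoc, h3]
      _ ≤ C₁ * (4 / Real.exp 1 * γ ^ (-(3 / 2) : ℝ)) := by
          gcongr
          exact div_le_self (by positivity) hTr
      _ ≤ K₁ := by rw [hK₁]; gcongr
  have herr : T * (2 * κ * (1 + T * Q)) ≤ 2 * K₁ * (1 + Q) := by
    have h1 : T * (2 * κ * (1 + T * Q)) ≤ 2 * (κ * T ^ 2) * (1 + Q) := by
      have : T * (1 + T * Q) ≤ (T : ℝ) ^ 2 * (1 + Q) := by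
        have : (T : ℝ) ≤ (T : ℝ) ^ 2 := le_self_pow₀ hTr two_ne_zero
        linarith
      calc _ = 2 * κ * (T * (1 + T * Q)) := by ring
        _ ≤ 2 * κ * ((T : ℝ) ^ 2 * (1 + Q)) := by gcongr
        _ = _ := by ring
    refine h1.trans ?_
    gcongr
  have hN : (Fintype.card (ι m) : ℝ) ≤ 2 * (m : ℝ) ^ d := by exact_mod_cast hcard m
  have hmd : (1 : ℝ) ≤ (m : ℝ) ^ d := one_le_pow₀ hmr
  -- The features tuned for the horizon T serve all earlier rounds.
  have hdouble : ∀ t ≤ T, doubleGain k lam η t ≤ K₂ * L * (m : ℝ) ^ d := by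
    intro t ht
    have ht' : (t : ℝ) ≤ T := by exact_mod_cast ht
    refine (doubleGain_le hkφ hlam hη hη1.le hc hAφ t).trans ?_
    have h1 : Real.log (1 + t * Q) ≤ L * (1 + Q) :=
      (Real.log_le_log (by positivity) (by gcongr)).trans hLQ
    have h2 : t * (2 * κ / lam * (1 + t * Q)) ≤ 2 * K₁ * (1 + Q) / lam := by
      rw [le_div_iff₀ hlam]
      calc t * (2 * κ / lam * (1 + t * Q)) * lam = t * (2 * κ * (1 + t * Q)) := by field_simp
        _ ≤ T * (2 * κ * (1 + T * Q)) := by gcongr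
        _ ≤ _ := herr
    have h3 : Fintype.card (ι m) * Real.log (1 + t * Q) ≤ 2 * (m : ℝ) ^ d * (L * (1 + Q)) :=
      mul_le_mul hN h1 (Real.log_nonneg (by
        have : 0 ≤ (t : ℝ) * Q := by positivity
        linarith)) (by positivity)
    have h4 : K₁ * (1 + Q) / lam ≤ K₁ * (1 + Q) / lam * (L * (m : ℝ) ^ d) :=
      le_mul_of_one_le_right (by positivity) (one_le_mul_of_one_le_of_one_le hL1 hmd)
    calc _ ≤ 1 / 2 * (2 * (m : ℝ) ^ d * (L * (1 + Q)) + 2 * K₁ * (1 + Q) / lam) := by gcongr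
      _ = (m : ℝ) ^ d * (L * (1 + Q)) + K₁ * (1 + Q) / lam := by ring
      _ ≤ (m : ℝ) ^ d * (L * (1 + Q)) + K₁ * (1 + Q) / lam * (L * (m : ℝ) ^ d) := by gcongr
      _ = _ := by rw [hK₂]; ring
  have hfeat : featureGain (φ m) lam η T ≤ K₂ * L * (m : ℝ) ^ d := by
    refine (featureGain_le hlam hη hη1.le hAφ T).trans ?_
    calc _ ≤ 1 / 2 * (2 * (m : ℝ) ^ d * (L * (1 + Q))) :=
          mul_le_mul_of_nonneg_left (mul_le_mul hN hLQ hlogTQ0 (by positivity)) (by norm_num)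
      _ = (1 + Q) * L * (m : ℝ) ^ d := by ring
      _ ≤ _ := by
        have : 1 + Q ≤ K₂ := by
          rw [hK₂]
          exact le_mul_of_one_le_right (by positivity) (le_add_of_nonneg_right (by positivity))
        gcongr
  have hγK : γ ≤ K₂ * L * (m : ℝ) ^ d := max_le (hdouble T le_rfl) hfeat
  -- Closes the circle between m, bounded by log γ, and γ, bounded by L m^d.
  have hmL : (m : ℝ) ≤ K₃ * L :=
    hK₃ ▸ le_mul_of_le_log hmr hL1 hK₂1 hν hγ0 (nodes_le hTr hγ0 hLT htuned.nodes) hγK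
  have hmd3 : (m : ℝ) ^ d ≤ K₃ ^ d * L ^ d := by
    rw [← mul_pow]; exact pow_le_pow_left₀ (by positivity) hmL d
  have hLd : L ≤ L ^ (d + 1) := le_self_pow₀ hL1 (by omega)
  have hLd1 : 1 ≤ L ^ (d + 1) := one_le_pow₀ hL1
  have hL0 : 0 < L := by linarith
  have hβ : ∀ t < T, width k lam R B (δ / T) η t ≤ K₅ * L ^ (d + 1) := by
    intro t ht
    have h1 : doubleGain k lam η t ≤ K₄ * L ^ (d + 1) := by
      refine (hdouble t ht.le).trans ?_
      calc K₂ * L * (m : ℝ) ^ d ≤ K₂ * L * (K₃ ^ d * L ^ d) := by gcongr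
        _ = _ := by rw [hK₄]; ring
    have h2 : Real.log (1 / (δ / T)) ≤ L := by rwa [one_div, inv_div]
    have h3 : √(2 * Real.log (1 / (δ / T)) + 2 * doubleGain k lam η t) ≤
        (3 + 2 * K₄) * L ^ (d + 1) := by
      have h4 : 2 * Real.log (1 / (δ / T)) + 2 * doubleGain k lam η t ≤
          (2 + 2 * K₄) * L ^ (d + 1) := by linarith
      exact sqrt_le_of_le_mul hK₄0 hLd1 h4
    rw [width]
    calc _ ≤ B * L ^ (d + 1) + 1 / √lam * R * ((3 + 2 * K₄) * L ^ (d + 1)) := by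
          refine add_le_add (le_mul_of_one_le_right hB hLd1) ?_
          gcongr
      _ = _ := by rw [hK₅]; ring
  set h : ℝ := 1 - η with hh
  have hh0 : 0 < h := by linarith
  have hlast : 0 ≤ (√h)⁻¹ * h⁻¹ * BT := by positivity
  have hLp : 1 ≤ L ^ (2 * d + 2) := one_le_pow₀ hL1
  have hLdp : L ^ (d + 1) * L ^ (d + 1) = L ^ (2 * d + 2) := by rw [← pow_add]; congr 1; omega
  -- For η < 1/2 the term T√(1−η) is at least T/2 and the trivial bound 2BT suffices; otherwise
  -- log(1/η) ≤ 2(1−η).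
  by_cases hη2 : η < 1 / 2
  · have huniv : {ω | dynamicRegret (fun t => ⇑(f t)) x T ω ≤ K₇ * L ^ (2 * d + 2) *
        (√T + T * √h + (√h)⁻¹ * h⁻¹ * BT)} = Set.univ := by
      refine Set.eq_univ_of_forall fun ω => ?_
      refine (dynamicRegret_le_trivial hH zero_le_one (by simpa using hk1) hf x ω).trans ?_
      have h1 : 1 / 2 ≤ √h := Real.le_sqrt_of_sq_le (by rw [hh]; linarith)
      have h2 : 4 * B ≤ K₇ * L ^ (2 * d + 2) := by
        refine le_trans ?_ (le_mul_of_one_le_right hK₇0 hLp)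
        rw [hK₇]
        have : 0 ≤ 2 * K₅ * (1 + K₆) + 4 / √lam := by positivity
        linarith
      have h3 : T * (1 / 2) ≤ √T + T * √h + (√h)⁻¹ * h⁻¹ * BT := by
        have := mul_le_mul_of_nonneg_left h1 hT0.le
        have := Real.sqrt_nonneg (T : ℝ)
        linarith
      calc T * (2 * (1 * B)) = 4 * B * (T * (1 / 2)) := by ring
        _ ≤ _ := mul_le_mul h2 h3 (by positivity) (by positivity)
    rw [huniv, measure_univ]
    exact ENNReal.ofReal_le_one.2 (by linarith)
  · have hη2 := not_lt.1 hη2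
    have hreg := le_measure_dynamicRegret_le hk hk1 hH hc hAφ hlam hR hB hη hη1 hδ hδ1 hT hf hBT
      hrun hβ
    refine hreg.trans (measure_mono fun ω hω => ?_)
    refine le_trans (Set.mem_ofPred_eq ▸ hω) ?_
    have hlogη : Real.log (1 / η) ≤ 2 * h := log_one_div_le hη2 hη1.le
    have hlogη0 : 0 ≤ Real.log (1 / η) := Real.log_nonneg (by rw [le_div_iff₀ hη]; linarith)
    have hN2 : (Fintype.card (ι m) : ℝ) ≤ 2 * (K₃ ^ d * L ^ d) := by linarith
    have hV : (lam + A) * (Fintype.card (ι m) * Real.log (1 + T * Q) +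
        T * (Fintype.card (ι m) * Real.log (1 / η))) + T * (2 * κ * (1 + T * Q)) ≤
        K₆ * L ^ (d + 1) * (1 + T * h) := by
      have hLL : L ^ d ≤ L ^ (d + 1) := pow_le_pow_right₀ hL1 (Nat.le_succ d)
      have e1 : Fintype.card (ι m) * Real.log (1 + T * Q) ≤
          2 * K₃ ^ d * (1 + Q) * L ^ (d + 1) := by
        calc _ ≤ 2 * (K₃ ^ d * L ^ d) * (L * (1 + Q)) :=
              mul_le_mul hN2 hLQ hlogTQ0 (by positivity)
          _ = _ := by ring
      have e2 : T * (Fintype.card (ι m) * Real.log (1 / η)) ≤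
          4 * K₃ ^ d * L ^ (d + 1) * (T * h) := by
        calc _ ≤ T * (2 * (K₃ ^ d * L ^ (d + 1)) * (2 * h)) := by
              refine mul_le_mul_of_nonneg_left (mul_le_mul (hN2.trans ?_) hlogη hlogη0
                (by positivity)) hT0.le
              gcongr
          _ = _ := by ring
      have e3 : 2 * K₁ * (1 + Q) ≤ 2 * K₁ * (1 + Q) * L ^ (d + 1) :=
        le_mul_of_one_le_right (by positivity) hLd1
      have hTh : 0 ≤ T * h := by positivity
      calc _ ≤ (lam + A) * (2 * K₃ ^ d * (1 + Q) * L ^ (d + 1) +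
            4 * K₃ ^ d * L ^ (d + 1) * (T * h)) + 2 * K₁ * (1 + Q) * L ^ (d + 1) := by
            refine add_le_add ?_ (herr.trans e3)
            gcongr
        _ ≤ (lam + A) * (2 * K₃ ^ d * (1 + Q) * L ^ (d + 1) * (1 + T * h) +
            4 * K₃ ^ d * L ^ (d + 1) * (1 + T * h)) +
            2 * K₁ * (1 + Q) * L ^ (d + 1) * (1 + T * h) := by
            refine add_le_add (mul_le_mul_of_nonneg_left (add_le_add ?_ ?_) (by positivity)) ?_
            · exact le_mul_of_one_le_right (by positivity) (by linarith)
            · gcongr; linarith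
            · exact le_mul_of_one_le_right (by positivity) (by linarith)
        _ = _ := by rw [hK₆]; ring
    have hsqrt : √(T * ((lam + A) * (Fintype.card (ι m) * Real.log (1 + T * Q) +
        T * (Fintype.card (ι m) * Real.log (1 / η))) + T * (2 * κ * (1 + T * Q)))) ≤
        (1 + K₆) * L ^ (d + 1) * (√T + T * √h) :=
      sqrt_mul_le_of_le hK₆0 hLd1 hT0.le hh0.le hV
    calc _ ≤ 2 * (K₅ * L ^ (d + 1)) * ((1 + K₆) * L ^ (d + 1) * (√T + T * √h)) +
          2 * (2 / √lam * ((√h)⁻¹ * h⁻¹ * BT)) := by gcongr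
      _ = 2 * K₅ * (1 + K₆) * (√T + T * √h) * L ^ (2 * d + 2) +
          4 / √lam * ((√h)⁻¹ * h⁻¹ * BT) := by rw [← hLdp]; ring
      _ ≤ 2 * K₅ * (1 + K₆) * (√T + T * √h) * L ^ (2 * d + 2) +
          4 / √lam * ((√h)⁻¹ * h⁻¹ * BT) * L ^ (2 * d + 2) := by
          refine add_le_add_right (le_mul_of_one_le_right (by positivity) hLp) _
      _ = (2 * K₅ * (1 + K₆) * (√T + T * √h) + 4 / √lam * ((√h)⁻¹ * h⁻¹ * BT)) *
          L ^ (2 * d + 2) := by ring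
      _ ≤ K₇ * (√T + T * √h + (√h)⁻¹ * h⁻¹ * BT) * L ^ (2 * d + 2) := by
          refine mul_le_mul_of_nonneg_right ?_ (by positivity)
          rw [mul_add K₇]
          have p1 : 2 * K₅ * (1 + K₆) ≤ K₇ := by
            have : 0 ≤ 4 / √lam + 4 * B := by positivity
            rw [hK₇]; linarith
          have p2 : 4 / √lam ≤ K₇ := by
            have : 0 ≤ 2 * K₅ * (1 + K₆) + 4 * B := by positivity
            rw [hK₇]; linarith
          exact add_le_add (mul_le_mul_of_nonneg_right p1 (by positivity))
            (mul_le_mul_of_nonneg_right p2 hlast)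
      _ = _ := by ring

/-- The regret order for every kernel that is approximated by finite-dimensional features at an
exponential rate. -/
theorem regretOrder_of_features {ι : ℕ → Type*} [∀ m, Fintype (ι m)] {φ : ∀ m, X → ι m → ℝ}
    {d : ℕ} {C₀ lam R B : ℝ} (hk : Continuous fun z : X × X => k z.1 z.2) (hk1 : ∀ z, k z z ≤ 1)
    (hcard : ∀ m, Fintype.card (ι m) ≤ 2 * m ^ d)
    (hC₀ : ∀ m, 1 ≤ m → ∀ z z', |k z z' - φ m z ⬝ᵥ φ m z'| ≤ C₀ * (Real.exp 1 / 4) ^ m)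
    (hlam : 0 < lam) (hR : 0 ≤ R) (hB : 0 ≤ B) : RegretOrder.{u, v} k φ lam R B := by
  intro b hb
  by_cases hz : ∃ z₀, 0 < k z₀ z₀
  · obtain ⟨z₀, hz₀⟩ := hz
    obtain ⟨K, hK0, hK⟩ :=
      exists_regret_bound.{u, v} hk hk1 hcard hC₀ hlam hR hB hz₀
    set g : ℝ := 1 / 2 * Real.log (1 + k z₀ z₀ / lam) with hg
    have hg0 : 0 < g := by
      have : 0 < k z₀ z₀ / lam := by positivity
      exact mul_pos (by norm_num) (Real.log_pos (by linarith))
    set c₁ : ℝ := g ^ (-(7 / 8) : ℝ) * b ^ (-(1 / 4) : ℝ) + g⁻¹ + g ^ (-(1 / 2) : ℝ) with hc₁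
    set c₂ : ℝ := g ^ (-(7 / 8) : ℝ) * b⁻¹ + g⁻¹ * b⁻¹ + g ^ (-(1 / 2) : ℝ) with hc₂
    have hc₁0 : 0 ≤ c₁ := by positivity
    have hc₂0 : 0 ≤ c₂ := by positivity
    refine ⟨K * (c₁ + c₂), 2 * d + 2, ?_⟩
    intro H _ _ _ _ hH Ω _ P _ T hT δ hδ hδ1 BT η m f x ε hf hBT hrun
    have hTr : (1 : ℝ) ≤ T := by exact_mod_cast hT
    have hT0 : (0 : ℝ) < T := by linarith
    have hL0 : 0 ≤ 1 + Real.log (T / δ) := by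
      have := Real.log_nonneg (show 1 ≤ (T : ℝ) / δ by rw [le_div_iff₀ hδ]; linarith)
      linarith
    constructor
    · intro hb1 ht
      obtain ⟨hgγ, hP⟩ := hK H hH Ω P T hT δ hδ hδ1 BT BT η m f x ε hf hBT hrun ht
      have hBT0 : 0 ≤ BT := (by positivity : 0 ≤ b / T).trans hb1
      have hγ0 := hg0.trans_le hgγ
      have ho := order_known (h := 1 - η) hg0 hgγ hb hT0 hb1
        (by have := ht.eta_eq; linarith)
      rw [← hc₁] at ho
      refine hP.trans (measure_mono fun ω hω => ?_)
      refine le_trans (Set.mem_ofPred_eq ▸ hω) ?_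
      calc _ ≤ K * (1 + Real.log (T / δ)) ^ (2 * d + 2) * ((c₁ + c₂) *
            (combinedGain k (φ m) lam η T ^ (7 / 8 : ℝ) * BT ^ (1 / 4 : ℝ) *
              (T : ℝ) ^ (3 / 4 : ℝ))) := by
            refine mul_le_mul_of_nonneg_left (ho.trans ?_) (by positivity)
            refine mul_le_mul_of_nonneg_right (by linarith) (by positivity)
        _ = _ := by ring
    · intro hb1 ht
      obtain ⟨hgγ, hP⟩ := hK H hH Ω P T hT δ hδ hδ1 BT 1 η m f x ε hf hBT hrun ht
      have hBT0 : 0 ≤ BT := hb.le.trans hb1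
      have hγ0 := hg0.trans_le hgγ
      have ho := order_unknown (h := 1 - η) hg0 hgγ hb hTr hb1
        (by have := ht.eta_eq; linarith)
      rw [← hc₂] at ho
      refine hP.trans (measure_mono fun ω hω => ?_)
      refine le_trans (Set.mem_ofPred_eq ▸ hω) ?_
      calc _ ≤ K * (1 + Real.log (T / δ)) ^ (2 * d + 2) * ((c₁ + c₂) *
            (combinedGain k (φ m) lam η T ^ (7 / 8 : ℝ) * BT *
              (T : ℝ) ^ (3 / 4 : ℝ))) := by
            refine mul_le_mul_of_nonneg_left (ho.trans ?_) (by positivity)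
            refine mul_le_mul_of_nonneg_right (by linarith) (by positivity)
        _ = _ := by ring
  -- Here every function of the RKHS vanishes, so C = 0 works.
  · have hz' : ∀ z, k z z ≤ (0 : ℝ) ^ 2 := fun z => by
      have := not_lt.1 (fun h => hz ⟨z, h⟩)
      simpa using this
    refine ⟨0, 0, ?_⟩
    intro H _ _ _ _ hH Ω _ P _ T hT δ hδ hδ1 BT η m f x ε hf hBT hrun
    have hreg : ∀ ω, dynamicRegret (fun t => ⇑(f t)) x T ω ≤ 0 := fun ω => by
      simpa using dynamicRegret_le_trivial hH le_rfl hz' hf x ω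
    have hone : ENNReal.ofReal (1 - δ) ≤ 1 := ENNReal.ofReal_le_one.2 (by linarith)
    constructor <;>
    · intro _ _
      refine hone.trans_eq ?_
      rw [← measure_univ (μ := P)]
      congr 1
      refine (Set.eq_univ_of_forall fun ω => ?_).symm
      simpa using hreg ω

end Order

/-! ### Hermite polynomials and Gauss–Hermite quadrature. -/

section Hermite

open Polynomial

lemma derivative_hermiteH_succ (n : ℕ) :
    derivative (hermiteH (n + 1)) = (2 * ((n : ℝ[X]) + 1)) * hermiteH n := by
  induction n with
  | zero => simp [hermiteH]
  | succ n ih =>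
    have h1 : derivative (hermiteH (n + 2)) = 2 * hermiteH (n + 1) +
        2 * X * derivative (hermiteH (n + 1)) - derivative (derivative (hermiteH (n + 1))) := by
      rw [hermiteH, derivative_sub, derivative_mul, derivative_mul, derivative_ofNat,
        derivative_X]
      ring
    have h2 : derivative (derivative (hermiteH (n + 1))) =
        (2 * ((n : ℝ[X]) + 1)) * derivative (hermiteH n) := by
      rw [ih, derivative_mul]
      simp
    rw [h1, h2, ih]
    have h3 : hermiteH (n + 1) = 2 * X * hermiteH n - derivative (hermiteH n) := rfl
    rw [h3]
    push_cast
    ring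

lemma hermiteH_succ_succ (n : ℕ) :
    hermiteH (n + 2) = 2 * X * hermiteH (n + 1) - (2 * ((n : ℝ[X]) + 1)) * hermiteH n := by
  rw [← derivative_hermiteH_succ]; rfl

lemma natDegree_hermiteH_and_coeff (n : ℕ) :
    (hermiteH n).natDegree ≤ n ∧ (hermiteH n).coeff n = 2 ^ n := by
  induction n with
  | zero => simp [hermiteH]
  | succ n ih =>
    have hd : (hermiteH (n + 1)).natDegree ≤ n + 1 := by
      refine (natDegree_sub_le _ _).trans (max_le ?_ ?_)
      · refine natDegree_mul_le.trans ?_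
        have : (2 * X : ℝ[X]).natDegree ≤ 1 := by
          refine natDegree_mul_le.trans ?_
          simp
        omega
      · exact (natDegree_derivative_le _).trans (by omega)
    refine ⟨hd, ?_⟩
    have h0 : (hermiteH n).coeff (n + 2) = 0 := coeff_eq_zero_of_natDegree_lt (by omega)
    rw [hermiteH, coeff_sub, coeff_derivative, h0, zero_mul, sub_zero, mul_assoc, coeff_ofNat_mul,
      coeff_X_mul, ih.2, pow_succ]
    ring

lemma natDegree_hermiteH (n : ℕ) : (hermiteH n).natDegree = n := by
  refine le_antisymm (natDegree_hermiteH_and_coeff n).1 (le_natDegree_of_ne_zero ?_)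
  rw [(natDegree_hermiteH_and_coeff n).2]
  positivity

lemma hermiteH_ne_zero (n : ℕ) : hermiteH n ≠ 0 := by
  intro h
  have := (natDegree_hermiteH_and_coeff n).2
  rw [h, coeff_zero] at this
  exact (by positivity : (2 : ℝ) ^ n ≠ 0) this.symm

lemma mem_nodes {m : ℕ} {r : ℝ} : r ∈ nodes m ↔ (hermiteH m).eval r = 0 := by
  rw [nodes, Multiset.mem_toFinset, mem_roots (hermiteH_ne_zero m), IsRoot.def]

/-- The recursion of the values of the Hermite polynomials at the point `x`. -/
structure IsHermiteSeq {K : Type*} [Field K] (x : K) (a : ℕ → K) : Prop where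
  zero : a 0 = 1
  one : a 1 = 2 * x
  step : ∀ n : ℕ, a (n + 2) = 2 * x * a (n + 1) - 2 * ((n : K) + 1) * a n

lemma isHermiteSeq_eval (x : ℝ) : IsHermiteSeq x fun n => (hermiteH n).eval x where
  zero := by simp [hermiteH]
  one := by simp [hermiteH]
  step n := by rw [hermiteH_succ_succ]; simp

lemma isHermiteSeq_aeval (x : ℂ) : IsHermiteSeq x fun n => aeval x (hermiteH n) where
  zero := by simp [hermiteH]
  one := by
    have h2 : aeval x (2 : Polynomial ℝ) = 2 := map_ofNat _ 2
    simp [hermiteH, h2]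
  step n := by
    have h2 : aeval x (2 : Polynomial ℝ) = 2 := map_ofNat _ 2
    rw [hermiteH_succ_succ]
    simp [h2]

/-- The Christoffel–Darboux formula. -/
lemma christoffel_darboux {K : Type*} [Field K] [CharZero K] {x y : K} {a b : ℕ → K}
    (ha : IsHermiteSeq x a) (hb : IsHermiteSeq y b) (n : ℕ) :
    (x - y) * ∑ j ∈ Finset.range (n + 1), a j * b j / (2 ^ j * j.factorial) =
      (a (n + 1) * b n - a n * b (n + 1)) / (2 ^ (n + 1) * n.factorial) := by
  induction n with
  | zero => simp [ha.zero, hb.zero, ha.one, hb.one]; ring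
  | succ n ih =>
    rw [Finset.sum_range_succ, mul_add, ih, ha.step, hb.step, Nat.factorial_succ]
    have h1 : (n.factorial : K) ≠ 0 := by exact_mod_cast n.factorial_ne_zero
    have h2 : (n : K) + 1 ≠ 0 := by exact_mod_cast n.succ_ne_zero
    push_cast
    field_simp
    ring

/-- The confluent Christoffel–Darboux formula. -/
lemma christoffel_darboux_self {K : Type*} [Field K] [CharZero K] {x : K} {a : ℕ → K}
    (ha : IsHermiteSeq x a) (n : ℕ) :
    ∑ j ∈ Finset.range (n + 1), a j * a j / (2 ^ j * j.factorial) =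
      (2 * (n + 1) * a n ^ 2 - (2 * x * a n - a (n + 1)) * a (n + 1)) /
        (2 ^ (n + 1) * n.factorial) := by
  induction n with
  | zero => simp [ha.zero, ha.one]
  | succ n ih =>
    rw [Finset.sum_range_succ, ih, ha.step, Nat.factorial_succ]
    have h1 : (n.factorial : K) ≠ 0 := by exact_mod_cast n.factorial_ne_zero
    have h2 : (n : K) + 1 ≠ 0 := by exact_mod_cast n.succ_ne_zero
    push_cast
    field_simp
    ring

lemma sum_hermite_sq_pos {x : ℝ} {a : ℕ → ℝ} (ha : IsHermiteSeq x a) (n : ℕ) :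
    0 < ∑ j ∈ Finset.range (n + 1), a j * a j / (2 ^ j * j.factorial) := by
  refine Finset.sum_pos' (fun j _ => div_nonneg (mul_self_nonneg _) (by positivity))
    ⟨0, by simp, by simp [ha.zero]⟩

/-- All complex roots of the Hermite polynomials are real. -/
lemma im_eq_zero_of_aeval_hermiteH {n : ℕ} {z : ℂ} (hz : aeval z (hermiteH (n + 1)) = 0) :
    z.im = 0 := by
  have hconj : ∀ j, aeval (starRingEnd ℂ z) (hermiteH j) = starRingEnd ℂ (aeval z (hermiteH j)) :=
    fun j => aeval_conj _ _
  -- At a root z and its conjugate the right side vanishes, while the sum has nonnegative terms and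
  -- first term 1.
  have h := christoffel_darboux (isHermiteSeq_aeval z) (isHermiteSeq_aeval (starRingEnd ℂ z)) n
  simp only [hconj, hz, map_zero, zero_mul, mul_zero, sub_zero, zero_div, Complex.mul_conj] at h
  have hsum : (∑ j ∈ Finset.range (n + 1),
      (Complex.normSq (aeval z (hermiteH j)) : ℂ) / (2 ^ j * j.factorial)) ≠ 0 := by
    have e : (∑ j ∈ Finset.range (n + 1),
        (Complex.normSq (aeval z (hermiteH j)) : ℂ) / (2 ^ j * j.factorial)) =
        ((∑ j ∈ Finset.range (n + 1),
          Complex.normSq (aeval z (hermiteH j)) / (2 ^ j * j.factorial) : ℝ) : ℂ) := by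
      push_cast; rfl
    rw [e, Complex.ofReal_ne_zero]
    refine (Finset.sum_pos' (fun j _ => div_nonneg (Complex.normSq_nonneg _) (by positivity))
      ⟨0, by simp, by simp [hermiteH]⟩).ne'
  have h2 := (mul_eq_zero.1 h).resolve_right hsum
  have h3 := congrArg Complex.im h2
  simp at h3
  linarith

/-- Two consecutive zeros at r would make the positive confluent sum vanish. -/
lemma eval_hermiteH_ne_zero_of_root {n : ℕ} {r : ℝ} (hr : (hermiteH (n + 1)).eval r = 0) :
    (hermiteH n).eval r ≠ 0 := by
  intro h
  have h1 := sum_hermite_sq_pos (isHermiteSeq_eval r) n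
  rw [christoffel_darboux_self (isHermiteSeq_eval r) n, hr, h] at h1
  simp at h1

/-- Over ℂ there are m roots with multiplicity. They are real, and simple because the derivative is
a nonzero multiple of the previous Hermite polynomial. -/
lemma card_nodes (m : ℕ) : (nodes m).card = m := by
  rcases m with _ | n
  · simp [nodes, hermiteH]
  refine le_antisymm ((Multiset.toFinset_card_le _).trans
    ((card_roots' _).trans (natDegree_hermiteH _).le)) ?_
  set p : ℂ[X] := (hermiteH (n + 1)).map (algebraMap ℝ ℂ) with hp
  have hp0 : p ≠ 0 := (Polynomial.map_ne_zero_iff (algebraMap ℝ ℂ).injective).2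
    (hermiteH_ne_zero _)
  have hroot : ∀ z : ℂ, p.IsRoot z → ∃ r : ℝ, (r : ℂ) = z ∧ (hermiteH (n + 1)).eval r = 0 := by
    intro z hz
    have h1 : aeval z (hermiteH (n + 1)) = 0 := by
      rw [aeval_def, ← eval_map]; exact hz
    have h2 : ((z.re : ℝ) : ℂ) = z :=
      Complex.ext (by simp) (by simp [im_eq_zero_of_aeval_hermiteH h1])
    refine ⟨z.re, h2, ?_⟩
    rw [← h2, ← Complex.coe_algebraMap, aeval_algebraMap_apply] at h1
    simpa using h1
  have hnodup : p.roots.Nodup := by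
    rw [Multiset.nodup_iff_count_le_one]
    intro z
    rw [count_roots]
    by_contra hcon
    obtain ⟨hz, hz'⟩ := (one_lt_rootMultiplicity_iff_isRoot hp0).1 (not_le.1 hcon)
    obtain ⟨r, rfl, hr⟩ := hroot z hz
    rw [hp, derivative_map, IsRoot.def, eval_map, ← Complex.coe_algebraMap, eval₂_at_apply,
      derivative_hermiteH_succ] at hz'
    have h3 := (map_eq_zero (algebraMap ℝ ℂ)).1 hz'
    simp only [eval_mul, eval_add, eval_ofNat, eval_natCast, eval_one, mul_eq_zero] at h3
    rcases h3 with h3 | h3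
    · have : (0 : ℝ) < (n : ℝ) + 1 := by positivity
      rcases h3 with h3 | h3
      · norm_num at h3
      · linarith
    · exact eval_hermiteH_ne_zero_of_root hr h3
  have hcard : p.roots.toFinset.card = n + 1 := by
    rw [Multiset.toFinset_card_of_nodup hnodup, IsAlgClosed.card_roots_eq_natDegree, hp,
      natDegree_map, natDegree_hermiteH]
  have hsub : p.roots.toFinset ⊆ (nodes (n + 1)).image (fun r : ℝ => (r : ℂ)) := by
    intro z hz
    obtain ⟨r, hr, hr'⟩ := hroot z (isRoot_of_mem_roots (Multiset.mem_toFinset.1 hz))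
    exact Finset.mem_image.2 ⟨r, mem_nodes.2 hr', hr⟩
  calc n + 1 = p.roots.toFinset.card := hcard.symm
    _ ≤ _ := Finset.card_le_card hsub
    _ ≤ _ := Finset.card_image_le

lemma nodeWeight_nonneg (m : ℕ) (r : ℝ) : 0 ≤ nodeWeight m r := by
  rw [nodeWeight]; positivity

/-- At a node the confluent formula keeps only its H_n² term, which is the reciprocal of the weight.
-/
lemma nodeWeight_mul_sum {n : ℕ} {r : ℝ} (hr : (hermiteH (n + 1)).eval r = 0) :
    nodeWeight (n + 1) r * ∑ j ∈ Finset.range (n + 1),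
      (hermiteH j).eval r * (hermiteH j).eval r / (2 ^ j * j.factorial) = 1 := by
  have h := eval_hermiteH_ne_zero_of_root hr
  rw [christoffel_darboux_self (isHermiteSeq_eval r) n, hr, nodeWeight, Nat.add_sub_cancel,
    Nat.factorial_succ]
  have h1 : (n.factorial : ℝ) ≠ 0 := by exact_mod_cast n.factorial_ne_zero
  push_cast
  field_simp
  ring

/-- The quadrature rule integrates the Hermite polynomials of degree below `m` exactly. -/
lemma sum_nodeWeight_hermite {m j : ℕ} (hj : j < m) :
    ∑ r ∈ nodes m, nodeWeight m r * (hermiteH j).eval r = if j = 0 then 1 else 0 := by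
  obtain ⟨n, rfl⟩ : ∃ n, m = n + 1 := ⟨m - 1, by omega⟩
  let U : Matrix (nodes (n + 1)) (Fin (n + 1)) ℝ :=
    Matrix.of fun r i => nodeWeight (n + 1) r * (hermiteH i).eval (r : ℝ)
  let W : Matrix (Fin (n + 1)) (nodes (n + 1)) ℝ :=
    Matrix.of fun i r => (hermiteH i).eval (r : ℝ) / (2 ^ (i : ℕ) * (i : ℕ).factorial)
  -- Christoffel–Darboux at pairs of nodes. The matrices are square because there are exactly n+1
  -- nodes, so W U = 1 too, and its row 0 is exactness, as H_0 = 1.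
  have hUW : U * W = 1 := by
    ext r s
    have hr := mem_nodes.1 r.2
    have hs := mem_nodes.1 s.2
    have e : (U * W) r s = nodeWeight (n + 1) r * ∑ j ∈ Finset.range (n + 1),
        (hermiteH j).eval (r : ℝ) * (hermiteH j).eval (s : ℝ) / (2 ^ j * j.factorial) := by
      rw [Matrix.mul_apply, Finset.mul_sum, Finset.sum_range]
      exact Finset.sum_congr rfl fun i _ => by simp only [U, W, Matrix.of_apply]; ring
    rw [e, Matrix.one_apply]
    split_ifs with h
    · subst h
      exact nodeWeight_mul_sum hr
    · have hcd := christoffel_darboux (isHermiteSeq_eval (r : ℝ)) (isHermiteSeq_eval (s : ℝ)) n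
      rw [hr, hs] at hcd
      simp only [zero_mul, mul_zero, sub_zero, zero_div] at hcd
      have hne : (r : ℝ) - s ≠ 0 := sub_ne_zero.2 fun h' => h (Subtype.ext h')
      rw [(mul_eq_zero.1 hcd).resolve_left hne, mul_zero]
  have hWU : W * U = 1 := by
    have he : Fintype.card (nodes (n + 1)) = Fintype.card (Fin (n + 1)) := by
      rw [Fintype.card_coe, card_nodes, Fintype.card_fin]
    exact (Matrix.mul_eq_one_comm_of_equiv (Fintype.equivOfCardEq he)).1 hUW
  have h := congrFun (congrFun hWU 0) ⟨j, hj⟩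
  rw [Matrix.mul_apply] at h
  have e : ∑ r : nodes (n + 1), W 0 r * U r ⟨j, hj⟩ =
      ∑ r ∈ nodes (n + 1), nodeWeight (n + 1) r * (hermiteH j).eval r := by
    rw [← Finset.sum_coe_sort (nodes (n + 1))]
    exact Finset.sum_congr rfl fun r _ => by simp [U, W, hermiteH]
  rw [← e, h, Matrix.one_apply]
  congr 1
  simp [Fin.ext_iff, eq_comm]

end Hermite

/-! ### Moments of the quadrature rule. -/

section Moments

/-- The coefficient of `H_j` in the expansion of `x^n`, computed with the polynomials of degree
below `m` only. -/
noncomputable def truncCoeff (m : ℕ) : ℕ → ℕ → ℝ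
  | 0, j => if j = 0 then 1 else 0
  | n + 1, j => if j < m then
      (if j = 0 then 0 else truncCoeff m n (j - 1) / 2) + (j + 1) * truncCoeff m n (j + 1) else 0

/-- The coefficient of `H_j` in the expansion of `x^n`. -/
noncomputable def hermiteCoeff : ℕ → ℕ → ℝ
  | 0, j => if j = 0 then 1 else 0
  | n + 1, j =>
      (if j = 0 then 0 else hermiteCoeff n (j - 1) / 2) + (j + 1) * hermiteCoeff n (j + 1)

/-- Truncation only discards nonnegative contributions of the recursion. -/
lemma truncCoeff_bounds (m n j : ℕ) :
    0 ≤ truncCoeff m n j ∧ truncCoeff m n j ≤ hermiteCoeff n j := by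
  induction n generalizing j with
  | zero => simp only [truncCoeff, hermiteCoeff, le_refl, and_true]; split_ifs <;> norm_num
  | succ n ih =>
    have h1 := ih (j - 1)
    have h2 := ih (j + 1)
    have h3 : 0 ≤ ((j : ℝ) + 1) * truncCoeff m n (j + 1) := mul_nonneg (by positivity) h2.1
    have h4 : ((j : ℝ) + 1) * truncCoeff m n (j + 1) ≤ (j + 1) * hermiteCoeff n (j + 1) :=
      mul_le_mul_of_nonneg_left h2.2 (by positivity)
    simp only [truncCoeff, hermiteCoeff]
    split_ifs <;> constructor <;> linarith

lemma hermiteCoeff_eq_zero {n j : ℕ} (h : n < j) : hermiteCoeff n j = 0 := by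
  induction n generalizing j with
  | zero => simp [hermiteCoeff, Nat.pos_iff_ne_zero.1 h]
  | succ n ih =>
    rw [hermiteCoeff, ih (by omega), ih (by omega)]
    simp

/-- The recursion counts weighted paths with steps ±1 in the degree. A path from 0 to j through
degree m needs at least 2m − j steps, so none is lost here; for j = 0 this is exactness up to degree
2m − 1. -/
lemma truncCoeff_eq {m n j : ℕ} (h : n + j < 2 * m) : truncCoeff m n j = hermiteCoeff n j := by
  induction n generalizing j with
  | zero => rfl
  | succ n ih =>
    by_cases hj : j < m
    · rw [truncCoeff, hermiteCoeff, if_pos hj, ih (by omega), ih (by omega)]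
    · rw [truncCoeff, if_neg hj, hermiteCoeff_eq_zero (by omega)]

lemma truncCoeff_eq_zero {m n j : ℕ} (hm : 1 ≤ m) (h : m ≤ j) : truncCoeff m n j = 0 := by
  cases n with
  | zero => rw [truncCoeff, if_neg (by omega)]
  | succ n => rw [truncCoeff, if_neg (by omega)]

lemma hermiteCoeff_odd {n j : ℕ} (h : (n + j) % 2 = 1) : hermiteCoeff n j = 0 := by
  induction n generalizing j with
  | zero =>
    have : j ≠ 0 := by rintro rfl; simp at h
    simp [hermiteCoeff, this]
  | succ n ih =>
    rw [hermiteCoeff, ih (j := j + 1) (by omega), mul_zero, add_zero]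
    split_ifs with hj
    · rfl
    · rw [ih (j := j - 1) (by omega), zero_div]

lemma hermiteCoeff_closed (n j k : ℕ) (h : n = j + 2 * k) :
    hermiteCoeff n j = n.factorial / (2 ^ n * k.factorial * j.factorial) := by
  induction n generalizing j k with
  | zero =>
    obtain ⟨rfl, rfl⟩ : j = 0 ∧ k = 0 := by omega
    simp [hermiteCoeff]
  | succ n ih =>
    have hk : ((j : ℝ) + 1) * hermiteCoeff n (j + 1) =
        n.factorial * (2 * k) / (2 ^ (n + 1) * k.factorial * j.factorial) := by
      rcases k with _ | k
      · rw [hermiteCoeff_eq_zero (by omega)]; simp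
      · rw [ih (j + 1) k (by omega), Nat.factorial_succ k, Nat.factorial_succ j]
        push_cast
        have h1 : (k.factorial : ℝ) ≠ 0 := by positivity
        have h2 : (j.factorial : ℝ) ≠ 0 := by positivity
        field_simp
        ring
    have hj : (if j = 0 then 0 else hermiteCoeff n (j - 1) / 2) =
        n.factorial * j / (2 ^ (n + 1) * k.factorial * j.factorial) := by
      rcases j with _ | j
      · simp
      · rw [if_neg (by omega), Nat.add_sub_cancel, ih j k (by omega), Nat.factorial_succ j]
        push_cast
        have h1 : (k.factorial : ℝ) ≠ 0 := by positivity
        have h2 : (j.factorial : ℝ) ≠ 0 := by positivity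
        field_simp
        ring
    rw [hermiteCoeff, hk, hj, Nat.factorial_succ, ← add_div]
    congr 1
    have : (n : ℝ) + 1 = j + 2 * k := by exact_mod_cast h
    push_cast
    rw [this]
    ring

/-- Powers of a node in terms of the Hermite polynomials of lower degree. -/
lemma pow_eq_sum_truncCoeff {m : ℕ} (hm : 1 ≤ m) {r : ℝ} (hr : (hermiteH m).eval r = 0) (n : ℕ) :
    r ^ n = ∑ j ∈ Finset.range m, truncCoeff m n j * (hermiteH j).eval r := by
  set a : ℕ → ℝ := fun n => (hermiteH n).eval r with ha
  have hH := isHermiteSeq_eval r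
  rw [← ha] at hH
  obtain ⟨M, rfl⟩ : ∃ M, m = M + 1 := ⟨m - 1, by omega⟩
  induction n with
  | zero =>
    rw [Finset.sum_eq_single 0]
    · simp [truncCoeff, hermiteH]
    · intro j _ hj; simp [truncCoeff, hj]
    · simp
  | succ n ih =>
    -- Three-term recurrence; for j = 0 the truncated index j − 1 is harmless because its
    -- coefficient is 0.
    have hx : ∀ j, r * a j = a (j + 1) / 2 + j * a (j - 1) := by
      intro j
      rcases j with _ | j
      · simp [hH.zero, hH.one]
      · rw [hH.step, Nat.add_sub_cancel]; push_cast; ring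
    rw [pow_succ, ih, Finset.sum_mul]
    have h1 : ∑ j ∈ Finset.range (M + 1), truncCoeff (M + 1) n j * (hermiteH j).eval r * r =
        ∑ j ∈ Finset.range (M + 1), truncCoeff (M + 1) n j / 2 * a (j + 1) +
        ∑ j ∈ Finset.range (M + 1), truncCoeff (M + 1) n j * j * a (j - 1) := by
      rw [← Finset.sum_add_distrib]
      refine Finset.sum_congr rfl fun j _ => ?_
      rw [mul_assoc, mul_comm _ r]
      change _ * (r * a j) = _
      rw [hx]; ring
    have h2 : ∑ j ∈ Finset.range (M + 1), truncCoeff (M + 1) (n + 1) j * (hermiteH j).eval r =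
        ∑ j ∈ Finset.range (M + 1), (if j = 0 then 0 else truncCoeff (M + 1) n (j - 1) / 2) * a j +
        ∑ j ∈ Finset.range (M + 1), ((j : ℝ) + 1) * truncCoeff (M + 1) n (j + 1) * a j := by
      rw [← Finset.sum_add_distrib]
      refine Finset.sum_congr rfl fun j hj => ?_
      rw [truncCoeff, if_pos (Finset.mem_range.1 hj), add_mul]
    rw [h1, h2]
    congr 1
    -- Multiplication by r lifts the top polynomial to H_m, which vanishes at the node; hence
    -- degrees below m suffice.
    · rw [Finset.sum_range_succ, Finset.sum_range_succ', show a (M + 1) = 0 from hr]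
      simp
    · rw [Finset.sum_range_succ', Finset.sum_range_succ, truncCoeff_eq_zero hm le_rfl]
      simp only [Nat.cast_zero, mul_zero, zero_mul, add_zero, Nat.add_sub_cancel]
      refine Finset.sum_congr rfl fun j _ => ?_
      push_cast; ring

/-- Exactness below degree m extracts the coefficient of H_0. -/
lemma sum_nodeWeight_pow {m : ℕ} (hm : 1 ≤ m) (n : ℕ) :
    ∑ r ∈ nodes m, nodeWeight m r * r ^ n = truncCoeff m n 0 := by
  have h1 : ∑ r ∈ nodes m, nodeWeight m r * r ^ n = ∑ j ∈ Finset.range m, truncCoeff m n j *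
      ∑ r ∈ nodes m, nodeWeight m r * (hermiteH j).eval r := by
    simp only [Finset.mul_sum]
    rw [Finset.sum_comm]
    refine Finset.sum_congr rfl fun r hr => ?_
    rw [pow_eq_sum_truncCoeff hm (mem_nodes.1 hr), Finset.mul_sum]
    exact Finset.sum_congr rfl fun j _ => by ring
  rw [h1, Finset.sum_eq_single 0]
  · rw [sum_nodeWeight_hermite (by omega)]; simp
  · intro j hj hj0
    rw [sum_nodeWeight_hermite (Finset.mem_range.1 hj), if_neg hj0, mul_zero]
  · intro h
    exact absurd (Finset.mem_range.2 (by omega)) h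

lemma sum_nodeWeight {m : ℕ} (hm : 1 ≤ m) : ∑ r ∈ nodes m, nodeWeight m r = 1 := by
  simpa [truncCoeff] using sum_nodeWeight_pow hm 0

/-- All odd moments vanish, by parity of the Hermite coefficients, so symmetry of the nodes is not
needed. -/
lemma sum_nodeWeight_sin {m : ℕ} (hm : 1 ≤ m) (θ : ℝ) :
    ∑ r ∈ nodes m, nodeWeight m r * Real.sin (θ * r) = 0 := by
  have h1 : HasSum (fun k : ℕ => ∑ r ∈ nodes m, nodeWeight m r *
      ((-1) ^ k * (θ * r) ^ (2 * k + 1) / (2 * k + 1).factorial))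
      (∑ r ∈ nodes m, nodeWeight m r * Real.sin (θ * r)) :=
    hasSum_sum fun r _ => (Real.hasSum_sin (θ * r)).mul_left _
  have h2 : (fun k : ℕ => ∑ r ∈ nodes m, nodeWeight m r *
      ((-1) ^ k * (θ * r) ^ (2 * k + 1) / (2 * k + 1).factorial)) = fun _ => 0 := by
    ext k
    have h3 : truncCoeff m (2 * k + 1) 0 = 0 := by
      have h4 := truncCoeff_bounds m (2 * k + 1) 0
      rw [hermiteCoeff_odd (by omega)] at h4
      exact le_antisymm h4.2 h4.1
    rw [← sum_nodeWeight_pow hm] at h3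
    calc _ = ((-1) ^ k * θ ^ (2 * k + 1) / (2 * k + 1).factorial) *
          ∑ r ∈ nodes m, nodeWeight m r * r ^ (2 * k + 1) := by
          rw [Finset.mul_sum]
          exact Finset.sum_congr rfl fun r _ => by rw [mul_pow]; ring
      _ = 0 := by rw [h3, mul_zero]
  rw [h2] at h1
  exact h1.unique hasSum_zero

/-- The error of the quadrature rule for a cosine. -/
lemma abs_sum_nodeWeight_cos_sub_le {m : ℕ} (hm : 1 ≤ m) (θ : ℝ) :
    |∑ r ∈ nodes m, nodeWeight m r * Real.cos (θ * r) - Real.exp (-(θ ^ 2 / 4))| ≤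
      (θ ^ 2 / 4) ^ m / m.factorial * Real.exp (θ ^ 2 / 4) := by
  set x := θ ^ 2 / 4 with hx
  have hx0 : 0 ≤ x := by positivity
  have h1 : HasSum (fun k : ℕ => ∑ r ∈ nodes m, nodeWeight m r *
      ((-1) ^ k * (θ * r) ^ (2 * k) / (2 * k).factorial))
      (∑ r ∈ nodes m, nodeWeight m r * Real.cos (θ * r)) :=
    hasSum_sum fun r _ => (Real.hasSum_cos (θ * r)).mul_left _
  have h2 : HasSum (fun k : ℕ => (-x) ^ k / k.factorial) (Real.exp (-x)) := by
    rw [Real.exp_eq_exp_ℝ]; exact NormedSpace.expSeries_div_hasSum_exp (-x)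
  have h3 : HasSum (fun k : ℕ => x ^ k / k.factorial) (Real.exp x) := by
    rw [Real.exp_eq_exp_ℝ]; exact NormedSpace.expSeries_div_hasSum_exp x
  -- Summable majorant of the series of errors: nothing for k < m by exactness, and afterwards
  -- x^k/k! ≤ (x^m/m!) x^{k−m}/(k−m)!.
  set g : ℕ → ℝ := fun k => if k < m then 0 else x ^ m / m.factorial *
    (x ^ (k - m) / (k - m).factorial) with hg
  have hgsum : HasSum g (x ^ m / m.factorial * Real.exp x) := by
    have h4 := (hasSum_nat_add_iff (f := g) m (g := x ^ m / m.factorial * Real.exp x)).1 (by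
      have : (fun k => g (k + m)) = fun k => x ^ m / m.factorial * (x ^ k / k.factorial) := by
        ext k; simp [hg]
      rw [this]
      exact h3.mul_left _)
    have h5 : ∑ i ∈ Finset.range m, g i = 0 :=
      Finset.sum_eq_zero fun i hi => if_pos (Finset.mem_range.1 hi)
    rwa [h5, add_zero] at h4
  refine (h1.sub h2).norm_le_of_bounded hgsum fun k => ?_
  have hterm : ∑ r ∈ nodes m, nodeWeight m r *
      ((-1) ^ k * (θ * r) ^ (2 * k) / (2 * k).factorial) =
      (-1) ^ k * θ ^ (2 * k) / (2 * k).factorial * truncCoeff m (2 * k) 0 := by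
    rw [← sum_nodeWeight_pow hm, Finset.mul_sum]
    exact Finset.sum_congr rfl fun r _ => by rw [mul_pow]; ring
  have hcoeff : θ ^ (2 * k) / (2 * k).factorial * hermiteCoeff (2 * k) 0 = x ^ k / k.factorial := by
    rw [hermiteCoeff_closed (2 * k) 0 k (by omega), hx, div_pow, ← pow_mul, pow_mul 2 2 k]
    have e1 : ((2 * k).factorial : ℝ) ≠ 0 := by positivity
    have e2 : (k.factorial : ℝ) ≠ 0 := by positivity
    norm_num
    field_simp
  have hdiff : ∑ r ∈ nodes m, nodeWeight m r *
      ((-1) ^ k * (θ * r) ^ (2 * k) / (2 * k).factorial) - (-x) ^ k / k.factorial =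
      (-1) ^ k * (θ ^ (2 * k) / (2 * k).factorial *
        (truncCoeff m (2 * k) 0 - hermiteCoeff (2 * k) 0)) := by
    rw [hterm, mul_sub, hcoeff, neg_pow x]; ring
  rw [hdiff, norm_mul, norm_pow, norm_neg, norm_one, one_pow, one_mul]
  by_cases hk : k < m
  · rw [truncCoeff_eq (by omega), sub_self, mul_zero, norm_zero]
    simp [hg, hk]
  · have hb := truncCoeff_bounds m (2 * k) 0
    have hθ : 0 ≤ θ ^ (2 * k) / (2 * k).factorial := by rw [pow_mul]; positivity
    rw [norm_mul, Real.norm_of_nonneg hθ, Real.norm_eq_abs]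
    -- Both coefficients are nonnegative and the truncated one is the smaller, so the error is at
    -- most the true moment.
    have habs : |truncCoeff m (2 * k) 0 - hermiteCoeff (2 * k) 0| ≤ hermiteCoeff (2 * k) 0 := by
      rw [abs_le]; constructor <;> linarith [hb.1, hb.2]
    refine (mul_le_mul_of_nonneg_left habs hθ).trans ?_
    rw [hcoeff, hg]
    simp only [if_neg hk]
    obtain ⟨i, rfl⟩ : ∃ i, k = m + i := ⟨k - m, by omega⟩
    rw [Nat.add_sub_cancel_left, pow_add, div_mul_div_comm]
    refine div_le_div_of_nonneg_left (by positivity) (by positivity) ?_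
    exact_mod_cast Nat.le_of_dvd (Nat.factorial_pos _)
      (Nat.factorial_mul_factorial_dvd_factorial_add m i)

end Moments

/-! ### Quadrature Fourier features of the squared exponential kernel. -/

section Quadrature

/-- Real part of a product of sums of complex exponentials; each factor is real because its sine sum
vanishes. -/
lemma sum_prod_mul_cos_sum {ι α : Type*} [Fintype ι] [DecidableEq ι] [Fintype α] (w x : α → ℝ)
    (θ : ι → ℝ) (h : ∀ j, ∑ a, w a * Real.sin (θ j * x a) = 0) :
    ∑ ρ : ι → α, (∏ j, w (ρ j)) * Real.cos (∑ j, θ j * x (ρ j)) =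
      ∏ j, ∑ a, w a * Real.cos (θ j * x a) := by
  have hexp : ∀ (c t : ℝ), (c : ℂ) * Complex.exp (t * Complex.I) =
      ((c * Real.cos t : ℝ) : ℂ) + ((c * Real.sin t : ℝ) : ℂ) * Complex.I := by
    intro c t
    rw [Complex.exp_mul_I]
    push_cast
    ring
  have h1 : ∏ j, ∑ a, (w a : ℂ) * Complex.exp ((θ j * x a : ℝ) * Complex.I) =
      ((∏ j, ∑ a, w a * Real.cos (θ j * x a) : ℝ) : ℂ) := by
    rw [Complex.ofReal_prod]
    refine Finset.prod_congr rfl fun j _ => ?_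
    simp_rw [hexp]
    rw [Finset.sum_add_distrib, ← Finset.sum_mul, ← Complex.ofReal_sum, ← Complex.ofReal_sum, h j]
    simp
  have h2 : ∏ j, ∑ a, (w a : ℂ) * Complex.exp ((θ j * x a : ℝ) * Complex.I) =
      ∑ ρ : ι → α, ((∏ j, w (ρ j) : ℝ) : ℂ) *
        Complex.exp ((∑ j, θ j * x (ρ j) : ℝ) * Complex.I) := by
    rw [Fintype.prod_sum]
    refine Finset.sum_congr rfl fun ρ _ => ?_
    rw [Finset.prod_mul_distrib, ← Complex.exp_sum, Complex.ofReal_prod, Complex.ofReal_sum,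
      Finset.sum_mul]
  rw [h1] at h2
  simp_rw [hexp] at h2
  have h3 := congrArg Complex.re h2
  rw [Complex.ofReal_re, Complex.re_sum] at h3
  rw [h3]
  refine Finset.sum_congr rfl fun ρ _ => ?_
  rw [Complex.add_re, Complex.ofReal_re, Complex.re_ofReal_mul, Complex.I_re, mul_zero, add_zero]

/-- The cosine and sine features of a node combine to the cosine of the difference, and the grid sum
factorizes over coordinates. -/
lemma qff_dotProduct {d m : ℕ} (hm : 1 ≤ m) (l : ℝ) (z z' : cube d) :
    qff d l m z ⬝ᵥ qff d l m z' = ∏ j, ∑ r ∈ nodes m, nodeWeight m r *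
      Real.cos (√2 / l * ((z : EuclideanSpace ℝ (Fin d)) j -
        (z' : EuclideanSpace ℝ (Fin d)) j) * r) := by
  set θ : Fin d → ℝ := fun j => √2 / l * ((z : EuclideanSpace ℝ (Fin d)) j -
    (z' : EuclideanSpace ℝ (Fin d)) j) with hθ
  have h1 := sum_prod_mul_cos_sum (fun r : nodes m => nodeWeight m r) (fun r => (r : ℝ)) θ
    fun j => by
      rw [Finset.sum_coe_sort (nodes m) fun r => nodeWeight m r * Real.sin (θ j * r)]
      exact sum_nodeWeight_sin hm _
  have h2 : ∀ j, ∑ r : nodes m, nodeWeight m r * Real.cos (θ j * r) =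
      ∑ r ∈ nodes m, nodeWeight m r * Real.cos (θ j * r) := fun j =>
    Finset.sum_coe_sort (nodes m) fun r => nodeWeight m r * Real.cos (θ j * r)
  simp_rw [h2] at h1
  rw [← h1, dotProduct, Fintype.sum_prod_type]
  refine Finset.sum_congr rfl fun ρ _ => ?_
  have h3 : ∑ j, θ j * (ρ j : ℝ) =
      √2 / l * ∑ j, (ρ j : ℝ) * (z : EuclideanSpace ℝ (Fin d)) j -
        √2 / l * ∑ j, (ρ j : ℝ) * (z' : EuclideanSpace ℝ (Fin d)) j := by
    rw [← mul_sub, ← Finset.sum_sub_distrib, Finset.mul_sum]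
    exact Finset.sum_congr rfl fun j _ => by rw [hθ]; ring
  have h4 : √(∏ j, nodeWeight m (ρ j)) * √(∏ j, nodeWeight m (ρ j)) = ∏ j, nodeWeight m (ρ j) :=
    Real.mul_self_sqrt (Finset.prod_nonneg fun j _ => nodeWeight_nonneg m _)
  rw [h3, Real.cos_sub, ← h4, Fintype.sum_bool]
  simp only [qff, if_true, Bool.false_eq_true, if_false]
  ring

lemma abs_prod_sub_prod_le {ι : Type*} (s : Finset ι) (a b : ι → ℝ) (ha : ∀ j, |a j| ≤ 1)
    (hb : ∀ j, |b j| ≤ 1) : |∏ j ∈ s, a j - ∏ j ∈ s, b j| ≤ ∑ j ∈ s, |a j - b j| := by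
  classical
  induction s using Finset.induction_on with
  | empty => simp
  | insert i s hi ih =>
    rw [Finset.prod_insert hi, Finset.prod_insert hi, Finset.sum_insert hi]
    have hP : |∏ j ∈ s, b j| ≤ 1 := by
      rw [Finset.abs_prod]; exact Finset.prod_le_one (fun j _ => abs_nonneg _) fun j _ => hb j
    calc |a i * ∏ j ∈ s, a j - b i * ∏ j ∈ s, b j|
        = |a i * (∏ j ∈ s, a j - ∏ j ∈ s, b j) + (a i - b i) * ∏ j ∈ s, b j| := by ring_nf
      _ ≤ |a i| * |∏ j ∈ s, a j - ∏ j ∈ s, b j| + |a i - b i| * |∏ j ∈ s, b j| := by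
        rw [← abs_mul, ← abs_mul]; exact abs_add_le _ _
      _ ≤ 1 * ∑ j ∈ s, |a j - b j| + |a i - b i| * 1 := by
        gcongr
        exact ha i
      _ = _ := by ring

lemma seKernel_eq_prod {d : ℕ} (l : ℝ) (z z' : cube d) :
    seKernel l z z' = ∏ j, Real.exp (-((√2 / l * ((z : EuclideanSpace ℝ (Fin d)) j -
      (z' : EuclideanSpace ℝ (Fin d)) j)) ^ 2 / 4)) := by
  rw [seKernel, ← Real.exp_sum, EuclideanSpace.norm_sq_eq, neg_div, Finset.sum_div,
    ← Finset.sum_neg_distrib]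
  refine congrArg Real.exp (Finset.sum_congr rfl fun j _ => ?_)
  rw [mul_pow, div_pow, Real.sq_sqrt zero_le_two, PiLp.sub_apply, Real.norm_eq_abs, sq_abs]
  rcases eq_or_ne l 0 with rfl | hl
  · simp
  · field_simp
    norm_num

/-- The factorial beats any geometric rate: (4c/e)^m/m! is at most exp(4c/e). -/
lemma pow_div_factorial_le_rate (m : ℕ) {c : ℝ} (hc : 0 ≤ c) :
    c ^ m / m.factorial ≤ Real.exp (4 * c / Real.exp 1) * (Real.exp 1 / 4) ^ m := by
  have h1 := Real.pow_div_factorial_le_exp (4 * c / Real.exp 1) (by positivity) m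
  have h2 : c ^ m / m.factorial =
      (4 * c / Real.exp 1) ^ m / m.factorial * (Real.exp 1 / 4) ^ m := by
    rw [div_mul_eq_mul_div, ← mul_pow]
    congr 2
    field_simp
  rw [h2]
  gcongr

/-- The quadrature Fourier features approximate the squared exponential kernel at the rate
`(e/4)^m`. -/
lemma abs_seKernel_sub_qff_le {d m : ℕ} (hm : 1 ≤ m) {l : ℝ} (hl : 0 < l) (z z' : cube d) :
    |seKernel l z z' - qff d l m z ⬝ᵥ qff d l m z'| ≤
      d * (Real.exp (4 * (1 / (2 * l ^ 2)) / Real.exp 1) * Real.exp (1 / (2 * l ^ 2))) *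
        (Real.exp 1 / 4) ^ m := by
  set c := 1 / (2 * l ^ 2) with hc
  have hc0 : 0 ≤ c := by positivity
  rw [seKernel_eq_prod, qff_dotProduct hm]
  set θ : Fin d → ℝ := fun j => √2 / l * ((z : EuclideanSpace ℝ (Fin d)) j -
    (z' : EuclideanSpace ℝ (Fin d)) j) with hθ
  refine (abs_prod_sub_prod_le _ _ _ (fun j => ?_) fun j => ?_).trans ?_
  · rw [Real.abs_exp]
    exact Real.exp_le_one_iff.2 (neg_nonpos.2 (by positivity))
  · refine (Finset.abs_sum_le_sum_abs _ _).trans ?_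
    rw [← sum_nodeWeight hm]
    refine Finset.sum_le_sum fun r _ => ?_
    rw [abs_mul, abs_of_nonneg (nodeWeight_nonneg m r)]
    exact mul_le_of_le_one_right (nodeWeight_nonneg m r) (Real.abs_cos_le_one _)
  · have hj : ∀ j ∈ (Finset.univ : Finset (Fin d)),
        |Real.exp (-(θ j ^ 2 / 4)) - ∑ r ∈ nodes m, nodeWeight m r * Real.cos (θ j * r)| ≤
          Real.exp (4 * c / Real.exp 1) * Real.exp c * (Real.exp 1 / 4) ^ m := by
      intro j _
      rw [abs_sub_comm]
      have hu : ((z : EuclideanSpace ℝ (Fin d)) j - (z' : EuclideanSpace ℝ (Fin d)) j) ^ 2 ≤ 1 := by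
        have h1 := z.2 j
        have h2 := z'.2 j
        rw [sq_le_one_iff_abs_le_one, abs_le]
        constructor <;> linarith [h1.1, h1.2, h2.1, h2.2]
      -- Coordinates of points of the unit cube differ by at most 1, which makes the constant
      -- independent of the points.
      have hle : θ j ^ 2 / 4 ≤ c := by
        have : θ j ^ 2 / 4 = c * ((z : EuclideanSpace ℝ (Fin d)) j -
            (z' : EuclideanSpace ℝ (Fin d)) j) ^ 2 := by
          rw [hθ, hc]
          simp only [mul_pow, div_pow, Real.sq_sqrt zero_le_two]
          field_simp
          ring
        rw [this]
        exact mul_le_of_le_one_right hc0 hu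
      calc _ ≤ (θ j ^ 2 / 4) ^ m / m.factorial * Real.exp (θ j ^ 2 / 4) :=
            abs_sum_nodeWeight_cos_sub_le hm _
        _ ≤ c ^ m / m.factorial * Real.exp c := by gcongr
        _ ≤ Real.exp (4 * c / Real.exp 1) * (Real.exp 1 / 4) ^ m * Real.exp c := by
            gcongr
            exact pow_div_factorial_le_rate m hc0
        _ = _ := by ring
    refine (Finset.sum_le_card_nsmul _ _ _ hj).trans_eq ?_
    rw [Finset.card_univ, Fintype.card_fin, nsmul_eq_mul]
    ring

lemma card_qff_index (d m : ℕ) : Fintype.card ((Fin d → nodes m) × Bool) ≤ 2 * m ^ d := by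
  rw [Fintype.card_prod, Fintype.card_fun, Fintype.card_coe, card_nodes, Fintype.card_fin,
    Fintype.card_bool, mul_comm]

lemma continuous_seKernel (d : ℕ) (l : ℝ) :
    Continuous fun z : cube d × cube d => seKernel l z.1 z.2 := by
  unfold seKernel
  fun_prop

end Quadrature

end WGP

/-! ### The general kernel and the squared exponential kernel. -/

theorem corollary1 (d : ℕ) (lam R B : ℝ) (hlam : 0 < lam) (hR : 0 ≤ R) (hB : 0 ≤ B) :
    (∀ (D : Set (EuclideanSpace ℝ (Fin d))) (_ : IsCompact D) (k : D → D → ℝ)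
      (_ : Continuous fun z : D × D => k z.1 z.2) (_ : ∀ z, k z z ≤ 1)
      (ι : ℕ → Type) [∀ m, Fintype (ι m)] (_ : ∀ m, Fintype.card (ι m) ≤ 2 * m ^ d)
      (φ : ∀ m, D → ι m → ℝ) (C₀ : ℝ)
      (_ : ∀ m, 1 ≤ m → ∀ z z', |k z z' - φ m z ⬝ᵥ φ m z'| ≤ C₀ * (Real.exp 1 / 4) ^ m),
      WGP.RegretOrder.{u, v} k φ lam R B) ∧
    (∀ l : ℝ, 0 < l →
      WGP.RegretOrder.{u, v} (WGP.seKernel (d := d) l) (WGP.qff d l) lam R B) := by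
  refine ⟨fun D _ k hk hk1 ι _ hcard φ C₀ hC₀ => ?_, fun l hl => ?_⟩
  · exact WGP.regretOrder_of_features hk hk1 hcard hC₀ hlam hR hB
  · exact WGP.regretOrder_of_features (WGP.continuous_seKernel d l)
      (fun z => by simp [WGP.seKernel]) (WGP.card_qff_index d)
      (fun m hm z z' => WGP.abs_seKernel_sub_qff_le hm hl z z') hlam hR hB
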